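/- Let $\triangle\subset\mathbb R^n$ be a reflexive lattice polytope (a lattice polytope with $0$ in its interior whose polar dual $\triangle^\vee=\{u:\langle u,v\rangle\ge -1\ \forall v\in\triangle\}$ is a lattice polytope). Let $X^\vee$ be the complex toric variety of the fan $\Sigma_\triangle$ of cones over the proper faces of $\triangle$. Let $\mathcal T$ be a regular projective triangulation of $\triangle$: a finite triangulation with lattice points as vertices such that $0$ is a vertex of every maximal simplex, every maximal simplex is unimodular, and there is a strictly convex $\mathcal T$-piecewise linear function on $\triangle$. Let $\widetilde{X^\vee_{\mathcal T}}$ be the toric variety of the fan $\Sigma_{\triangle,\mathcal T}$ of cones over the simplices of $\mathcal T$, and let $\pi^\vee:\widetilde{X^\vee_{\mathcal T}}\to X^\vee$ be the toric morphism given by the subdivision $\Sigma_{\triangle,\mathcal T}$ of $\Sigma_\triangle$. Let $D_1,\dots,D_p$ be the torus-invariant prime divisors of $\widetilde{X^\vee_{\mathcal T}}$ (one for each nonzero vertex of $\mathcal T$) and $D_0=-\sum_{i=1}^p D_i$. Let $Y^\vee\subset X^\vee$ be a $\triangle^\vee$-regular anticanonical hypersurface, that is, the zero divisor of the section of $-\omega_{X^\vee}$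 given by a Laurent polynomial $f=\sum_{m\in\triangle^\vee\cap\mathbb Z^n}c_m t^m$ such that for every nonempty face $\Gamma$ of $\triangle^\vee$ (including $\triangle^\vee$ itself) the polynomial $f_\Gamma=\sum_{m\in\Gamma\cap\mathbb Z^n}c_m t^m$ and all $t_j\,\partial f_\Gamma/\partial t_j$ have no common zero in $(\mathbb C^*)^n$. All cohomology is sheaf cohomology for the classical topology, and $[D]$ denotes the cohomology class of a Cartier divisor $D$ (the first Chern class of $\mathcal O(D)$). For a field $k$ and a complex $F^\bullet$ in the bounded below derived category of sheaves of $k$-vector spaces on a space $Z$, put $\mathbb H^i(Z,F^\bullet)=\mathrm{Hom}(\underline k_Z,F^\bullet[i])$; a class $\omega\in H^2(Z,k)=\mathrm{Hom}(\underline k_Z,\underline k_Z[2])$ acts on $\mathbb H^\bullet(Z,F^\bullet)=\bigoplus_i\mathbb H^i(Z,F^\bullet)$ by the cup product $\alpha\mapsto\alpha[2]\circ\omega$. Then the rank over $\mathbb C$ of the cup product $$(-D_0)\,\cdot\;:\;H^\bullet(\widetilde{X^\vee_{\mathcal T}},\mathbb C)\to H^\bullet(\widetilde{X^\vee_{\mathcal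 T}},\mathbb C)$$ is equal to the rank over $\mathbb Q$ of the cup product $$\smile[Y^\vee]\;:\;\mathbb H^\bullet(X^\vee,R\pi^\vee_*\underline{\mathbb Q}_{\widetilde{X^\vee_{\mathcal T}}})\to\mathbb H^\bullet(X^\vee,R\pi^\vee_*\underline{\mathbb Q}_{\widetilde{X^\vee_{\mathcal T}}}),$$ and the rank over $\mathbb Q$ of the cup product with $-D_0$ on $H^\bullet(\widetilde{X^\vee_{\mathcal T}},\mathbb Q)$ is equal to the same number. -/

import Mathlib

open CategoryTheory Limits TopologicalSpace Opposite

attribute [local instance] HasDerivedCategory.standard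

noncomputable section

namespace ToricCup

/-- A local predicate on functions on open sets, stable under linear operations. Its sections form
a sheaf of modules. -/
structure LinearLocalPredicate (R : Type) [Ring R] {X : TopCat.{0}} (T : X → Type)
    [∀ x, AddCommGroup (T x)] [∀ x, Module R (T x)] extends TopCat.LocalPredicate T where
  zero_mem : ∀ {U : Opens X}, pred (fun x : U => (0 : T x))
  add_mem : ∀ {U : Opens X} (f g : ∀ x : U, T x), pred f → pred g → pred (fun x => f x + g x)
  smul_mem : ∀ {U : Opens X} (r : R) (f : ∀ x : U, T x), pred f → pred (fun x => r • f x)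

namespace LinearLocalPredicate

variable {R : Type} [Ring R] {X : TopCat.{0}} {T T' : X → Type}
  [∀ x, AddCommGroup (T x)] [∀ x, Module R (T x)]
  [∀ x, AddCommGroup (T' x)] [∀ x, Module R (T' x)]

def sections (P : LinearLocalPredicate R T) (U : Opens X) : Submodule R (∀ x : U, T x) where
  carrier := {f | P.pred f}
  zero_mem' := P.zero_mem
  add_mem' := fun hf hg => P.add_mem _ _ hf hg
  smul_mem' := fun r _ hf => P.smul_mem r _ hf

def presheaf (P : LinearLocalPredicate R T) : (Opens X)ᵒᵖ ⥤ ModuleCat.{0} R where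
  obj U := ModuleCat.of R (P.sections U.unop)
  map {U V} i := ModuleCat.ofHom
    { toFun := fun f => ⟨fun x => f.1 (i.unop x), P.res i.unop f.1 f.2⟩
      map_add' := fun _ _ => rfl
      map_smul' := fun _ _ => rfl }

/-- The sheaf of functions satisfying a linear local predicate. -/
def sheaf (P : LinearLocalPredicate R T) : TopCat.Sheaf (ModuleCat.{0} R) X :=
  ⟨P.presheaf, by
    refine (TopCat.Presheaf.isSheaf_iff_isSheaf_comp (CategoryTheory.forget (ModuleCat.{0} R)) _).2 ?_
    exact TopCat.subpresheafToTypes.isSheaf P.toLocalPredicate⟩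

/-- The morphism of sheaves given by linear maps applied pointwise. -/
def map (P : LinearLocalPredicate R T) (P' : LinearLocalPredicate R T')
    (φ : ∀ x, T x →ₗ[R] T' x)
    (hφ : ∀ (U : Opens X) (f : ∀ x : U, T x), P.pred f → P'.pred (fun x => φ x (f x))) :
    P.sheaf ⟶ P'.sheaf :=
  ⟨{ app := fun U => ModuleCat.ofHom
      { toFun := fun f => ⟨fun x => φ x (f.1 x), hφ _ f.1 f.2⟩
        map_add' := fun _ _ => by ext; simp
        map_smul' := fun _ _ => by ext; simp } }⟩


section ShortExact
variable {T₁ T₂ T₃ : X → Type}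
  [∀ x, AddCommGroup (T₁ x)] [∀ x, Module R (T₁ x)]
  [∀ x, AddCommGroup (T₂ x)] [∀ x, Module R (T₂ x)]
  [∀ x, AddCommGroup (T₃ x)] [∀ x, Module R (T₃ x)]
  (P₁ : LinearLocalPredicate R T₁) (P₂ : LinearLocalPredicate R T₂)
  (P₃ : LinearLocalPredicate R T₃)
  (φ : ∀ x, T₁ x →ₗ[R] T₂ x) (ψ : ∀ x, T₂ x →ₗ[R] T₃ x)
  (hφ : ∀ (U : Opens X) (f : ∀ x : U, T₁ x), P₁.pred f → P₂.pred (fun x => φ x (f x)))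
  (hψ : ∀ (U : Opens X) (f : ∀ x : U, T₂ x), P₂.pred f → P₃.pred (fun x => ψ x (f x)))
  (zero : ∀ x a, ψ x (φ x a) = 0)

def shortComplex : ShortComplex (TopCat.Sheaf (ModuleCat.{0} R) X) :=
  ShortComplex.mk (P₁.map P₂ φ hφ) (P₂.map P₃ ψ hψ) (by
    apply ObjectProperty.hom_ext
    ext U f
    apply Subtype.ext
    funext x
    exact zero _ _)

theorem shortExact (inj : ∀ x, Function.Injective (φ x))
    (ker : ∀ (U : Opens X) (f : ∀ x : U, T₂ x), P₂.pred f → (∀ x : U, ψ x (f x) = 0) →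
      ∃ g : ∀ x : U, T₁ x, P₁.pred g ∧ ∀ x : U, φ x (g x) = f x)
    (surj : ∀ (U : Opens X) (h : ∀ x : U, T₃ x), P₃.pred h → ∀ x : U,
      ∃ (V : Opens X) (_ : x.1 ∈ V) (i : V ⟶ U) (f : ∀ y : V, T₂ y), P₂.pred f ∧
        ∀ y : V, ψ y (f y) = h (i y)) :
    (shortComplex P₁ P₂ P₃ φ ψ hφ hψ zero).ShortExact := by
  set S := shortComplex P₁ P₂ P₃ φ ψ hφ hψ zero with hS
  have hinj : ∀ (U : (Opens X)ᵒᵖ) (a b : P₁.sections U.unop),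
      (∀ x : U.unop, φ x (a.1 x) = φ x (b.1 x)) → a = b := by
    intro U a b hab
    apply Subtype.ext
    funext x
    exact inj _ (hab x)
  have hmono : Mono S.f := by
    apply (TopCat.Sheaf.forget (ModuleCat.{0} R) X).mono_of_mono_map
    have : ∀ U, Mono (((TopCat.Sheaf.forget (ModuleCat.{0} R) X).map S.f).app U) := by
      intro U
      rw [ModuleCat.mono_iff_injective]
      intro a b hab
      exact hinj U a b fun x => congrFun (congrArg Subtype.val hab) x
    exact NatTrans.mono_of_mono_app _
  have hepi : Epi S.g := by
    rw [← TopCat.Sheaf.isLocallySurjective_iff_epi, TopCat.Presheaf.isLocallySurjective_iff]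
    intro U h x hx
    obtain ⟨V, hV, i, f, hf, hfh⟩ := surj U h.1 h.2 ⟨x, hx⟩
    refine ⟨V, i.le, ⟨⟨f, hf⟩, ?_⟩, hV⟩
    apply Subtype.ext
    funext y
    exact hfh y
  refine ShortComplex.ShortExact.mk' ?_ hmono hepi
  apply ShortComplex.exact_of_f_is_kernel
  refine KernelFork.IsLimit.ofι' S.f S.zero (fun {A} k hk => ?_)
  have hk' : ∀ (U : (Opens X)ᵒᵖ) (a : A.obj.obj U), ∃ g : P₁.sections U.unop,
      ∀ x : U.unop, φ x (g.1 x) = (show P₂.sections U.unop from k.hom.app U a).1 x := by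
    intro U a
    obtain ⟨g, hg, hg'⟩ := ker U.unop (show P₂.sections U.unop from k.hom.app U a).1
      (show P₂.sections U.unop from k.hom.app U a).2 (fun x => by
        have h1 := congrArg (fun q => q.hom.app U a) hk
        exact congrFun (congrArg Subtype.val h1) x)
    exact ⟨⟨g, hg⟩, hg'⟩
  choose l hl using hk'
  refine ⟨⟨{ app := fun U => ModuleCat.ofHom { toFun := l U, map_add' := ?_, map_smul' := ?_ }
             naturality := ?_ }⟩, ?_⟩
  · intro a b
    apply hinj
    intro x
    rw [hl, map_add]
    change _ = φ x ((l U a).1 x + (l U b).1 x)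
    rw [map_add, hl, hl]
    rfl
  · intro r a
    apply hinj
    intro x
    rw [hl, map_smul]
    change _ = φ x (r • (l U a).1 x)
    rw [map_smul, hl]
    rfl
  · intro U V i
    ext a
    apply hinj V
    intro x
    change φ x ((l V (A.obj.map i a)).1 x) = φ x ((l U a).1 (i.unop x))
    rw [hl]
    refine Eq.trans ?_ (hl U a (i.unop x)).symm
    have h2 := congrArg (fun q => q.hom a) (k.hom.naturality i)
    exact congrFun (congrArg Subtype.val h2) x
  · apply ObjectProperty.hom_ext
    ext U a
    apply Subtype.ext
    funext x
    exact hl U a x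
end ShortExact
end LinearLocalPredicate

section Exponential
variable (X : TopCat.{0})

/-- The predicate defining the sheaf of continuous functions with values in `G`. -/
def continuousPredicate (R : Type) [Ring R] (G : Type) [AddCommGroup G] [Module R G]
    [TopologicalSpace G] [IsTopologicalAddGroup G] [ContinuousConstSMul R G] :
    LinearLocalPredicate R (fun _ : X => G) where
  toLocalPredicate := TopCat.continuousLocal X G
  zero_mem := by intro U; exact continuous_const
  add_mem := by intro U f g hf hg; exact Continuous.add hf hg
  smul_mem := by intro U r f hf; exact Continuous.const_smul hf r

/-- The homomorphism `z ↦ exp (2πiz)`. -/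
def expHom : ℂ →+ Additive ℂˣ where
  toFun z := Additive.ofMul (Units.mk0 (Complex.exp (2 * Real.pi * Complex.I * z))
    (Complex.exp_ne_zero _))
  map_zero' := by
    apply Additive.toMul.injective
    ext
    simp
  map_add' a b := by
    apply Additive.toMul.injective
    ext
    simp [mul_add, Complex.exp_add]

theorem expHom_val (z : ℂ) : ((expHom z).toMul : ℂ) = Complex.exp (2 * Real.pi * Complex.I * z) :=
  rfl

theorem continuous_expHom : Continuous expHom := by
  have : Continuous fun z : ℂ => (expHom z).toMul := by
    rw [Units.continuous_iff]
    constructor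
    · change Continuous fun z : ℂ => Complex.exp (2 * Real.pi * Complex.I * z)
      fun_prop
    · have : (fun z : ℂ => (((expHom z).toMul⁻¹ : ℂˣ) : ℂ)) =
          fun z : ℂ => Complex.exp (-(2 * Real.pi * Complex.I * z)) := by
        funext z
        simp [expHom_val, Complex.exp_neg]
      rw [this]
      fun_prop
  exact this

theorem expHom_eq_zero_iff (z : ℂ) : expHom z = 0 ↔ ∃ n : ℤ, (n : ℂ) = z := by
  rw [← Additive.toMul.injective.eq_iff, Units.ext_iff, expHom_val, toMul_zero, Units.val_one,
    Complex.exp_eq_one_iff]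
  have h : (2 * (Real.pi : ℂ) * Complex.I) ≠ 0 := Complex.two_pi_I_ne_zero
  constructor
  · rintro ⟨n, hn⟩
    exact ⟨n, mul_left_cancel₀ h (by rw [hn]; ring)⟩
  · rintro ⟨n, rfl⟩
    exact ⟨n, by ring⟩

/-- The exponential sequence `0 → ℤ → C → Cˣ → 0`, where `C` and `Cˣ` are the sheaves of continuous
functions with values in `ℂ` and `ℂˣ`. -/
def exponentialSequence : ShortComplex (TopCat.Sheaf (ModuleCat.{0} ℤ) X) :=
  LinearLocalPredicate.shortComplex (continuousPredicate X ℤ ℤ) (continuousPredicate X ℤ ℂ)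
    (continuousPredicate X ℤ (Additive ℂˣ))
    (fun _ => (Int.castAddHom ℂ).toIntLinearMap) (fun _ => expHom.toIntLinearMap)
    (fun _ _ hf => (continuous_of_discreteTopology (f := (Int.cast : ℤ → ℂ))).comp hf)
    (fun _ _ hf => continuous_expHom.comp hf)
    (fun _ n => (expHom_eq_zero_iff _).2 ⟨n, rfl⟩)

theorem exponentialSequence_shortExact : (exponentialSequence X).ShortExact := by
  apply LinearLocalPredicate.shortExact
  · intro _
    exact Int.cast_injective
  · intro U f hf h0
    choose g hg using fun x => (expHom_eq_zero_iff (f x)).1 (h0 x)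
    refine ⟨g, ?_, hg⟩
    have : Continuous fun x => ((g x : ℤ) : ℝ) := by
      have h1 : (fun x => ((g x : ℤ) : ℝ)) = fun x => (f x).re := by
        funext x
        rw [← hg x]
        simp
      rw [h1]
      exact Complex.continuous_re.comp hf
    exact Int.isClosedEmbedding_coe_real.isInducing.continuous_iff.2 this
  · intro U h hh x
    have hh : Continuous h := hh
    have hc : Continuous fun y : U => (((h y).toMul : ℂˣ) : ℂ) := Units.continuous_val.comp hh
    let c : ℂ := (((h x).toMul : ℂˣ) : ℂ)
    have hc0 : c ≠ 0 := Units.ne_zero _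
    have hcd : Continuous fun y : U => (((h y).toMul : ℂˣ) : ℂ) / c := hc.div_const c
    let V' : Set U := {y | (((h y).toMul : ℂˣ) : ℂ) / c ∈ Complex.slitPlane}
    have hV' : IsOpen V' := Complex.isOpen_slitPlane.preimage hcd
    let V : Opens X := ⟨Subtype.val '' V', U.isOpen.isOpenMap_subtype_val _ hV'⟩
    have hVU : V ≤ U := by
      rintro _ ⟨y, _, rfl⟩
      exact y.2
    have hmem : ∀ y : V, (((h ⟨y.1, hVU y.2⟩).toMul : ℂˣ) : ℂ) / c ∈ Complex.slitPlane := by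
      rintro ⟨_, y, hy, rfl⟩
      exact hy
    have hinc : Continuous fun y : V => (⟨y.1, hVU y.2⟩ : U) := by fun_prop
    refine ⟨V, ⟨x, ?_, rfl⟩, homOfLE hVU, fun y =>
      (Complex.log ((((h ⟨y.1, hVU y.2⟩).toMul : ℂˣ) : ℂ) / c) + Complex.log c) /
        (2 * Real.pi * Complex.I), ?_, ?_⟩
    · change c / c ∈ Complex.slitPlane
      rw [div_self hc0]
      exact Complex.one_mem_slitPlane
    · refine Continuous.div_const (Continuous.add ?_ continuous_const) _
      exact Continuous.clog (hcd.comp hinc) hmem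
    · intro y
      apply Additive.toMul.injective
      ext
      change Complex.exp (2 * Real.pi * Complex.I * (_ / _)) = _
      rw [mul_div_cancel₀ _ Complex.two_pi_I_ne_zero, Complex.exp_add, Complex.exp_log,
        Complex.exp_log hc0, div_mul_cancel₀ _ hc0]
      · rfl
      · exact Complex.slitPlane_ne_zero (hmem y)

end Exponential

/-- An effective Cartier divisor in local equations, on a complex variety with its classical
topology: on `chart i` it is the zero divisor of `equation i`, and the quotients of the local
equations are the invertible functions `transition i j`, which are the transition functions of the
line bundle of the divisor. -/
structure CartierDivisor (X : TopCat.{0}) where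
  ι : Type
  chart : ι → Opens X
  cover : ∀ x : X, ∃ i, x ∈ chart i
  equation : ι → X → ℂ
  continuousOn_equation : ∀ i, ContinuousOn (equation i) (chart i)
  transition : ι → ι → X → ℂˣ
  continuousOn_transition : ∀ i j, ContinuousOn (transition i j) (chart i ∩ chart j)
  equation_eq : ∀ i j x, x ∈ chart i → x ∈ chart j →
    equation i x = transition i j x * equation j x
  cocycle : ∀ i j k x, x ∈ chart i → x ∈ chart j → x ∈ chart k →
    transition i k x = transition i j x * transition j k x

namespace CartierDivisor
variable {X : TopCat.{0}} (D : CartierDivisor X)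

theorem transition_self (i : D.ι) (x : X) (hx : x ∈ D.chart i) : D.transition i i x = 1 := by
  have h := D.cocycle i i i x hx hx hx
  exact (left_eq_mul.1 h)

/-- At `x`, pairs of an integer `m` and the coordinates, in the local trivializations, of an element
of the `m`-th power of the line bundle of the divisor. -/
abbrev Frame (x : X) : Type := ℤ × ({i : D.ι // x ∈ D.chart i} → Additive ℂˣ)

/-- The predicate defining the sheaf of pairs of a locally constant integer `m` and a nowhere
vanishing continuous section of the `m`-th power of the line bundle of the divisor. -/
def framePredicate : LinearLocalPredicate ℤ D.Frame where
  pred {U} f := (∀ x : U, ∀ i j : {i : D.ι // x.1 ∈ D.chart i},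
      ((f x).2 i).toMul = D.transition i.1 j.1 x.1 ^ (f x).1 * ((f x).2 j).toMul) ∧
    Continuous (fun x : U => (f x).1) ∧
    ∀ i : D.ι, Continuous (fun x : {x : U // x.1 ∈ D.chart i} => (f x.1).2 ⟨i, x.2⟩)
  res {U V} h f hf := by
    refine ⟨fun x i j => hf.1 (h x) i j, ?_, fun i => ?_⟩
    · exact hf.2.1.comp (Opens.isOpenEmbedding_of_le h.le).continuous
    · have hc : Continuous fun x : {x : U // x.1 ∈ D.chart i} =>
          (⟨⟨x.1.1, h.le x.1.2⟩, x.2⟩ : {x : V // x.1 ∈ D.chart i}) := by fun_prop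
      exact (hf.2.2 i).comp hc
  locality {U} f hf := by
    refine ⟨fun x i j => ?_, ?_, fun i => ?_⟩
    · obtain ⟨V, hx, h, hV⟩ := hf x
      exact hV.1 ⟨x.1, hx⟩ i j
    · apply (TopCat.continuousLocal X ℤ).locality (fun x : U => (f x).1)
      intro x
      obtain ⟨V, hx, h, hV⟩ := hf x
      exact ⟨V, hx, h, hV.2.1⟩
    · rw [continuous_iff_continuousAt]
      intro x
      obtain ⟨V, hx, h, hV⟩ := hf x.1
      have hV' := hV.2.2 i
      have hemb : Topology.IsOpenEmbedding (fun y : {y : V // y.1 ∈ D.chart i} =>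
          (⟨⟨y.1.1, h.le y.1.2⟩, y.2⟩ : {x : U // x.1 ∈ D.chart i})) := by
        have h1 := (V.isOpen.inter (D.chart i).isOpen)
        refine Topology.IsOpenEmbedding.of_continuous_injective_isOpenMap (by fun_prop) ?_ ?_
        · intro a b hab
          apply Subtype.ext
          apply Subtype.ext
          exact congrArg (fun q => q.1.1) hab
        · intro S hS
          have hb : Topology.IsOpenEmbedding
              (fun y : {y : V // y.1 ∈ D.chart i} => (y.1.1 : X)) :=
            V.isOpen.isOpenEmbedding_subtypeVal.comp
              (((D.chart i).isOpen.preimage continuous_subtype_val).isOpenEmbedding_subtypeVal)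
          have hcont : Continuous (fun z : {x : U // x.1 ∈ D.chart i} => (z.1.1 : X)) := by
            fun_prop
          convert (hb.isOpenMap S hS).preimage hcont using 1
          ext z
          constructor
          · rintro ⟨y, hy, rfl⟩
            exact ⟨y, hy, rfl⟩
          · rintro ⟨y, hy, hyz⟩
            exact ⟨y, hy, Subtype.ext (Subtype.ext hyz)⟩
      have := hV'.continuousAt (x := ⟨⟨x.1.1, hx⟩, x.2⟩)
      exact (hemb.continuousAt_iff (x := ⟨⟨x.1.1, hx⟩, x.2⟩)
        (g := fun x : {x : U // x.1 ∈ D.chart i} => (f x.1).2 ⟨i, x.2⟩)).1 this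
  zero_mem {U} := by
    refine ⟨fun x i j => by simp, continuous_const, fun i => continuous_const⟩
  add_mem {U} f g hf hg := by
    refine ⟨fun x i j => ?_, hf.2.1.add hg.2.1, fun i => (hf.2.2 i).add (hg.2.2 i)⟩
    have h1 := hf.1 x i j
    have h2 := hg.1 x i j
    simp only [Prod.fst_add, Prod.snd_add, Pi.add_apply, toMul_add, h1, h2, zpow_add]
    exact mul_mul_mul_comm _ _ _ _
  smul_mem {U} r f hf := by
    refine ⟨fun x i j => ?_, hf.2.1.const_smul r, fun i => (hf.2.2 i).const_smul r⟩
    have h1 := hf.1 x i j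
    simp only [Prod.smul_fst, Prod.smul_snd, Pi.smul_apply, toMul_zsmul, h1, mul_zpow,
      smul_eq_mul, zpow_mul']

/-- The extension `0 → Cˣ → E → ℤ → 0` of the line bundle of the divisor, where the fibre of `E` over
`1` is the sheaf of nowhere vanishing sections. Its connecting homomorphism sends `1` to the class
of the line bundle in `H¹(X, Cˣ)`. -/
def frameSequence : ShortComplex (TopCat.Sheaf (ModuleCat.{0} ℤ) X) :=
  LinearLocalPredicate.shortComplex (continuousPredicate X ℤ (Additive ℂˣ)) D.framePredicate
    (continuousPredicate X ℤ ℤ)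
    (fun x => (LinearMap.inr ℤ ℤ ({i : D.ι // x ∈ D.chart i} → Additive ℂˣ)).comp
      (LinearMap.pi fun _ => LinearMap.id))
    (fun x => LinearMap.fst ℤ ℤ ({i : D.ι // x ∈ D.chart i} → Additive ℂˣ))
    (fun U f hf => by
      refine ⟨fun x i j => ?_, continuous_const, fun i => hf.comp continuous_subtype_val⟩
      simp)
    (fun U f hf => hf.2.1)
    (fun x a => rfl)

theorem frameSequence_shortExact : D.frameSequence.ShortExact := by
  apply LinearLocalPredicate.shortExact
  · intro x a b hab
    obtain ⟨i, hi⟩ := D.cover x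
    exact congrFun (congrArg Prod.snd hab) ⟨i, hi⟩
  · intro U f hf h0
    choose c hc using D.cover
    refine ⟨fun x => (f x).2 ⟨c x.1, hc x.1⟩, ?_, ?_⟩
    · have heq : ∀ (x : U) (i j : {i : D.ι // x.1 ∈ D.chart i}), (f x).2 i = (f x).2 j := by
        intro x i j
        have h1 := hf.1 x i j
        have h2 : (f x).1 = 0 := h0 x
        apply Additive.toMul.injective
        rw [h1, h2, zpow_zero, one_mul]
      change Continuous _
      rw [continuous_iff_continuousAt]
      intro x
      have h3 := hf.2.2 (c x.1)
      have hopen : IsOpen {y : U | y.1 ∈ D.chart (c x.1)} :=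
        (D.chart (c x.1)).isOpen.preimage continuous_subtype_val
      refine (hopen.isOpenEmbedding_subtypeVal.continuousAt_iff (x := ⟨x, hc x.1⟩)
        (g := fun x : U => (f x).2 ⟨c x.1, hc x.1⟩)).1 ?_
      have h4 : ((fun x : U => (f x).2 ⟨c x.1, hc x.1⟩) ∘
          (Subtype.val : {y : U | y.1 ∈ D.chart (c x.1)} → U)) =
          fun y => (f y.1).2 ⟨c x.1, y.2⟩ := by
        funext y
        exact heq _ _ _
      rw [h4]
      exact h3.continuousAt
    · intro x
      refine Prod.ext (h0 x).symm ?_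
      funext i
      have h1 := hf.1 x i ⟨c x.1, hc x.1⟩
      have h2 : (f x).1 = 0 := h0 x
      apply Additive.toMul.injective
      rw [h1, h2, zpow_zero, one_mul]
      rfl
  · intro U h hh x
    have hh : Continuous h := hh
    obtain ⟨i, hi⟩ := D.cover x
    refine ⟨U ⊓ D.chart i, ⟨x.2, hi⟩, homOfLE inf_le_left, fun y =>
      (h ⟨y.1, y.2.1⟩, fun j => Additive.ofMul (D.transition j.1 i y.1 ^ h ⟨y.1, y.2.1⟩)),
      ⟨?_, ?_, ?_⟩, ?_⟩
    · intro y j k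
      change D.transition j.1 i y.1 ^ h ⟨y.1, y.2.1⟩ = D.transition j.1 k.1 y.1 ^ h ⟨y.1, y.2.1⟩ *
        D.transition k.1 i y.1 ^ h ⟨y.1, y.2.1⟩
      rw [← mul_zpow, ← D.cocycle j.1 k.1 i y.1 j.2 k.2 y.2.2]
    · have hinc : Continuous fun y : (U ⊓ D.chart i : Opens X) => (⟨y.1, y.2.1⟩ : U) := by
        fun_prop
      exact hh.comp hinc
    · intro j
      have h1 : Continuous fun y : {y : (U ⊓ D.chart i : Opens X) // y.1 ∈ D.chart j} =>
          D.transition j i y.1.1 := by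
        have hinc : Continuous fun y : {y : (U ⊓ D.chart i : Opens X) // y.1 ∈ D.chart j} =>
          (y.1.1 : X) := by fun_prop
        exact ContinuousOn.comp_continuous (D.continuousOn_transition j i) hinc
          (fun y => ⟨y.2, y.1.2.2⟩)
      rw [continuous_iff_continuousAt]
      intro y
      have hinc : Continuous fun y : {y : (U ⊓ D.chart i : Opens X) // y.1 ∈ D.chart j} =>
          (h ⟨y.1.1, y.1.2.1⟩) := by
        apply hh.comp
        fun_prop
      have h2 : ∀ᶠ z in nhds y, h ⟨z.1.1, z.1.2.1⟩ = h ⟨y.1.1, y.1.2.1⟩ :=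
        hinc.continuousAt.eventually (IsOpen.mem_nhds (isOpen_discrete {h ⟨y.1.1, y.1.2.1⟩}) rfl)
      refine ContinuousAt.congr (f := fun z => Additive.ofMul
        (D.transition j i z.1.1 ^ h ⟨y.1.1, y.1.2.1⟩)) ?_ ?_
      · exact (h1.zpow _).continuousAt
      · filter_upwards [h2] with z hz
        rw [hz]
    · intro y
      rfl

end CartierDivisor

section Cohomology
open DerivedCategory

instance sheafLinear (k : Type) [Field k] (X : TopCat.{0}) :
    Linear k (TopCat.Sheaf (ModuleCat.{0} k) X) :=
  inferInstanceAs (Linear k (CategoryTheory.Sheaf (Opens.grothendieckTopology X) (ModuleCat.{0} k)))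

/-- The constant sheaf with value `R`. -/
abbrev constSheaf (R : Type) [CommRing R] (X : TopCat.{0}) : TopCat.Sheaf (ModuleCat.{0} R) X :=
  (constantSheaf (Opens.grothendieckTopology X) (ModuleCat.{0} R)).obj (ModuleCat.of R R)

/-- Constants as locally constant functions. -/
def constToLocallyConstant (X : TopCat.{0}) :
    (Functor.const (Opens X)ᵒᵖ).obj (ModuleCat.of ℤ ℤ) ⟶ (continuousPredicate X ℤ ℤ).presheaf where
  app U := ModuleCat.ofHom
    { toFun := fun n => ⟨fun _ => n, continuous_const⟩
      map_add' := fun _ _ => rfl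
      map_smul' := fun _ _ => rfl }

theorem isLocallyBijective_constToLocallyConstant (X : TopCat.{0}) :
    (Opens.grothendieckTopology X).W (constToLocallyConstant X) := by
  rw [GrothendieckTopology.W_iff_isLocallyBijective]
  constructor
  · refine ⟨fun {U} a b hab x hx => ⟨U.unop, 𝟙 _, ?_, hx⟩⟩
    have := congrFun (congrArg Subtype.val hab) ⟨x, hx⟩
    exact this
  · change TopCat.Presheaf.IsLocallySurjective _
    rw [TopCat.Presheaf.isLocallySurjective_iff]
    intro U f x hx
    have hf : Continuous f.1 := f.2
    let V : Opens X := ⟨Subtype.val '' (f.1 ⁻¹' {f.1 ⟨x, hx⟩}),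
      U.isOpen.isOpenMap_subtype_val _ ((isOpen_discrete _).preimage hf)⟩
    have hVU : V ≤ U := by
      rintro _ ⟨y, _, rfl⟩
      exact y.2
    refine ⟨V, hVU, ⟨f.1 ⟨x, hx⟩, ?_⟩, ⟨⟨x, hx⟩, rfl, rfl⟩⟩
    apply Subtype.ext
    funext y
    obtain ⟨z, hz, hzy⟩ := y.2
    have : (⟨y.1, hVU y.2⟩ : U) = z := Subtype.ext hzy.symm
    change f.1 ⟨x, hx⟩ = f.1 ⟨y.1, hVU y.2⟩
    rw [this]
    exact hz.symm

/-- The constant sheaf `ℤ` is the sheaf of locally constant functions. -/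
def constSheafIso (X : TopCat.{0}) : constSheaf ℤ X ≅ (continuousPredicate X ℤ ℤ).sheaf :=
  (@asIso _ _ _ _ ((presheafToSheaf (Opens.grothendieckTopology X) (ModuleCat.{0} ℤ)).map
      (constToLocallyConstant X))
    (((Opens.grothendieckTopology X).W_iff _).1 (isLocallyBijective_constToLocallyConstant X))) ≪≫
    (sheafificationIso (continuousPredicate X ℤ ℤ).sheaf).symm

section
variable (k : Type) [Field k] [CharZero k] (X : TopCat.{0})

/-- The functor `- ⊗ k` on sheaves of abelian groups. -/
abbrev tensorFunctor : TopCat.Sheaf (ModuleCat.{0} ℤ) X ⥤ TopCat.Sheaf (ModuleCat.{0} k) X :=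
  Sheaf.composeAndSheafify (Opens.grothendieckTopology X)
    (ModuleCat.extendScalars.{0, 0, 0} (Int.castRingHom k))

theorem extendScalars_preservesFiniteLimits :
    PreservesFiniteLimits (ModuleCat.extendScalars.{0, 0, 0} (Int.castRingHom k)) := by
  apply ModuleCat.preservesFiniteLimits_extendScalars_of_flat
  have h : (algebraMap ℤ k).Flat := RingHom.flat_algebraMap_iff.2 inferInstance
  exact h

instance : PreservesFiniteLimits (tensorFunctor k X) := by
  have := extendScalars_preservesFiniteLimits k
  have : PreservesFiniteLimits ((Functor.whiskeringRight (Opens X)ᵒᵖ _ _).obj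
    (ModuleCat.extendScalars.{0, 0, 0} (Int.castRingHom k))) := ⟨fun _ => inferInstance⟩
  have : PreservesFiniteLimits (Sheaf.composeAndSheafify (Opens.grothendieckTopology X)
    (ModuleCat.extendScalars.{0, 0, 0} (Int.castRingHom k))) := inferInstance
  exact this

instance : PreservesFiniteColimits (tensorFunctor k X) := by
  have : PreservesFiniteColimits (Sheaf.composeAndSheafify (Opens.grothendieckTopology X)
    (ModuleCat.extendScalars.{0, 0, 0} (Int.castRingHom k))) := inferInstance
  exact this

instance : (tensorFunctor k X).Additive := Functor.additive_of_preserves_binary_products _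

/-- `ℤ ⊗ k` is `k`. -/
def extendScalarsIso :
    (ModuleCat.extendScalars.{0, 0, 0} (Int.castRingHom k)).obj (ModuleCat.of ℤ ℤ) ≅
      ModuleCat.of k k :=
  letI alg : Algebra ℤ k := (Int.castRingHom k).toAlgebra
  LinearEquiv.toModuleIso (@TensorProduct.AlgebraTensorModule.rid ℤ k k _ _ alg _ alg.toModule _
    (@IsScalarTower.right ℤ k _ _ alg))

/-- Extension of scalars takes the constant sheaf `ℤ` to the constant sheaf `k`. -/
def tensorConstIso : (tensorFunctor k X).obj (constSheaf ℤ X) ≅ constSheaf k X :=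
  (presheafToSheafCompComposeAndSheafifyIso (Opens.grothendieckTopology X)
    (ModuleCat.extendScalars.{0, 0, 0} (Int.castRingHom k))).app _ ≪≫
  (presheafToSheaf (Opens.grothendieckTopology X) (ModuleCat.{0} k)).mapIso
    (NatIso.ofComponents (fun _ => extendScalarsIso k) (by intros; simp))

variable {X}

/-- The first Chern class in `H²(X, ℤ) = Hom (ℤ, ℤ[2])` of the line bundle of a Cartier divisor: the
image of its class in `H¹(X, Cˣ)` under the connecting homomorphism of the exponential sequence. -/
def integralClass (D : CartierDivisor X) :
    ShiftedHom ((singleFunctor (TopCat.Sheaf (ModuleCat.{0} ℤ) X) 0).obj (constSheaf ℤ X))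
      ((singleFunctor _ 0).obj (constSheaf ℤ X)) (2 : ℤ) :=
  (singleFunctor _ 0).map (constSheafIso X).hom ≫
    ShiftedHom.comp (show ShiftedHom _ _ (1 : ℤ) from D.frameSequence_shortExact.singleδ)
      (show ShiftedHom _ _ (1 : ℤ) from (exponentialSequence_shortExact X).singleδ)
      (show (1 : ℤ) + 1 = 2 from rfl) ≫
    (shiftFunctor _ (2 : ℤ)).map ((singleFunctor _ 0).map (constSheafIso X).inv)

/-- The class in `H²(X, k) = Hom (k, k[2])` of a Cartier divisor, as the image of the integral class. -/
def divisorClass (D : CartierDivisor X) :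
    ShiftedHom ((singleFunctor (TopCat.Sheaf (ModuleCat.{0} k) X) 0).obj (constSheaf k X))
      ((singleFunctor _ 0).obj (constSheaf k X)) (2 : ℤ) :=
  let e := ((tensorFunctor k X).mapDerivedCategorySingleFunctor 0).app (constSheaf ℤ X) ≪≫
    (singleFunctor _ 0).mapIso (tensorConstIso k X)
  e.inv ≫ ShiftedHom.map (integralClass D) (tensorFunctor k X).mapDerivedCategory ≫
    (shiftFunctor _ (2 : ℤ)).map e.hom

variable (X)
/-- The cohomology group `H²(X, k) = Hom (k, k[2])` in the derived category of sheaves of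
`k`-modules. -/
abbrev H2 : Type 1 :=
  ShiftedHom ((singleFunctor (TopCat.Sheaf (ModuleCat.{0} k) X) 0).obj (constSheaf k X))
      ((singleFunctor _ 0).obj (constSheaf k X)) (2 : ℤ)
variable {X}
/-- The hypercohomology `ℍⁱ(X, F) = Hom (k, F[i])`. -/
abbrev Hypercohomology (F : DerivedCategory.Plus (TopCat.Sheaf (ModuleCat.{0} k) X)) (i : ℤ) :
    Type 1 :=
  ShiftedHom ((singleFunctor (TopCat.Sheaf (ModuleCat.{0} k) X) 0).obj (constSheaf k X))
      (Plus.ι.obj F) i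

/-- The total hypercohomology `⨁ᵢ ℍⁱ(X, F)`. -/
abbrev TotalHypercohomology (F : DerivedCategory.Plus (TopCat.Sheaf (ModuleCat.{0} k) X)) :
    Type 1 :=
  DirectSum ℤ fun i => Hypercohomology k F i

/-- Cup product with `ω : k ⟶ k[2]`, which sends `α : k ⟶ F[i]` to `α[2] ∘ ω`. -/
def cup (ω : H2 k X) (F : DerivedCategory.Plus (TopCat.Sheaf (ModuleCat.{0} k) X)) (i : ℤ) :
    Hypercohomology k F i →ₗ[k] Hypercohomology k F (i + 2) where
  toFun α := ShiftedHom.comp ω α rfl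
  map_add' _ _ := ShiftedHom.comp_add _ _ _ _
  map_smul' _ _ := ShiftedHom.comp_smul _ _ _ _

/-- Cup product with `ω` on the total hypercohomology. -/
def totalCup (ω : H2 k X) (F : DerivedCategory.Plus (TopCat.Sheaf (ModuleCat.{0} k) X)) :
    TotalHypercohomology k F →ₗ[k] TotalHypercohomology k F :=
  DirectSum.toModule k ℤ _ fun i => DirectSum.lof k ℤ (Hypercohomology k F) (i + 2) ∘ₗ cup k ω F i

/-- The constant sheaf as an object of the bounded below derived category. Its hypercohomology is
the cohomology of `X` with coefficients in `k`. -/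
abbrev constComplex (X : TopCat.{0}) : DerivedCategory.Plus (TopCat.Sheaf (ModuleCat.{0} k) X) :=
  (Plus.singleFunctor _ 0).obj (constSheaf k X)

instance {X Y : TopCat.{0}} (f : X ⟶ Y) :
    (TopCat.Sheaf.pushforward (ModuleCat.{0} k) f).Additive :=
  Functor.additive_of_preserves_binary_products _

/-- The derived direct image `Rf_* : D⁺(X) ⥤ D⁺(Y)`. -/
def derivedPushforward {X Y : TopCat.{0}} (f : X ⟶ Y) :
    DerivedCategory.Plus (TopCat.Sheaf (ModuleCat.{0} k) X) ⥤
      DerivedCategory.Plus (TopCat.Sheaf (ModuleCat.{0} k) Y) :=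
  (TopCat.Sheaf.pushforward (ModuleCat.{0} k) f).rightDerivedFunctorPlus

end
end Cohomology

section Polytopes

variable {n : ℕ}

/-- The inclusion of the lattice `ℤⁿ` in `ℝⁿ`. -/
def toReal (m : Fin n → ℤ) : Fin n → ℝ := fun i => (m i : ℝ)

theorem toReal_add (m m' : Fin n → ℤ) : toReal (m + m') = toReal m + toReal m' := by
  ext i; simp [toReal]

theorem toReal_sub (m m' : Fin n → ℤ) : toReal (m - m') = toReal m - toReal m' := by
  ext i; simp [toReal]

theorem toReal_neg (m : Fin n → ℤ) : toReal (-m) = -toReal m := by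
  ext i; simp [toReal]

theorem toReal_zero : toReal (0 : Fin n → ℤ) = 0 := by
  ext i; simp [toReal]

theorem toReal_nsmul (N : ℕ) (m : Fin n → ℤ) : toReal (N • m) = (N : ℝ) • toReal m := by
  ext i; simp [toReal]

/-- The convex hull of a finite set of lattice points. -/
def IsLatticePolytope (P : Set (Fin n → ℝ)) : Prop :=
  ∃ s : Finset (Fin n → ℤ), P = convexHull ℝ (toReal '' (s : Set (Fin n → ℤ)))

/-- The polar dual `{u | ⟨u, v⟩ ≥ -1 for all v in P}`. -/
def polarDual (P : Set (Fin n → ℝ)) : Set (Fin n → ℝ) :=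
  {u | ∀ v ∈ P, -1 ≤ u ⬝ᵥ v}

/-- A reflexive polytope: a lattice polytope with the origin in its interior, whose polar dual is a
lattice polytope. -/
structure IsReflexive (P : Set (Fin n → ℝ)) : Prop where
  lattice : IsLatticePolytope P
  zero_mem_interior : (0 : Fin n → ℝ) ∈ interior P
  dual_lattice : IsLatticePolytope (polarDual P)

/-- A regular projective triangulation: a finite triangulation of `P` with lattice points as vertices,
such that the origin is a vertex of every maximal simplex, every maximal simplex is unimodular, and
there is a strictly convex piecewise linear function (given by its values `ψ` at the vertices: its
linear pieces are strictly below `ψ` at all other vertices). -/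
structure IsRegularProjectiveTriangulation (P : Set (Fin n → ℝ))
    (K : Geometry.SimplicialComplex ℝ (Fin n → ℝ)) : Prop where
  finite : K.faces.Finite
  space_eq : K.space = P
  lattice : ∀ t ∈ K.faces, ∀ v ∈ t, v ∈ Set.range (toReal (n := n))
  zero_mem : ∀ t ∈ K.facets, (0 : Fin n → ℝ) ∈ t
  unimodular : ∀ t ∈ K.facets,
    (AddSubgroup.closure (t : Set (Fin n → ℝ)) : Set (Fin n → ℝ)) = Set.range (toReal (n := n))
  projective : ∃ ψ : (Fin n → ℝ) → ℝ, ∀ t ∈ K.facets, ∃ a : (Fin n → ℝ) →ᵃ[ℝ] ℝ,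
    ∀ v ∈ K.vertices, (v ∈ t → a v = ψ v) ∧ (v ∉ t → a v < ψ v)

/-- The fan of cones over the proper faces of `P`. The empty face gives the cone `0`. -/
def faceFan (P : Set (Fin n → ℝ)) : Set (PointedCone ℝ (Fin n → ℝ)) :=
  {σ | ∃ F : Set (Fin n → ℝ), IsExposed ℝ P F ∧ F ≠ P ∧ σ = PointedCone.hull ℝ F}

/-- The fan of cones over the simplices of a triangulation. -/
def triangulationFan (K : Geometry.SimplicialComplex ℝ (Fin n → ℝ)) :
    Set (PointedCone ℝ (Fin n → ℝ)) :=
  {σ | ∃ t ∈ K.faces, σ = PointedCone.hull ℝ (t : Set (Fin n → ℝ))}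

/-- Every cone of `S` lies in some cone of `S'`. -/
def Refines (S S' : Set (PointedCone ℝ (Fin n → ℝ))) : Prop :=
  ∀ σ ∈ S, ∃ τ ∈ S', σ ≤ τ

theorem hull_nonneg {F : Set (Fin n → ℝ)} {u : Fin n → ℝ} (h : ∀ v ∈ F, 0 ≤ u ⬝ᵥ v)
    {v : Fin n → ℝ} (hv : v ∈ PointedCone.hull ℝ F) : 0 ≤ u ⬝ᵥ v := by
  induction hv using Submodule.span_induction with
  | mem x hx => exact h x hx
  | zero => simp
  | add x y _ _ hx hy => rw [dotProduct_add]; exact add_nonneg hx hy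
  | smul a x _ hx =>
    rw [show a • x = (a : ℝ) • x from rfl, dotProduct_smul]
    exact mul_nonneg a.2 hx

theorem convexHull_dot_le {s : Set (Fin n → ℝ)} {u : Fin n → ℝ} {c : ℝ}
    (h : ∀ v ∈ s, u ⬝ᵥ v ≤ c) {v : Fin n → ℝ} (hv : v ∈ convexHull ℝ s) : u ⬝ᵥ v ≤ c := by
  have hc : Convex ℝ {v : Fin n → ℝ | u ⬝ᵥ v ≤ c} := by
    refine convex_halfSpace_le (f := fun v => u ⬝ᵥ v) ⟨fun x y => dotProduct_add _ _ _,
      fun a x => dotProduct_smul _ _ _⟩ c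
  exact convexHull_min (t := {v : Fin n → ℝ | u ⬝ᵥ v ≤ c}) h hc hv

theorem convexHull_dot_ge {s : Set (Fin n → ℝ)} {u : Fin n → ℝ} {c : ℝ}
    (h : ∀ v ∈ s, c ≤ u ⬝ᵥ v) {v : Fin n → ℝ} (hv : v ∈ convexHull ℝ s) : c ≤ u ⬝ᵥ v := by
  have := convexHull_dot_le (u := -u) (c := -c) (s := s) (fun v hv => by
    rw [neg_dotProduct]; exact neg_le_neg (h v hv)) hv
  rw [neg_dotProduct] at this
  linarith

theorem convexHull_dot_eq {s : Set (Fin n → ℝ)} {u u' : Fin n → ℝ}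
    (h : ∀ v ∈ s, u ⬝ᵥ v = u' ⬝ᵥ v) {v : Fin n → ℝ} (hv : v ∈ convexHull ℝ s) :
    u ⬝ᵥ v = u' ⬝ᵥ v := by
  have h1 := convexHull_dot_le (u := u - u') (c := 0) (s := s) (fun v hv => by
    rw [sub_dotProduct, h v hv, sub_self]) hv
  have h2 := convexHull_dot_ge (u := u - u') (c := 0) (s := s) (fun v hv => by
    rw [sub_dotProduct, h v hv, sub_self]) hv
  rw [sub_dotProduct] at h1 h2
  linarith

/-- The set `{u | -1 ≤ ⟨u, ·⟩}` of a closed convex set containing the origin determines it. -/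
theorem mem_of_polarDual {P : Set (Fin n → ℝ)} (hc : Convex ℝ P) (hcl : IsClosed P)
    (h0 : (0 : Fin n → ℝ) ∈ P) {p : Fin n → ℝ} (hp : ∀ u ∈ polarDual P, -1 ≤ u ⬝ᵥ p) : p ∈ P := by
  by_contra hpP
  obtain ⟨l, c, hl, hlp⟩ := geometric_hahn_banach_closed_point hc hcl hpP
  have hc0 : 0 < c := by simpa using hl 0 h0
  let w : Fin n → ℝ := fun i => l (Pi.single i 1)
  have hw : ∀ v, w ⬝ᵥ v = l v := by
    intro v
    conv_rhs => rw [← Finset.univ_sum_single v]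
    rw [map_sum]
    refine Finset.sum_congr rfl fun i _ => ?_
    rw [show (Pi.single i (v i) : Fin n → ℝ) = v i • Pi.single i 1 by
      rw [← Pi.single_smul', smul_eq_mul, mul_one], map_smul, smul_eq_mul, mul_comm]
  have h1 : -(c⁻¹ • w) ∈ polarDual P := by
    intro v hv
    rw [neg_dotProduct, smul_dotProduct, hw, smul_eq_mul, neg_le_neg_iff, inv_mul_le_iff₀ hc0,
      mul_one]
    exact (hl v hv).le
  have h2 := hp _ h1
  rw [neg_dotProduct, smul_dotProduct, hw, smul_eq_mul, neg_le_neg_iff, inv_mul_le_iff₀ hc0,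
    mul_one] at h2
  exact absurd hlp (not_lt.2 h2)

namespace IsReflexive
variable {P : Set (Fin n → ℝ)}

theorem convex (hP : IsReflexive P) : Convex ℝ P := by
  obtain ⟨s, rfl⟩ := hP.lattice
  exact convex_convexHull _ _

theorem isClosed (hP : IsReflexive P) : IsClosed P := by
  obtain ⟨s, rfl⟩ := hP.lattice
  exact (Set.Finite.isCompact_convexHull (𝕜 := ℝ) (s.finite_toSet.image _)).isClosed

/-- A boundary point lies on a facet `⟨m, ·⟩ = -1` with `m` a lattice point of the dual. -/
theorem exists_lattice_eq (hP : IsReflexive P) {y : Fin n → ℝ} (hy : y ∈ P)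
    (hb : ∀ c : ℝ, 1 < c → c • y ∉ P) :
    ∃ m : Fin n → ℤ, toReal m ∈ polarDual P ∧ toReal m ⬝ᵥ y = -1 := by
  by_contra! hcon
  obtain ⟨s, hs⟩ := hP.dual_lattice
  have hsm : ∀ m ∈ s, toReal m ∈ polarDual P := by
    intro m hm
    rw [hs]
    exact subset_convexHull ℝ _ ⟨m, hm, rfl⟩
  have hlt : ∀ m ∈ s, -1 < toReal m ⬝ᵥ y := fun m hm =>
    lt_of_le_of_ne (hsm m hm y hy) (Ne.symm (hcon m (hsm m hm)))
  have hex : ∀ᶠ c in nhdsWithin (1 : ℝ) (Set.Ioi 1), ∀ m ∈ s, -1 < c * (toReal m ⬝ᵥ y) := by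
    rw [Filter.eventually_all_finset]
    intro m hm
    have hcont : Filter.Tendsto (fun c : ℝ => c * (toReal m ⬝ᵥ y))
        (nhdsWithin (1 : ℝ) (Set.Ioi 1)) (nhds (1 * (toReal m ⬝ᵥ y))) :=
      ((continuous_id.mul continuous_const).tendsto 1).mono_left nhdsWithin_le_nhds
    rw [one_mul] at hcont
    exact hcont.eventually (lt_mem_nhds (hlt m hm))
  obtain ⟨c, hc, hc1⟩ := (hex.and self_mem_nhdsWithin).exists
  refine hb c hc1 (mem_of_polarDual hP.convex hP.isClosed
    (interior_subset hP.zero_mem_interior) fun u hu => ?_)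
  rw [hs] at hu
  rw [dotProduct_comm]
  refine convexHull_dot_ge (c := -1) ?_ hu
  rintro _ ⟨m, hm, rfl⟩
  rw [dotProduct_comm, dotProduct_smul, smul_eq_mul]
  exact (hc m hm).le

/-- Every proper face lies in some `{⟨m, ·⟩ = -1}`, `m` a lattice point of the dual. -/
theorem exists_lattice_face (hP : IsReflexive P) {F : Set (Fin n → ℝ)} (hF : IsExposed ℝ P F)
    (hne : F ≠ P) :
    ∃ m : Fin n → ℤ, toReal m ∈ polarDual P ∧ ∀ v ∈ F, toReal m ⬝ᵥ v = -1 := by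
  have h0 : (0 : Fin n → ℝ) ∈ P := interior_subset hP.zero_mem_interior
  rcases F.eq_empty_or_nonempty with rfl | hFne
  · refine ⟨0, ?_, by simp⟩
    intro v _
    simp [toReal_zero]
  obtain ⟨l, hl⟩ := hF hFne
  obtain ⟨v₀, hv₀⟩ := hFne
  have hv₀' : v₀ ∈ P ∧ ∀ y ∈ P, l y ≤ l v₀ := by rw [hl] at hv₀; exact hv₀
  have hpos : 0 < l v₀ := by
    have hge : 0 ≤ l v₀ := by simpa using hv₀'.2 0 h0
    refine lt_of_le_of_ne hge fun heq => hne ?_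
    have hle : ∀ y ∈ P, l y ≤ 0 := fun y hy => heq ▸ hv₀'.2 y hy
    have hzero : ∀ y, l y = 0 := by
      intro y
      have hev : ∀ᶠ c in nhdsWithin (0 : ℝ) (Set.Ioi 0), -(c • y) ∈ P := by
        have hcont : Filter.Tendsto (fun c : ℝ => -(c • y)) (nhdsWithin (0 : ℝ) (Set.Ioi 0))
            (nhds (-((0 : ℝ) • y))) :=
          ((continuous_id.smul continuous_const).neg.tendsto 0).mono_left nhdsWithin_le_nhds
        rw [zero_smul, neg_zero] at hcont
        exact hcont.eventually (mem_interior_iff_mem_nhds.1 hP.zero_mem_interior)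
      have hev' : ∀ᶠ c in nhdsWithin (0 : ℝ) (Set.Ioi 0), c • y ∈ P := by
        have hcont : Filter.Tendsto (fun c : ℝ => c • y) (nhdsWithin (0 : ℝ) (Set.Ioi 0))
            (nhds ((0 : ℝ) • y)) :=
          ((continuous_id.smul continuous_const).tendsto 0).mono_left nhdsWithin_le_nhds
        rw [zero_smul] at hcont
        exact hcont.eventually (mem_interior_iff_mem_nhds.1 hP.zero_mem_interior)
      obtain ⟨c, ⟨hc1, hc2⟩, hc⟩ := ((hev.and hev').and self_mem_nhdsWithin).exists
      have hc : 0 < c := hc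
      have h1 := hle _ hc1
      have h2 := hle _ hc2
      rw [map_neg, map_smul, smul_eq_mul] at h1
      rw [map_smul, smul_eq_mul] at h2
      have h3 : c * l y = 0 := by linarith
      exact (mul_eq_zero.1 h3).resolve_left hc.ne'
    rw [hl]
    ext x
    simp [hzero]
  obtain ⟨s, hs⟩ := hP.dual_lattice
  let w : Fin n → ℝ := fun i => l (Pi.single i 1)
  have hw : ∀ v, w ⬝ᵥ v = l v := by
    intro v
    conv_rhs => rw [← Finset.univ_sum_single v]
    rw [map_sum]
    refine Finset.sum_congr rfl fun i _ => ?_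
    rw [show (Pi.single i (v i) : Fin n → ℝ) = v i • Pi.single i 1 by
      rw [← Pi.single_smul', smul_eq_mul, mul_one], map_smul, smul_eq_mul, mul_comm]
  have hu : -((l v₀)⁻¹ • w) ∈ convexHull ℝ (toReal '' (s : Set (Fin n → ℤ))) := by
    rw [← hs]
    intro v hv
    rw [neg_dotProduct, smul_dotProduct, hw, smul_eq_mul, neg_le_neg_iff, inv_mul_le_iff₀ hpos,
      mul_one]
    exact hv₀'.2 v hv
  have huF : ∀ v ∈ F, -((l v₀)⁻¹ • w) ⬝ᵥ v = -1 := by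
    intro v hv
    rw [hl] at hv
    have : l v = l v₀ := le_antisymm (hv₀'.2 v hv.1) (hv.2 v₀ hv₀'.1)
    rw [neg_dotProduct, smul_dotProduct, hw, smul_eq_mul, this, inv_mul_cancel₀ hpos.ne']
  rw [convexHull_eq] at hu
  obtain ⟨ι, t, c, z, hc0, hc1, hz, hcz⟩ := hu
  rw [Finset.centerMass_eq_of_sum_1 _ _ hc1] at hcz
  obtain ⟨i, hi, hci⟩ : ∃ i ∈ t, 0 < c i := by
    by_contra! hcon
    have : ∑ i ∈ t, c i ≤ 0 := Finset.sum_nonpos hcon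
    linarith
  obtain ⟨m, hm, hmz⟩ := hz i hi
  have hmem : ∀ j ∈ t, z j ∈ polarDual P := by
    intro j hj
    rw [hs]
    exact subset_convexHull ℝ _ (hz j hj)
  refine ⟨m, hmz ▸ hmem i hi, fun v hv => ?_⟩
  have hvP : v ∈ P := by rw [hl] at hv; exact hv.1
  have h1 : ∑ j ∈ t, c j * (z j ⬝ᵥ v + 1) = 0 := by
    have h2 := huF v hv
    rw [← hcz, sum_dotProduct] at h2
    simp only [smul_dotProduct, smul_eq_mul] at h2
    simp only [mul_add, mul_one, Finset.sum_add_distrib, hc1, h2]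
    norm_num
  have h3 := (Finset.sum_eq_zero_iff_of_nonneg (fun j hj => mul_nonneg (hc0 j hj)
    (by linarith [hmem j hj v hvP]))).1 h1 i hi
  rw [hmz]
  have := (mul_eq_zero.1 h3).resolve_left hci.ne'
  linarith

end IsReflexive

namespace IsRegularProjectiveTriangulation
variable {P : Set (Fin n → ℝ)} {K : Geometry.SimplicialComplex ℝ (Fin n → ℝ)}

theorem exists_facet (hK : IsRegularProjectiveTriangulation P K) {t : Finset (Fin n → ℝ)}
    (ht : t ∈ K.faces) : ∃ s ∈ K.facets, t ⊆ s := by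
  obtain ⟨s, hts, hs⟩ := hK.finite.exists_le_maximal ht
  exact ⟨s, ⟨hs.1, fun u hu hsu => le_antisymm hsu (hs.2 hu hsu)⟩, hts⟩

/-- On a maximal simplex, integers at the nonzero vertices are interpolated by a unique
element of the dual lattice. -/
theorem exists_exponent (hK : IsRegularProjectiveTriangulation P K) {t : Finset (Fin n → ℝ)}
    (ht : t ∈ K.facets) (a : (Fin n → ℝ) → ℤ) :
    ∃ e : Fin n → ℤ, ∀ v ∈ t, v ≠ 0 → toReal e ⬝ᵥ v = a v := by
  have h0 := hK.zero_mem t ht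
  have hind := (affineIndependent_set_iff_linearIndependent_vsub ℝ
    (s := (t : Set (Fin n → ℝ))) (p₁ := 0) h0).1 (K.indep ht.1)
  have himg : (fun p : Fin n → ℝ => p -ᵥ (0 : Fin n → ℝ)) '' ((t : Set (Fin n → ℝ)) \ {0}) =
      (t : Set (Fin n → ℝ)) \ {0} := by
    simp
  rw [himg] at hind
  have hind : LinearIndepOn ℝ id ((t : Set (Fin n → ℝ)) \ {0}) := hind
  let b := Module.Basis.extend hind
  let l : (Fin n → ℝ) →ₗ[ℝ] ℝ := b.constr ℝ fun v => (a v.1 : ℝ)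
  have hl : ∀ v ∈ t, v ≠ 0 → l v = a v := by
    intro v hv hv0
    have hmem : v ∈ hind.extend (Set.subset_univ _) :=
      hind.subset_extend (Set.subset_univ _) ⟨hv, hv0⟩
    have h1 : b ⟨v, hmem⟩ = v := Module.Basis.extend_apply_self hind ⟨v, hmem⟩
    have h2 := b.constr_basis ℝ (fun v => (a v.1 : ℝ)) ⟨v, hmem⟩
    rw [h1] at h2
    exact h2
  have hint : ∀ v ∈ AddSubgroup.closure (t : Set (Fin n → ℝ)), ∃ c : ℤ, (c : ℝ) = l v := by
    intro v hv
    induction hv using AddSubgroup.closure_induction with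
    | mem x hx =>
      by_cases hx0 : x = 0
      · exact ⟨0, by simp [hx0]⟩
      · exact ⟨a x, (hl x hx hx0).symm⟩
    | zero => exact ⟨0, by simp⟩
    | add x y _ _ hx hy =>
      obtain ⟨c, hc⟩ := hx
      obtain ⟨d, hd⟩ := hy
      exact ⟨c + d, by rw [map_add, Int.cast_add, hc, hd]⟩
    | neg x _ hx =>
      obtain ⟨c, hc⟩ := hx
      exact ⟨-c, by rw [map_neg, Int.cast_neg, hc]⟩
  have hlat : ∀ m : Fin n → ℤ, toReal m ∈ AddSubgroup.closure (t : Set (Fin n → ℝ)) := by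
    intro m
    have : toReal m ∈ (AddSubgroup.closure (t : Set (Fin n → ℝ)) : Set (Fin n → ℝ)) := by
      rw [hK.unimodular t ht]
      exact ⟨m, rfl⟩
    exact this
  choose e he using fun i => hint _ (hlat (Pi.single i 1))
  refine ⟨e, fun v hv hv0 => ?_⟩
  rw [← hl v hv hv0]
  conv_rhs => rw [← Finset.univ_sum_single v]
  rw [map_sum]
  refine Finset.sum_congr rfl fun i _ => ?_
  have h3 : (Pi.single i (v i) : Fin n → ℝ) = v i • toReal (Pi.single i 1) := by
    ext j
    by_cases hij : j = i
    · subst hij; simp [toReal]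
    · simp [toReal, hij]
  rw [h3, map_smul, smul_eq_mul, ← he, mul_comm]
  rfl

/-- The element of the dual lattice with value `a v` at each nonzero vertex `v` of the maximal
simplex `t`. -/
def exponent (hK : IsRegularProjectiveTriangulation P K) (a : (Fin n → ℝ) → ℤ)
    (t : K.facets) : Fin n → ℤ :=
  (hK.exists_exponent t.2 a).choose

theorem exponent_dot (hK : IsRegularProjectiveTriangulation P K) (a : (Fin n → ℝ) → ℤ)
    (t : K.facets) : ∀ v ∈ t.1, v ≠ 0 → toReal (hK.exponent a t) ⬝ᵥ v = a v :=
  (hK.exists_exponent t.2 a).choose_spec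

theorem exists_smul_mem_convexHull {t : Finset (Fin n → ℝ)} (h0 : (0 : Fin n → ℝ) ∈ t)
    {v : Fin n → ℝ} (hv : v ∈ PointedCone.hull ℝ (t : Set (Fin n → ℝ))) :
    ∃ c : ℝ, 0 < c ∧ ∀ d : ℝ, 0 < d → d ≤ c → d • v ∈ convexHull ℝ (t : Set (Fin n → ℝ)) := by
  have h0' : (0 : Fin n → ℝ) ∈ convexHull ℝ (t : Set (Fin n → ℝ)) := subset_convexHull ℝ _ h0
  have hconv := convex_convexHull ℝ (t : Set (Fin n → ℝ))
  have key : ∀ {c : ℝ} {v : Fin n → ℝ}, 0 < c → c • v ∈ convexHull ℝ (t : Set (Fin n → ℝ)) →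
      ∀ d : ℝ, 0 < d → d ≤ c → d • v ∈ convexHull ℝ (t : Set (Fin n → ℝ)) := by
    intro c v hc hcv d hd hdc
    have h1 := hconv.smul_mem_of_zero_mem h0' hcv (t := d / c)
      ⟨(div_pos hd hc).le, (div_le_one hc).2 hdc⟩
    rwa [smul_smul, div_mul_cancel₀ _ hc.ne'] at h1
  suffices h : ∃ c : ℝ, 0 < c ∧ c • v ∈ convexHull ℝ (t : Set (Fin n → ℝ)) by
    obtain ⟨c, hc, hcv⟩ := h
    exact ⟨c, hc, key hc hcv⟩
  induction hv using Submodule.span_induction with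
  | mem x hx => exact ⟨1, one_pos, by rw [one_smul]; exact subset_convexHull ℝ _ hx⟩
  | zero => exact ⟨1, one_pos, by rw [smul_zero]; exact h0'⟩
  | add x y _ _ hx hy =>
    obtain ⟨c, hc, hcx⟩ := hx
    obtain ⟨d, hd, hdy⟩ := hy
    have h1 := key hc hcx (min c d) (lt_min hc hd) (min_le_left _ _)
    have h2 := key hd hdy (min c d) (lt_min hc hd) (min_le_right _ _)
    refine ⟨min c d / 2, half_pos (lt_min hc hd), ?_⟩
    have h3 := hconv h1 h2 (a := 1 / 2) (b := 1 / 2) (by norm_num) (by norm_num) (by norm_num)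
    rw [smul_smul, smul_smul, ← smul_add] at h3
    rwa [show 1 / 2 * min c d = min c d / 2 by ring] at h3
  | smul r x _ hx =>
    obtain ⟨c, hc, hcx⟩ := hx
    rcases eq_or_ne (r : ℝ) 0 with hr | hr
    · refine ⟨1, one_pos, ?_⟩
      rw [show r • x = (r : ℝ) • x from rfl, hr, zero_smul, smul_zero]
      exact h0'
    · have hr' : (0 : ℝ) < r := lt_of_le_of_ne r.2 (Ne.symm hr)
      refine ⟨c / r, div_pos hc hr', ?_⟩
      rw [show r • x = (r : ℝ) • x from rfl, smul_smul, div_mul_cancel₀ _ hr]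
      exact hcx

/-- The exponents on two maximal simplices agree on the intersection of the two cones. -/
theorem exponent_compat (hK : IsRegularProjectiveTriangulation P K) (a : (Fin n → ℝ) → ℤ)
    (t t' : K.facets) {v : Fin n → ℝ}
    (hv : v ∈ PointedCone.hull ℝ (t.1 : Set (Fin n → ℝ)))
    (hv' : v ∈ PointedCone.hull ℝ (t'.1 : Set (Fin n → ℝ))) :
    toReal (hK.exponent a t) ⬝ᵥ v = toReal (hK.exponent a t') ⬝ᵥ v := by
  obtain ⟨c, hc, hcv⟩ := exists_smul_mem_convexHull (hK.zero_mem _ t.2) hv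
  obtain ⟨d, hd, hdv⟩ := exists_smul_mem_convexHull (hK.zero_mem _ t'.2) hv'
  have hm := lt_min hc hd
  have h1 := K.inter_subset_convexHull t.2.1 t'.2.1
    ⟨hcv _ hm (min_le_left _ _), hdv _ hm (min_le_right _ _)⟩
  have h2 := convexHull_dot_eq (u := toReal (hK.exponent a t)) (u' := toReal (hK.exponent a t'))
    (fun w hw => by
      by_cases hw0 : w = 0
      · simp [hw0]
      · rw [hK.exponent_dot a t w hw.1 hw0, hK.exponent_dot a t' w hw.2 hw0]) h1
  rw [dotProduct_smul, dotProduct_smul, smul_eq_mul, smul_eq_mul] at h2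
  exact mul_left_cancel₀ hm.ne' h2

theorem refines (hK : IsRegularProjectiveTriangulation P K) (hP : IsReflexive P) :
    Refines (triangulationFan K) (faceFan P) := by
  rintro _ ⟨t₀, ht₀, rfl⟩
  obtain ⟨t, ht, ht₀t⟩ := hK.exists_facet ht₀
  suffices h : ∃ m : Fin n → ℤ, toReal m ∈ polarDual P ∧ ∀ v ∈ t, v ≠ 0 → toReal m ⬝ᵥ v = -1 by
    obtain ⟨m, hm, hmt⟩ := h
    refine ⟨PointedCone.hull ℝ {v ∈ P | toReal m ⬝ᵥ v = -1},
      ⟨_, ?_, ?_, rfl⟩, ?_⟩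
    · intro hne
      let l : StrongDual ℝ (Fin n → ℝ) :=
        LinearMap.toContinuousLinearMap (-(dotProductBilin ℝ ℝ (toReal m)))
      have hl : ∀ v, l v = -(toReal m ⬝ᵥ v) := fun v => rfl
      refine ⟨l, ?_⟩
      ext x
      simp only [Set.mem_ofPred_eq, hl]
      refine and_congr_right fun hx => ⟨fun h y hy => ?_, fun h => ?_⟩
      · rw [h]
        linarith [hm y hy]
      · obtain ⟨w, hw, hw1⟩ := hne
        have := h w hw
        rw [hw1] at this
        exact le_antisymm (by linarith) (hm x hx)
    · intro heq
      have h0 : (0 : Fin n → ℝ) ∈ P := interior_subset hP.zero_mem_interior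
      rw [← heq] at h0
      simpa using h0.2
    · refine Submodule.span_le.2 fun v hv => ?_
      by_cases hv0 : v = 0
      · rw [hv0]
        exact Submodule.zero_mem _
      · refine Submodule.subset_span ⟨?_, hmt v (ht₀t hv) hv0⟩
        rw [← hK.space_eq]
        exact K.subset_space ht₀ hv
  have h0 := hK.zero_mem t ht
  rcases (t.erase 0).eq_empty_or_nonempty with hG | hG
  · refine ⟨0, fun v _ => by simp [toReal_zero], fun v hv hv0 => ?_⟩
    have : v ∈ t.erase 0 := Finset.mem_erase.2 ⟨hv0, hv⟩
    simp [hG] at this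
  set N : ℝ := ((t.erase 0).card : ℝ) with hN
  have hNpos : 0 < N := by
    rw [hN]
    exact_mod_cast hG.card_pos
  let y : Fin n → ℝ := ∑ v ∈ t.erase 0, N⁻¹ • v
  have hsum : ∑ _v ∈ t.erase 0, N⁻¹ = 1 := by
    rw [Finset.sum_const, nsmul_eq_mul, ← hN, mul_inv_cancel₀ hNpos.ne']
  have hyt : y ∈ convexHull ℝ (t : Set (Fin n → ℝ)) :=
    (convex_convexHull ℝ _).sum_mem (fun _ _ => (inv_pos.2 hNpos).le) hsum
      fun v hv => subset_convexHull ℝ _ (Finset.mem_of_mem_erase hv)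
  have hyP : y ∈ P := by
    rw [← hK.space_eq]
    exact K.convexHull_subset_space ht.1 hyt
  have hycone : y ∈ PointedCone.hull ℝ (t : Set (Fin n → ℝ)) :=
    Submodule.sum_mem _ fun v hv => by
      exact Submodule.smul_mem _ (⟨N⁻¹, (inv_pos.2 hNpos).le⟩ : NNReal)
        (Submodule.subset_span (Finset.mem_of_mem_erase hv))
  obtain ⟨m, hm, hmy⟩ := hP.exists_lattice_eq hyP fun c hc hcP => by
    rw [← hK.space_eq, Geometry.SimplicialComplex.mem_space_iff] at hcP
    obtain ⟨s₀, hs₀, hcs₀⟩ := hcP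
    obtain ⟨s, hs, hs₀s⟩ := hK.exists_facet hs₀
    have hcs : c • y ∈ convexHull ℝ (s : Set (Fin n → ℝ)) := convexHull_mono hs₀s hcs₀
    have hc0 : 0 < c := by linarith
    have hc1 : c • y ∈ PointedCone.hull ℝ (t : Set (Fin n → ℝ)) :=
      Submodule.smul_mem _ (⟨c, hc0.le⟩ : NNReal) hycone
    have hc2 : c • y ∈ PointedCone.hull ℝ (s : Set (Fin n → ℝ)) := by
      have : Convex ℝ (PointedCone.hull ℝ (s : Set (Fin n → ℝ)) : Set (Fin n → ℝ)) :=
        (PointedCone.hull ℝ (s : Set (Fin n → ℝ))).toConvexCone.convex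
      exact convexHull_min Submodule.subset_span this hcs
    have h1 := hK.exponent_compat (fun _ => 1) ⟨t, ht⟩ ⟨s, hs⟩ hc1 hc2
    have h2 : toReal (hK.exponent (fun _ => 1) ⟨s, hs⟩) ⬝ᵥ (c • y) ≤ 1 := by
      refine convexHull_dot_le (fun v hv => ?_) hcs
      by_cases hv0 : v = 0
      · simp [hv0]
      · rw [hK.exponent_dot (fun _ => 1) ⟨s, hs⟩ v hv hv0]
        simp
    rw [← h1, dotProduct_smul, smul_eq_mul, dotProduct_sum] at h2
    have h3 : ∑ v ∈ t.erase 0, toReal (hK.exponent (fun _ => 1) ⟨t, ht⟩) ⬝ᵥ (N⁻¹ • v) = 1 := by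
      rw [← hsum]
      refine Finset.sum_congr rfl fun v hv => ?_
      rw [dotProduct_smul, smul_eq_mul, hK.exponent_dot (fun _ => 1) ⟨t, ht⟩ v
        (Finset.mem_of_mem_erase hv) (Finset.ne_of_mem_erase hv)]
      simp
    rw [h3, mul_one] at h2
    linarith
  refine ⟨m, hm, fun v hv hv0 => ?_⟩
  have hvmem : v ∈ t.erase 0 := Finset.mem_erase.2 ⟨hv0, hv⟩
  have h4 : ∀ w ∈ t.erase 0, -1 ≤ toReal m ⬝ᵥ w := by
    intro w hw
    refine hm w ?_
    rw [← hK.space_eq]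
    exact K.subset_space ht.1 (Finset.mem_of_mem_erase hw)
  have h5 : ∑ w ∈ t.erase 0, N⁻¹ * (toReal m ⬝ᵥ w + 1) = 0 := by
    have h6 := hmy
    rw [dotProduct_sum] at h6
    simp only [dotProduct_smul, smul_eq_mul] at h6
    simp only [mul_add, mul_one, Finset.sum_add_distrib, hsum, h6]
    norm_num
  have h7 := (Finset.sum_eq_zero_iff_of_nonneg (fun w hw => mul_nonneg (inv_pos.2 hNpos).le
    (by linarith [h4 w hw]))).1 h5 v hvmem
  have := (mul_eq_zero.1 h7).resolve_left (inv_pos.2 hNpos).ne'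
  linarith

end IsRegularProjectiveTriangulation
end Polytopes

section ToricVarieties

variable {n : ℕ}

/-- The monoid `σ^∨ ∩ ℤⁿ` of characters that are regular on the affine chart of `σ`. -/
def dualMonoid (σ : PointedCone ℝ (Fin n → ℝ)) : AddSubmonoid (Fin n → ℤ) where
  carrier := {m | ∀ v ∈ σ, 0 ≤ toReal m ⬝ᵥ v}
  zero_mem' := fun v _ => by simp [toReal_zero]
  add_mem' := fun {a b} ha hb v hv => by
    rw [toReal_add, add_dotProduct]
    exact add_nonneg (ha v hv) (hb v hv)

theorem dualMonoid_anti {σ τ : PointedCone ℝ (Fin n → ℝ)} (h : σ ≤ τ) :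
    dualMonoid τ ≤ dualMonoid σ :=
  fun _ hm v hv => hm v (h hv)

/-- The complex points `Hom(σ^∨ ∩ ℤⁿ, ℂ)` of the affine toric variety of `σ`. -/
def AffineChart (σ : PointedCone ℝ (Fin n → ℝ)) : Type :=
  Multiplicative (dualMonoid σ) →* ℂ

namespace AffineChart
variable {σ τ : PointedCone ℝ (Fin n → ℝ)}

/-- The value at a point of the character `m`, when it is regular on the chart (and `0` if it is
not). -/
def char (m : Fin n → ℤ) (x : AffineChart σ) : ℂ :=
  open Classical in
  if h : m ∈ dualMonoid σ then (show Multiplicative (dualMonoid σ) →* ℂ from x)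
    (Multiplicative.ofAdd ⟨m, h⟩) else 0

/-- The classical topology: the coarsest one for which all regular characters are continuous. -/
instance : TopologicalSpace (AffineChart σ) :=
  TopologicalSpace.induced (fun x m => char m x) Pi.topologicalSpace

theorem continuous_char (m : Fin n → ℤ) : Continuous (char m : AffineChart σ → ℂ) :=
  (continuous_apply m).comp (continuous_induced_dom (f := fun (x : AffineChart σ) m => char m x))

theorem char_zero (x : AffineChart σ) : char 0 x = 1 := by
  rw [char, dif_pos (dualMonoid σ).zero_mem]
  exact MonoidHom.map_one (show Multiplicative (dualMonoid σ) →* ℂ from x)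

theorem char_add {m m' : Fin n → ℤ} (hm : m ∈ dualMonoid σ) (hm' : m' ∈ dualMonoid σ)
    (x : AffineChart σ) : char (m + m') x = char m x * char m' x := by
  rw [char, char, char, dif_pos hm, dif_pos hm', dif_pos ((dualMonoid σ).add_mem hm hm')]
  exact MonoidHom.map_mul (show Multiplicative (dualMonoid σ) →* ℂ from x)
    (Multiplicative.ofAdd ⟨m, hm⟩) (Multiplicative.ofAdd ⟨m', hm'⟩)

theorem char_nsmul {m : Fin n → ℤ} (hm : m ∈ dualMonoid σ) (N : ℕ) (x : AffineChart σ) :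
    char (N • m) x = char m x ^ N := by
  induction N with
  | zero => rw [zero_smul, char_zero, pow_zero]
  | succ N ih =>
    rw [succ_nsmul, char_add ((dualMonoid σ).nsmul_mem hm N) hm, ih, pow_succ]

/-- The map of affine toric varieties induced by an inclusion of cones. -/
def restrict (h : σ ≤ τ) (x : AffineChart σ) : AffineChart τ :=
  MonoidHom.comp (show Multiplicative (dualMonoid σ) →* ℂ from x)
    (AddMonoidHom.toMultiplicative (AddSubmonoid.inclusion (dualMonoid_anti h)))

theorem char_restrict (h : σ ≤ τ) {m : Fin n → ℤ} (hm : m ∈ dualMonoid τ) (x : AffineChart σ) :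
    char m (restrict h x) = char m x := by
  rw [char, char, dif_pos hm, dif_pos (dualMonoid_anti h hm)]
  rfl

theorem continuous_restrict (h : σ ≤ τ) :
    Continuous (restrict h : AffineChart σ → AffineChart τ) := by
  refine continuous_induced_rng.2 (continuous_pi fun m => ?_)
  by_cases hm : m ∈ dualMonoid τ
  · exact (continuous_char m).congr fun x => (char_restrict h hm x).symm
  · exact continuous_const.congr fun x => (dif_neg hm).symm

/-- The Laurent monomial with exponent `e` is regular at the point `x`. -/
def Regular (e : Fin n → ℤ) (x : AffineChart σ) : Prop :=
  ∃ d ∈ dualMonoid σ, e + d ∈ dualMonoid σ ∧ char d x ≠ 0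

/-- The value at `x` of the Laurent monomial with exponent `e`, when it is regular there (and `0`
if it is not). -/
def laurent (e : Fin n → ℤ) (x : AffineChart σ) : ℂ :=
  open Classical in
  if h : Regular e x then char (e + h.choose) x / char h.choose x else 0

theorem laurent_eq {e d : Fin n → ℤ} {x : AffineChart σ} (hd : d ∈ dualMonoid σ)
    (hed : e + d ∈ dualMonoid σ) (hx : char d x ≠ 0) :
    laurent e x = char (e + d) x / char d x := by
  have h : Regular e x := ⟨d, hd, hed, hx⟩
  obtain ⟨h1, h2, h3⟩ := h.choose_spec
  rw [laurent, dif_pos h, div_eq_div_iff h3 hx, ← char_add h2 hd, ← char_add hed h1]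
  congr 1
  abel

theorem laurent_zero (x : AffineChart σ) : laurent 0 x = 1 := by
  rw [laurent_eq (d := 0) (dualMonoid σ).zero_mem (by simp [(dualMonoid σ).zero_mem])
    (by simp [char_zero])]
  simp [char_zero]

theorem Regular.add {e e' : Fin n → ℤ} {x : AffineChart σ} (h : Regular e x)
    (h' : Regular e' x) : Regular (e + e') x := by
  obtain ⟨d, hd, hed, hx⟩ := h
  obtain ⟨d', hd', hed', hx'⟩ := h'
  refine ⟨d + d', add_mem hd hd', ?_, ?_⟩
  · rw [add_add_add_comm]
    exact add_mem hed hed'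
  · rw [char_add hd hd']
    exact mul_ne_zero hx hx'

theorem laurent_add {e e' : Fin n → ℤ} {x : AffineChart σ} (h : Regular e x)
    (h' : Regular e' x) : laurent (e + e') x = laurent e x * laurent e' x := by
  obtain ⟨d, hd, hed, hx⟩ := h
  obtain ⟨d', hd', hed', hx'⟩ := h'
  have h1 : e + e' + (d + d') = (e + d) + (e' + d') := by abel
  rw [laurent_eq hd hed hx, laurent_eq hd' hed' hx', laurent_eq (d := d + d') (add_mem hd hd')
    (by rw [h1]; exact add_mem hed hed') (by rw [char_add hd hd']; exact mul_ne_zero hx hx'),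
    h1, char_add hed hed', char_add hd hd', div_mul_div_comm]

theorem Regular.of_restrict (h : σ ≤ τ) {e : Fin n → ℤ} {z : AffineChart σ}
    (hz : Regular e (restrict h z)) : laurent e (restrict h z) = laurent e z := by
  obtain ⟨d, hd, hed, hx⟩ := hz
  rw [laurent_eq hd hed hx, laurent_eq (dualMonoid_anti h hd) (dualMonoid_anti h hed)
    (by rwa [char_restrict h hd] at hx), char_restrict h hd, char_restrict h hed]

end AffineChart

/-- The gluing of the affine charts of two cones along the chart of their intersection. -/
def glue (S : Set (PointedCone ℝ (Fin n → ℝ))) (p q : Σ σ : S, AffineChart σ.1) : Prop :=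
  ∃ z : AffineChart (p.1.1 ⊓ q.1.1),
    z.restrict inf_le_left = p.2 ∧ z.restrict inf_le_right = q.2

theorem glue_iff {S : Set (PointedCone ℝ (Fin n → ℝ))} {σ τ : S} {x : AffineChart σ.1}
    {y : AffineChart τ.1} : glue S ⟨σ, x⟩ ⟨τ, y⟩ ↔ ∃ z : AffineChart (σ.1 ⊓ τ.1),
      z.restrict inf_le_left = x ∧ z.restrict inf_le_right = y :=
  Iff.rfl

/-- The complex points, with the classical topology, of the toric variety of a fan. -/
def ToricVariety (S : Set (PointedCone ℝ (Fin n → ℝ))) : Type :=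
  Quot (glue S)

instance (S : Set (PointedCone ℝ (Fin n → ℝ))) : TopologicalSpace (ToricVariety S) :=
  inferInstanceAs (TopologicalSpace (Quot (glue S)))

namespace ToricVariety
variable {S S' : Set (PointedCone ℝ (Fin n → ℝ))}

/-- A point given in an affine chart. -/
def mk (p : Σ σ : S, AffineChart σ.1) : ToricVariety S := Quot.mk _ p

theorem isOpen_iff {W : Set (ToricVariety S)} :
    IsOpen W ↔ ∀ σ : S, IsOpen {x : AffineChart σ.1 | mk ⟨σ, x⟩ ∈ W} := by
  change IsOpen ((Quot.mk (glue S)) ⁻¹' W) ↔ _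
  rw [isOpen_sigma_iff]
  rfl

theorem continuousOn_of_chart {Y : Type} [TopologicalSpace Y] {W : Set (ToricVariety S)}
    (hW : IsOpen W) {g : ToricVariety S → Y}
    (h : ∀ σ : S, ContinuousOn (fun x : AffineChart σ.1 => g (mk ⟨σ, x⟩))
      {x | mk ⟨σ, x⟩ ∈ W}) : ContinuousOn g W := by
  rw [continuousOn_open_iff hW]
  intro V hV
  rw [isOpen_iff]
  intro σ
  exact (h σ).isOpen_inter_preimage (isOpen_iff.1 hW σ) hV

/-- The toric morphism, induced by the identity of the lattice, when each cone of the first fan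
lies in some cone of the second. -/
def map (h : Refines S S') : ToricVariety S → ToricVariety S' :=
  Quot.lift (fun p => mk ⟨⟨(h p.1.1 p.1.2).choose, (h p.1.1 p.1.2).choose_spec.1⟩,
      p.2.restrict (h p.1.1 p.1.2).choose_spec.2⟩) (by
    rintro ⟨σ, x⟩ ⟨τ, y⟩ hxy
    obtain ⟨z, rfl, rfl⟩ := glue_iff.1 hxy
    refine Quot.sound ⟨z.restrict (inf_le_inf (h σ.1 σ.2).choose_spec.2
      (h τ.1 τ.2).choose_spec.2), ?_, ?_⟩ <;> rfl)

theorem continuous_map (h : Refines S S') : Continuous (map h) := by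
  refine continuous_quot_lift _ (continuous_sigma fun σ => ?_)
  have h1 : Continuous (fun x : AffineChart (h σ.1 σ.2).choose =>
      (mk ⟨⟨_, (h σ.1 σ.2).choose_spec.1⟩, x⟩ : ToricVariety S')) :=
    continuous_quot_mk.comp (continuous_sigmaMk (σ := fun τ : S' => AffineChart τ.1)
      (i := ⟨_, (h σ.1 σ.2).choose_spec.1⟩))
  exact h1.comp (AffineChart.continuous_restrict (h σ.1 σ.2).choose_spec.2)

end ToricVariety

/-- Combinatorial data of the zero divisor of a section `f` of a toric line bundle with frames
`χ^(frame i)`: the frame `χ^(frame i)` generates the bundle over the open set `χ^(loc i σ) ≠ 0` of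
each chart. -/
structure ToricData (S : Set (PointedCone ℝ (Fin n → ℝ))) where
  ι : Type
  loc : ι → S → Fin n → ℤ
  loc_mem : ∀ i σ, loc i σ ∈ dualMonoid σ.1
  loc_compat : ∀ i σ τ, loc i σ - loc i τ ∈ dualMonoid (σ.1 ⊓ τ.1)
  cover : ∀ σ, ∃ i, -loc i σ ∈ dualMonoid σ.1
  frame : ι → Fin n → ℤ
  f : (Fin n → ℤ) →₀ ℂ
  regular : ∀ i σ, ∀ a ∈ f.support, ∃ N : ℕ, a - frame i + N • loc i σ ∈ dualMonoid σ.1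
  trans : ∀ i j σ, ∃ N : ℕ, frame j - frame i + N • (loc i σ + loc j σ) ∈ dualMonoid σ.1

namespace ToricData
variable {S : Set (PointedCone ℝ (Fin n → ℝ))} (A : ToricData S)
open AffineChart

theorem loc_ne_zero_of_glue (i : A.ι) {p q : Σ σ : S, AffineChart σ.1} (h : glue S p q)
    (hp : char (A.loc i p.1) p.2 ≠ 0) : char (A.loc i q.1) q.2 ≠ 0 := by
  obtain ⟨σ, x⟩ := p
  obtain ⟨τ, y⟩ := q
  obtain ⟨z, rfl, rfl⟩ := glue_iff.1 h
  dsimp only at hp ⊢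
  rw [char_restrict _ (A.loc_mem i σ)] at hp
  rw [char_restrict _ (A.loc_mem i τ)]
  have h1 := char_add (dualMonoid_anti inf_le_right (A.loc_mem i τ)) (A.loc_compat i σ τ) z
  rw [add_sub_cancel] at h1
  rw [h1] at hp
  exact left_ne_zero_of_mul hp

theorem glue_symm {p q : Σ σ : S, AffineChart σ.1} (h : glue S p q) : glue S q p := by
  obtain ⟨σ, x⟩ := p
  obtain ⟨τ, y⟩ := q
  obtain ⟨z, rfl, rfl⟩ := glue_iff.1 h
  exact ⟨z.restrict (le_of_eq (inf_comm _ _)), rfl, rfl⟩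

/-- The `i`-th frame generates at the point. -/
def chartPred (i : A.ι) : ToricVariety S → Prop :=
  Quot.lift (fun p => char (A.loc i p.1) p.2 ≠ 0) fun _ _ h =>
    propext ⟨A.loc_ne_zero_of_glue i h, A.loc_ne_zero_of_glue i (glue_symm h)⟩

/-- The open set over which the `i`-th frame generates, as an open set. -/
def chart (i : A.ι) : Opens (ToricVariety S) where
  carrier := {q | A.chartPred i q}
  is_open' := by
    rw [ToricVariety.isOpen_iff]
    intro σ
    exact isOpen_ne.preimage (continuous_char (A.loc i σ))

theorem laurent_glue {e : Fin n → ℤ} {p q : Σ σ : S, AffineChart σ.1} (h : glue S p q)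
    (hp : Regular e p.2) (hq : Regular e q.2) : laurent e p.2 = laurent e q.2 := by
  obtain ⟨σ, x⟩ := p
  obtain ⟨τ, y⟩ := q
  obtain ⟨z, rfl, rfl⟩ := glue_iff.1 h
  dsimp only at hp hq ⊢
  rw [hp.of_restrict, hq.of_restrict]

theorem regular_term {i : A.ι} {σ : S} {x : AffineChart σ.1} (hx : char (A.loc i σ) x ≠ 0)
    {a : Fin n → ℤ} (ha : a ∈ A.f.support) : Regular (a - A.frame i) x := by
  obtain ⟨N, hN⟩ := A.regular i σ a ha
  refine ⟨N • A.loc i σ, AddSubmonoid.nsmul_mem _ (A.loc_mem i σ) N, hN, ?_⟩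
  rw [char_nsmul (A.loc_mem i σ)]
  exact pow_ne_zero _ hx

theorem regular_trans {i j : A.ι} {σ : S} {x : AffineChart σ.1}
    (hi : char (A.loc i σ) x ≠ 0) (hj : char (A.loc j σ) x ≠ 0) :
    Regular (A.frame j - A.frame i) x := by
  obtain ⟨N, hN⟩ := A.trans i j σ
  have h := AddSubmonoid.add_mem _ (A.loc_mem i σ) (A.loc_mem j σ)
  refine ⟨N • (A.loc i σ + A.loc j σ), AddSubmonoid.nsmul_mem _ h N, hN, ?_⟩
  rw [char_nsmul h, char_add (A.loc_mem i σ) (A.loc_mem j σ)]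
  exact pow_ne_zero _ (mul_ne_zero hi hj)

theorem trans_ne_zero {i j : A.ι} {σ : S} {x : AffineChart σ.1}
    (hi : char (A.loc i σ) x ≠ 0) (hj : char (A.loc j σ) x ≠ 0) :
    laurent (A.frame j - A.frame i) x ≠ 0 := by
  have h := laurent_add (A.regular_trans hi hj) (A.regular_trans hj hi)
  rw [sub_add_sub_cancel, sub_self, laurent_zero] at h
  exact left_ne_zero_of_mul (h ▸ one_ne_zero)

/-- The local equation `f / χ^(frame i)`, extended by `0` outside of `chart i`. -/
def equation (i : A.ι) : ToricVariety S → ℂ :=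
  open Classical in
  Quot.lift (fun p => if char (A.loc i p.1) p.2 ≠ 0 then
      A.f.sum fun a c => c * laurent (a - A.frame i) p.2 else 0) (by
    intro p q h
    by_cases hp : char (A.loc i p.1) p.2 ≠ 0
    · have hq := A.loc_ne_zero_of_glue i h hp
      rw [if_pos hp, if_pos hq]
      refine Finset.sum_congr rfl fun a ha => ?_
      dsimp only
      rw [laurent_glue h (A.regular_term hp ha) (A.regular_term hq ha)]
    · have hq : ¬ char (A.loc i q.1) q.2 ≠ 0 :=
        fun hq => hp (A.loc_ne_zero_of_glue i (glue_symm h) hq)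
      rw [if_neg hp, if_neg hq])

/-- The transition function `χ^(frame j - frame i)`, extended by `1` outside of
`chart i ∩ chart j`. -/
def transition (i j : A.ι) : ToricVariety S → ℂˣ :=
  open Classical in
  Quot.lift (fun p => if h : char (A.loc i p.1) p.2 ≠ 0 ∧ char (A.loc j p.1) p.2 ≠ 0 then
      Units.mk0 (laurent (A.frame j - A.frame i) p.2) (A.trans_ne_zero h.1 h.2) else 1) (by
    intro p q h
    by_cases hp : char (A.loc i p.1) p.2 ≠ 0 ∧ char (A.loc j p.1) p.2 ≠ 0
    · have hq : char (A.loc i q.1) q.2 ≠ 0 ∧ char (A.loc j q.1) q.2 ≠ 0 :=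
        ⟨A.loc_ne_zero_of_glue i h hp.1, A.loc_ne_zero_of_glue j h hp.2⟩
      rw [dif_pos hp, dif_pos hq]
      ext
      exact laurent_glue h (A.regular_trans hp.1 hp.2) (A.regular_trans hq.1 hq.2)
    · have hq : ¬ (char (A.loc i q.1) q.2 ≠ 0 ∧ char (A.loc j q.1) q.2 ≠ 0) :=
        fun hq => hp ⟨A.loc_ne_zero_of_glue i (glue_symm h) hq.1,
          A.loc_ne_zero_of_glue j (glue_symm h) hq.2⟩
      rw [dif_neg hp, dif_neg hq])

theorem equation_mk {i : A.ι} {σ : S} {x : AffineChart σ.1} (hx : char (A.loc i σ) x ≠ 0) :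
    A.equation i (ToricVariety.mk ⟨σ, x⟩) =
      ∑ a ∈ A.f.support, A.f a * laurent (a - A.frame i) x :=
  if_pos hx

theorem transition_mk {i j : A.ι} {σ : S} {x : AffineChart σ.1}
    (hi : char (A.loc i σ) x ≠ 0) (hj : char (A.loc j σ) x ≠ 0) :
    (A.transition i j (ToricVariety.mk ⟨σ, x⟩) : ℂ) = laurent (A.frame j - A.frame i) x := by
  refine congrArg Units.val (a₂ := Units.mk0 _ (A.trans_ne_zero hi hj)) ?_
  exact dif_pos ⟨hi, hj⟩

theorem continuousOn_laurent {σ : S} {e d : Fin n → ℤ} (hd : d ∈ dualMonoid σ.1)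
    (hed : e + d ∈ dualMonoid σ.1) :
    ContinuousOn (fun x : AffineChart σ.1 => laurent e x) {x | char d x ≠ 0} := by
  refine ContinuousOn.congr (f := fun x => char (e + d) x / char d x) ?_
    fun x hx => laurent_eq hd hed hx
  exact (continuous_char _).continuousOn.div (continuous_char _).continuousOn fun x hx => hx

theorem cocycle_aux {i j k : A.ι} {σ : S} {x : AffineChart σ.1}
    (hi : char (A.loc i σ) x ≠ 0) (hj : char (A.loc j σ) x ≠ 0) (hk : char (A.loc k σ) x ≠ 0) :
    laurent (A.frame k - A.frame i) x =
      laurent (A.frame j - A.frame i) x * laurent (A.frame k - A.frame j) x := by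
  rw [← laurent_add (A.regular_trans hi hj) (A.regular_trans hj hk)]
  congr 1
  abel

/-- The Cartier divisor of zeros of `f`. -/
def divisor : CartierDivisor (TopCat.of (ToricVariety S)) where
  ι := A.ι
  chart := A.chart
  cover := by
    rintro ⟨⟨σ, x⟩⟩
    obtain ⟨i, hi⟩ := A.cover σ
    refine ⟨i, ?_⟩
    change char (A.loc i σ) x ≠ 0
    have h := char_add (A.loc_mem i σ) hi x
    rw [add_neg_cancel, char_zero] at h
    exact left_ne_zero_of_mul (h ▸ one_ne_zero)
  equation := A.equation
  continuousOn_equation i := by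
    refine ToricVariety.continuousOn_of_chart (A.chart i).isOpen fun σ => ?_
    refine ContinuousOn.congr (f := fun x : AffineChart σ.1 =>
      ∑ a ∈ A.f.support, A.f a * laurent (a - A.frame i) x) ?_ fun x hx => A.equation_mk hx
    refine continuousOn_finsetSum _ fun a ha => continuousOn_const.mul ?_
    obtain ⟨N, hN⟩ := A.regular i σ a ha
    refine (continuousOn_laurent (AddSubmonoid.nsmul_mem _ (A.loc_mem i σ) N) hN).mono ?_
    intro x hx
    change char _ x ≠ 0
    rw [char_nsmul (A.loc_mem i σ)]
    exact pow_ne_zero _ hx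
  transition := A.transition
  continuousOn_transition i j := by
    refine ToricVariety.continuousOn_of_chart ((A.chart i).isOpen.inter (A.chart j).isOpen)
      fun σ => ?_
    refine (Units.isEmbedding_val₀ (G₀ := ℂ)).isInducing.continuousOn_iff.2 ?_
    refine ContinuousOn.congr (f := fun x : AffineChart σ.1 =>
      laurent (A.frame j - A.frame i) x) ?_ fun x hx => A.transition_mk hx.1 hx.2
    obtain ⟨N, hN⟩ := A.trans i j σ
    have h := AddSubmonoid.add_mem _ (A.loc_mem i σ) (A.loc_mem j σ)
    refine (continuousOn_laurent (AddSubmonoid.nsmul_mem _ h N) hN).mono ?_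
    intro x hx
    change char _ x ≠ 0
    rw [char_nsmul h, char_add (A.loc_mem i σ) (A.loc_mem j σ)]
    exact pow_ne_zero _ (mul_ne_zero hx.1 hx.2)
  equation_eq := by
    rintro i j ⟨⟨σ, x⟩⟩ hi hj
    have hi : char (A.loc i σ) x ≠ 0 := hi
    have hj : char (A.loc j σ) x ≠ 0 := hj
    refine (A.equation_mk hi).trans ?_
    refine Eq.trans ?_ (congrArg₂ (· * ·) (A.transition_mk hi hj) (A.equation_mk hj)).symm
    rw [Finset.mul_sum]
    refine Finset.sum_congr rfl fun a ha => ?_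
    rw [mul_left_comm, ← laurent_add (A.regular_trans hi hj) (A.regular_term hj ha)]
    congr 2
    abel
  cocycle := by
    rintro i j k ⟨⟨σ, x⟩⟩ hi hj hk
    have hi : char (A.loc i σ) x ≠ 0 := hi
    have hj : char (A.loc j σ) x ≠ 0 := hj
    have hk : char (A.loc k σ) x ≠ 0 := hk
    apply Units.ext
    refine (A.transition_mk hi hk).trans ?_
    refine Eq.trans ?_ (congrArg₂ (· * ·) (A.transition_mk hi hj) (A.transition_mk hj hk)).symm
    exact A.cocycle_aux hi hj hk

end ToricData

section Divisors
open AffineChart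

theorem faceFan_lattice {P : Set (Fin n → ℝ)} (hP : IsReflexive P) (σ : faceFan P) :
    ∃ m : Fin n → ℤ, toReal m ∈ polarDual P ∧
      ∀ m' : Fin n → ℤ, toReal m' ∈ polarDual P → m' - m ∈ dualMonoid σ.1 := by
  obtain ⟨σ, F, hF, hne, rfl⟩ := σ
  obtain ⟨m, hm, hmF⟩ := hP.exists_lattice_face hF hne
  refine ⟨m, hm, fun m' hm' v hv => hull_nonneg (fun w hw => ?_) hv⟩
  rw [toReal_sub, sub_dotProduct, hmF w hw]
  linarith [hm' w (hF.subset hw)]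

/-- A lattice point `m` of the polar dual for which `χ^m` generates the anticanonical bundle on
the chart of the cone `σ`. -/
def localGenerator {P : Set (Fin n → ℝ)} (hP : IsReflexive P) (σ : faceFan P) : Fin n → ℤ :=
  (faceFan_lattice hP σ).choose

theorem localGenerator_mem {P : Set (Fin n → ℝ)} (hP : IsReflexive P) (σ : faceFan P) :
    toReal (localGenerator hP σ) ∈ polarDual P :=
  (faceFan_lattice hP σ).choose_spec.1

theorem sub_localGenerator_mem {P : Set (Fin n → ℝ)} (hP : IsReflexive P) (σ : faceFan P)
    {m : Fin n → ℤ} (hm : toReal m ∈ polarDual P) : m - localGenerator hP σ ∈ dualMonoid σ.1 :=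
  (faceFan_lattice hP σ).choose_spec.2 m hm

/-- The hypersurface in the toric variety of the face fan of `P` defined by a Laurent polynomial
with exponents in the polar dual of `P`, that is, by a section of the anticanonical bundle. On the
open set where `χ^m` generates the anticanonical bundle its equation is `f / χ^m`. -/
def hypersurface {P : Set (Fin n → ℝ)} (hP : IsReflexive P) (f : (Fin n → ℤ) →₀ ℂ)
    (hf : ∀ m ∈ f.support, toReal m ∈ polarDual P) :
    CartierDivisor (TopCat.of (ToricVariety (faceFan P))) :=
  ToricData.divisor
    { ι := {m : Fin n → ℤ // toReal m ∈ polarDual P}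
      loc := fun m σ => m.1 - localGenerator hP σ
      loc_mem := fun m σ => sub_localGenerator_mem hP σ m.2
      loc_compat := fun m σ τ => by
        rw [sub_sub_sub_cancel_left]
        exact dualMonoid_anti inf_le_left
          (sub_localGenerator_mem hP σ (localGenerator_mem hP τ))
      cover := fun σ => ⟨⟨_, localGenerator_mem hP σ⟩, by
        rw [sub_self, neg_zero]
        exact (dualMonoid σ.1).zero_mem⟩
      frame := fun m => m.1
      f := f
      regular := fun m σ a ha => ⟨1, by
        rw [one_smul, sub_add_sub_cancel]
        exact sub_localGenerator_mem hP σ (hf a ha)⟩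
      trans := fun m m' σ => ⟨1, by
        have h := sub_localGenerator_mem hP σ m'.2
        have h2 : m'.1 - m.1 + 1 • (m.1 - localGenerator hP σ + (m'.1 - localGenerator hP σ)) =
            (m'.1 - localGenerator hP σ) + (m'.1 - localGenerator hP σ) := by
          rw [one_smul]
          abel
        rw [h2]
        exact AddSubmonoid.add_mem _ h h⟩ }

variable {P : Set (Fin n → ℝ)} {K : Geometry.SimplicialComplex ℝ (Fin n → ℝ)}

theorem triangulationFan_facet (hK : IsRegularProjectiveTriangulation P K)
    (σ : triangulationFan K) :
    ∃ s : K.facets, σ.1 ≤ PointedCone.hull ℝ (s.1 : Set (Fin n → ℝ)) := by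
  obtain ⟨σ, t, ht, rfl⟩ := σ
  obtain ⟨s, hs, hts⟩ := hK.exists_facet ht
  exact ⟨⟨s, hs⟩, Submodule.span_mono hts⟩

/-- A maximal simplex whose cone contains the cone `σ`. -/
def facetOf (hK : IsRegularProjectiveTriangulation P K) (σ : triangulationFan K) : K.facets :=
  (triangulationFan_facet hK σ).choose

theorem le_facetOf (hK : IsRegularProjectiveTriangulation P K) (σ : triangulationFan K) :
    σ.1 ≤ PointedCone.hull ℝ ((facetOf hK σ).1 : Set (Fin n → ℝ)) :=
  (triangulationFan_facet hK σ).choose_spec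

theorem mem_dualMonoid_of_facet (hK : IsRegularProjectiveTriangulation P K)
    (σ : triangulationFan K) {m : Fin n → ℤ}
    (h : ∀ v ∈ (facetOf hK σ).1, v ≠ 0 → 0 ≤ toReal m ⬝ᵥ v) : m ∈ dualMonoid σ.1 := by
  refine dualMonoid_anti (le_facetOf hK σ) fun v hv => hull_nonneg (fun w hw => ?_) hv
  by_cases hw0 : w = 0
  · simp [hw0]
  · exact h w hw hw0

/-- The number `0` at the vertices of the maximal simplex `t` and `1` at the others. -/
def outside (t : K.facets) (v : Fin n → ℝ) : ℤ :=
  open Classical in if v ∈ t.1 then 0 else 1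

theorem outside_nonneg (t : K.facets) (v : Fin n → ℝ) : 0 ≤ outside t v := by
  rw [outside]; split_ifs <;> simp

/-- The Cartier divisor `∑ a v • D_v` on the toric variety of a regular triangulation, where `D_v`
is the toric prime divisor of the nonzero vertex `v`. On the affine chart of the maximal simplex
`t` its equation is `χ^e` with `⟨e, v⟩ = a v` for all nonzero vertices `v` of `t`. -/
def toricDivisor (hK : IsRegularProjectiveTriangulation P K) (a : (Fin n → ℝ) → ℕ) :
    CartierDivisor (TopCat.of (ToricVariety (triangulationFan K))) :=
  ToricData.divisor
    { ι := K.facets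
      loc := fun t σ => hK.exponent (outside t) (facetOf hK σ)
      loc_mem := fun t σ => mem_dualMonoid_of_facet hK σ fun v hv hv0 => by
        rw [hK.exponent_dot _ _ v hv hv0]
        exact_mod_cast outside_nonneg t v
      loc_compat := fun t σ τ v hv => by
        rw [toReal_sub, sub_dotProduct, hK.exponent_compat (outside t) (facetOf hK σ)
          (facetOf hK τ) (le_facetOf hK σ hv.1) (le_facetOf hK τ hv.2), sub_self]
      cover := fun σ => ⟨facetOf hK σ, mem_dualMonoid_of_facet hK σ fun v hv hv0 => by
        rw [toReal_neg, neg_dotProduct, hK.exponent_dot _ _ v hv hv0, outside, if_pos hv]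
        simp⟩
      frame := fun t => -hK.exponent (fun v => a v) t
      f := Finsupp.single 0 1
      regular := fun t σ m hm => by
        have hm0 : m = 0 := by simpa using hm
        subst hm0
        obtain ⟨M, hM⟩ := ((facetOf hK σ).1.image fun v =>
          -(toReal (hK.exponent (fun v => a v) t) ⬝ᵥ v)).exists_le
        obtain ⟨N, hN⟩ := exists_nat_ge M
        refine ⟨N, mem_dualMonoid_of_facet hK σ fun v hv hv0 => ?_⟩
        rw [zero_sub, neg_neg, toReal_add, toReal_nsmul, add_dotProduct, smul_dotProduct,
          hK.exponent_dot _ (facetOf hK σ) v hv hv0, smul_eq_mul, outside]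
        split_ifs with hvt
        · rw [hK.exponent_dot _ t v hvt hv0]
          simp
        · have := hM _ (Finset.mem_image_of_mem _ hv)
          push_cast
          linarith
      trans := fun t t' σ => by
        obtain ⟨M, hM⟩ := ((facetOf hK σ).1.image fun v =>
          -(toReal (-hK.exponent (fun v => a v) t' - -hK.exponent (fun v => a v) t) ⬝ᵥ v)).exists_le
        obtain ⟨N, hN⟩ := exists_nat_ge M
        refine ⟨N, mem_dualMonoid_of_facet hK σ fun v hv hv0 => ?_⟩
        rw [toReal_add, toReal_nsmul, toReal_add, add_dotProduct, smul_dotProduct, add_dotProduct,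
          hK.exponent_dot _ (facetOf hK σ) v hv hv0, hK.exponent_dot _ (facetOf hK σ) v hv hv0,
          smul_eq_mul]
        have h1 := hM _ (Finset.mem_image_of_mem _ hv)
        have h2 : (0 : ℝ) ≤ N := Nat.cast_nonneg N
        by_cases hvt : v ∈ t.1
        · by_cases hvt' : v ∈ t'.1
          · rw [toReal_sub, toReal_neg, toReal_neg, sub_dotProduct, neg_dotProduct, neg_dotProduct,
              hK.exponent_dot _ t v hvt hv0, hK.exponent_dot _ t' v hvt' hv0, outside, outside,
              if_pos hvt, if_pos hvt']
            simp
          · rw [outside, outside, if_pos hvt, if_neg hvt']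
            push_cast
            linarith
        · by_cases hvt' : v ∈ t'.1
          · rw [outside, outside, if_neg hvt, if_pos hvt']
            push_cast
            linarith
          · rw [outside, outside, if_neg hvt, if_neg hvt']
            push_cast
            linarith }

end Divisors

/-- The part of a Laurent polynomial with exponents in `F`, evaluated at a point of the torus. -/
def evalFace (f : (Fin n → ℤ) →₀ ℂ) (F : Set (Fin n → ℝ)) (g : (Fin n → ℤ) → ℂ)
    (t : Fin n → ℂˣ) : ℂ :=
  open Classical in
  ∑ m ∈ f.support with toReal m ∈ F, g m * f m * ((∏ i, t i ^ m i : ℂˣ) : ℂ)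

/-- The Laurent polynomial `f` has its exponents in `Q` and for every nonempty face `F` of `Q` (the
polytope `Q` included) the polynomial `f_F` and its logarithmic derivatives have no common zero in
the torus. -/
structure IsRegularSection (Q : Set (Fin n → ℝ)) (f : (Fin n → ℤ) →₀ ℂ) : Prop where
  mem : ∀ m ∈ f.support, toReal m ∈ Q
  nondegenerate : ∀ F : Set (Fin n → ℝ), IsExposed ℝ Q F → F.Nonempty → ∀ t : Fin n → ℂˣ,
    evalFace f F 1 t = 0 → ∃ j, evalFace f F (fun m => m j) t ≠ 0

end ToricVarieties

section Resolution
variable {n : ℕ} {P : Set (Fin n → ℝ)} {K : Geometry.SimplicialComplex ℝ (Fin n → ℝ)}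

/-- The toric variety `X^∨` of the fan of cones over the faces of `P`. -/
abbrev faceVariety (P : Set (Fin n → ℝ)) : TopCat.{0} :=
  TopCat.of (ToricVariety (faceFan P))

/-- The toric variety of the fan of cones over the simplices of a triangulation. -/
abbrev triangulationVariety (K : Geometry.SimplicialComplex ℝ (Fin n → ℝ)) : TopCat.{0} :=
  TopCat.of (ToricVariety (triangulationFan K))

/-- The crepant resolution `π^∨`: the toric morphism of the subdivision of the fan. -/
def resolution (hP : IsReflexive P) (hK : IsRegularProjectiveTriangulation P K) :
    triangulationVariety K ⟶ faceVariety P :=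
  TopCat.ofHom ⟨ToricVariety.map (hK.refines hP), ToricVariety.continuous_map _⟩

/-- The anticanonical divisor `-D₀`, the sum of all toric prime divisors. -/
def anticanonical (hK : IsRegularProjectiveTriangulation P K) :
    CartierDivisor (triangulationVariety K) :=
  toricDivisor hK fun _ => 1

end Resolution

end ToricCup

end

open ToricCup

/-! The second equality comes from adjunction together with the fact that the resolution `π` is
crepant; the first then follows by extending the coefficients from `ℚ` to `ℂ`.

Crepancy: let `t` be a maximal simplex and `m` the lattice point with value `-1` at every nonzero
vertex of `t`. Since the polytope is reflexive, `m` lies in the polar dual (`neg_exponent_one_mem`).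
So `χ^m` is a frame of the anticanonical bundle below as well as above, and the line bundle of `Y`
pulls back to the line bundle of `-D₀` (`exists_resolutionFrameMap`). The class of a divisor is a
composite of the connecting morphisms of the frame sequence and of the exponential sequence; both
are natural for inverse images, and the inverse image of `ℤ` is `ℤ`, whence `π^*[Y] = [-D₀]`
(`FrameMap.exists_iso`).

Adjunction: `Hom (ℚ, Rπ_*ℚ[i])` is `Hom (π⁻¹ℚ, ℚ[i])`, and precomposition with `[Y]` becomes
precomposition with `π^*[Y]`. The argument runs over `ℤ`, where the Chern classes live: tensoring
with the field is left adjoint to restriction of scalars, so all groups are rewritten with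
coefficients in complexes of sheaves of abelian groups (`nonempty_cupEquiv_pushforward`). Instead of
a derived right adjoint on whole categories, only couniversal morphisms at particular complexes are
used.

Extension of coefficients: on a compact Hausdorff space every class with coefficients in `K`
involves only finitely many vectors of a basis of `K` over `k`. This is proved by a Mayer-Vietoris
induction on the degree (`fixedNear_of_isCompact`). Hence the image of the cohomology over `k` spans
the cohomology over `K`, coordinate maps split it, and the rank does not change
(`rank_eq_of_descends`, `rank_totalCup_divisorClass_eq`).

The resolution satisfies the topological hypotheses. It is Hausdorff because the strictly convex
function yields, for any two maximal simplices, a lattice point separating their cones, so that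
gluing is a closed relation (`exists_separates`, `isClosed_glued`). It is compact because the cones
cover the space: finitely many compact polydiscs contain the torus, which is dense. -/

open CategoryTheory Limits TopologicalSpace Opposite
attribute [local instance] HasDerivedCategory.standard

noncomputable section

namespace ToricCup

/-! ### Right adjoints known only at a given object -/

section Couniversal

variable {A B : Type*} [Category* A] [Category* B]

/-- A morphism `c : L Y ⟶ Z` which represents the functor `X ↦ Hom (L X, Z)`. -/
def IsCouniversal (L : A ⥤ B) {Y : A} {Z : B} (c : L.obj Y ⟶ Z) : Prop :=
  ∀ X : A, Function.Bijective fun f : X ⟶ Y => L.map f ≫ c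

theorem _root_.CategoryTheory.Adjunction.isCouniversal_counit {L : A ⥤ B} {R : B ⥤ A} (adj : L ⊣ R)
    (Z : B) : IsCouniversal L (adj.counit.app Z) := fun X => by
  have h : (fun f : X ⟶ R.obj Z => L.map f ≫ adj.counit.app Z) = (adj.homEquiv X Z).symm := by
    funext f
    simp [Adjunction.homEquiv_counit]
  rw [show (fun f : X ⟶ R.obj Z => L.map f ≫ adj.counit.app Z) = _ from h]
  exact (adj.homEquiv X Z).symm.bijective

namespace IsCouniversal
variable {L : A ⥤ B}

theorem iso_comp {Y Y' : A} {Z : B} {c : L.obj Y ⟶ Z} (hc : IsCouniversal L c) (e : Y' ≅ Y) :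
    IsCouniversal L (L.map e.hom ≫ c) := fun X => by
  convert (hc X).comp ((Iso.homToEquiv e (Z := X)).bijective) using 1
  funext f
  simp [Iso.homToEquiv]

/-- The test object matters only up to isomorphism, so couniversality may be tested on shifts, or on
images of complexes in the derived category. -/
theorem bijective_of_iso {Y : A} {Z : B} (c : L.obj Y ⟶ Z) {X X' : A} (e : X ≅ X')
    (h : Function.Bijective fun f : X ⟶ Y => L.map f ≫ c) :
    Function.Bijective fun f : X' ⟶ Y => L.map f ≫ c := by
  convert ((Iso.homFromEquiv (L.mapIso e) (Z := Z)).bijective.comp h).comp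
    (Iso.homFromEquiv e.symm (Z := Y)).bijective using 1
  funext f
  simp [Iso.homFromEquiv]

/-- Every test object is isomorphic to some `X'⟦i⟧`, and the shift functors are fully faithful, so
undoing the shift gives back the bijection for `c`. One couniversal morphism thus controls `Hom (L
X, Z⟦i⟧)` in every degree. -/
theorem shift [HasShift A ℤ] [HasShift B ℤ] [L.CommShift ℤ] {Y : A} {Z : B} {c : L.obj Y ⟶ Z}
    (hc : IsCouniversal L c) (i : ℤ) :
    IsCouniversal L ((L.commShiftIso i).hom.app Y ≫ c⟦i⟧') := fun X => by
  refine bijective_of_iso _ ((shiftFunctor A i).objObjPreimageIso X) ?_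
  set X' := (shiftFunctor A i).objPreimage X
  have h1 := (Functor.FullyFaithful.ofFullyFaithful (shiftFunctor A i)).map_bijective X' Y
  have h2 := (Functor.FullyFaithful.ofFullyFaithful (shiftFunctor B i)).map_bijective
    (L.obj X') Z
  rw [← Function.Bijective.of_comp_iff _ h1]
  have h3 : ((fun f : X'⟦i⟧ ⟶ Y⟦i⟧ => L.map f ≫ (L.commShiftIso i).hom.app Y ≫ c⟦i⟧') ∘
      (shiftFunctor A i).map) = ((Iso.homFromEquiv ((L.commShiftIso i).symm.app X')
        (Z := (shiftFunctor B i).obj Z)) ∘ (shiftFunctor B i).map) ∘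
        fun f : X' ⟶ Y => L.map f ≫ c := by
    funext f
    simp [Iso.homFromEquiv]
  exact h3 ▸ ((Iso.homFromEquiv ((L.commShiftIso i).symm.app X')
    (Z := (shiftFunctor B i).obj Z)).bijective.comp h2).comp (hc X')

end IsCouniversal
end Couniversal

/-! ### Graded Hom groups with their cup product -/

section CupEquiv

variable {A B E : Type*} [Category.{1} A] [Category.{1} B] [Category.{1} E]
  [Preadditive A] [Preadditive B] [Preadditive E] [HasShift A ℤ] [HasShift B ℤ] [HasShift E ℤ]

/-- Additive equivalences between the graded groups `Hom (P, Y⟦i⟧)` and `Hom (P', Y'⟦i⟧)` which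
respect composition with degree two endomorphisms of `P` and `P'` and with given families of
endomorphisms of `Y` and `Y'`. -/
structure CupEquiv (S : Type) {P Y : A} (ω : ShiftedHom P P (2 : ℤ)) (s : S → (Y ⟶ Y))
    {P' Y' : B} (ω' : ShiftedHom P' P' (2 : ℤ)) (s' : S → (Y' ⟶ Y')) where
  e (i : ℤ) : ShiftedHom P Y i ≃+ ShiftedHom P' Y' i
  cup (i : ℤ) (α : ShiftedHom P Y i) :
    e (i + 2) (ω.comp α rfl) = ω'.comp (e i α) rfl
  smul (i : ℤ) (z : S) (α : ShiftedHom P Y i) : e i (α ≫ (s z)⟦i⟧') = e i α ≫ (s' z)⟦i⟧'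

namespace CupEquiv
variable {S : Type} {P Y : A} {ω : ShiftedHom P P (2 : ℤ)} {s : S → (Y ⟶ Y)}
    {P' Y' : B} {ω' : ShiftedHom P' P' (2 : ℤ)} {s' : S → (Y' ⟶ Y')}
    {P'' Y'' : E} {ω'' : ShiftedHom P'' P'' (2 : ℤ)} {s'' : S → (Y'' ⟶ Y'')}

def symm (h : CupEquiv S ω s ω' s') : CupEquiv S ω' s' ω s where
  e i := (h.e i).symm
  cup i α := by
    rw [AddEquiv.symm_apply_eq, h.cup, AddEquiv.apply_symm_apply]
  smul i z α := by
    rw [AddEquiv.symm_apply_eq, h.smul, AddEquiv.apply_symm_apply]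

def trans (h : CupEquiv S ω s ω' s') (h' : CupEquiv S ω' s' ω'' s'') :
    CupEquiv S ω s ω'' s'' where
  e i := (h.e i).trans (h'.e i)
  cup i α := by simp [h.cup, h'.cup]
  smul i z α := by simp [h.smul, h'.smul]

/-- Isomorphic coefficients. -/
def ofIsoRight [∀ i : ℤ, (shiftFunctor A i).Additive] {Y₁ : A} (s₁ : S → (Y₁ ⟶ Y₁)) (φ : Y ≅ Y₁)
    (h : ∀ z, s z ≫ φ.hom = φ.hom ≫ s₁ z) : CupEquiv S ω s ω s₁ where
  e i :=
    { toFun := fun α => α ≫ φ.hom⟦i⟧'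
      invFun := fun α => α ≫ φ.inv⟦i⟧'
      left_inv := fun α => by simp [← Functor.map_comp]
      right_inv := fun α => by simp [← Functor.map_comp]
      map_add' := fun _ _ => by simp }
  cup i α := by
    simp only [AddEquiv.coe_mk, Equiv.coe_fn_mk]
    rw [← ShiftedHom.comp_mk₀ _ 0 rfl, ← ShiftedHom.comp_mk₀ _ 0 rfl,
      ShiftedHom.comp_assoc _ _ _ _ (zero_add _) (by omega)]
  smul i z α := by
    simp only [AddEquiv.coe_mk, Equiv.coe_fn_mk, Category.assoc, ← Functor.map_comp, h]

/-- Isomorphic arguments. -/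
def ofIsoLeft {P₁ : A} (ω₁ : ShiftedHom P₁ P₁ (2 : ℤ)) (φ : P₁ ≅ P)
    (h : φ.hom ≫ ω = ω₁ ≫ φ.hom⟦(2 : ℤ)⟧') : CupEquiv S ω s ω₁ s where
  e i :=
    { toFun := fun α => φ.hom ≫ α
      invFun := fun α => φ.inv ≫ α
      left_inv := fun α => by simp
      right_inv := fun α => by simp
      map_add' := fun _ _ => by simp }
  cup i α := by
    change φ.hom ≫ ShiftedHom.comp ω α rfl = ShiftedHom.comp ω₁ (φ.hom ≫ α) rfl
    simp only [ShiftedHom.comp, Functor.map_comp, Category.assoc]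
    rw [reassoc_of% h]
  smul i z α := by simp

/-- The equivalence given by a couniversal morphism. -/
def ofIsCouniversal [∀ i : ℤ, (shiftFunctor B i).Additive] (L : A ⥤ B) [L.CommShift ℤ] [L.Additive]
    {Z : B} {c : L.obj Y ⟶ Z} (hc : IsCouniversal L c) (t : S → (Z ⟶ Z))
    (h : ∀ z, L.map (s z) ≫ c = c ≫ t z) :
    CupEquiv S ω s (ShiftedHom.map ω L) t where
  e i :=
    { Equiv.ofBijective (fun f : ShiftedHom P Y i =>
        L.map f ≫ (L.commShiftIso i).hom.app Y ≫ c⟦i⟧') (hc.shift i P) with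
      map_add' := fun _ _ => by simp }
  cup i α := by
    change L.map _ ≫ _ = _
    -- Transposition is `L` followed by composition with `c` in degree zero. As `L` respects
    -- composition of shifted morphisms, compatibility with the cup product is associativity.
    have key : ∀ (j : ℤ) (f : ShiftedHom P Y j), L.map f ≫ (L.commShiftIso j).hom.app Y ≫ c⟦j⟧' =
        (ShiftedHom.map f L).comp (ShiftedHom.mk₀ 0 rfl c) (zero_add _) := by
      intro j f
      rw [ShiftedHom.comp_mk₀]
      simp [ShiftedHom.map]
    rw [key]
    refine Eq.trans ?_ (congrArg (fun q => ShiftedHom.comp (ShiftedHom.map ω L) q rfl)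
      (key i α)).symm
    rw [ShiftedHom.map_comp, ShiftedHom.comp_assoc _ _ _ _ (zero_add _) (by omega)]
  smul i z α := by
    change L.map _ ≫ _ = (L.map _ ≫ _) ≫ _
    have h1 := (L.commShiftIso i).hom.naturality (s z)
    dsimp at h1
    rw [Functor.map_comp, Category.assoc, Category.assoc, Category.assoc, reassoc_of% h1,
      ← Functor.map_comp, h, Functor.map_comp]

end CupEquiv
end CupEquiv

/-! ### Adjunctions in the derived category -/

section Derived
open DerivedCategory

variable {A B : Type 1} [Category.{0} A] [Category.{0} B] [Abelian A] [Abelian B]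
  {L : A ⥤ B} {R : B ⥤ A} (adj : L ⊣ R) [L.Additive] [R.Additive]

/-- The adjunction on cochain complexes. -/
def complexAdjunction : L.mapHomologicalComplex (ComplexShape.up ℤ) ⊣
    R.mapHomologicalComplex (ComplexShape.up ℤ) :=
  Adjunction.mkOfUnitCounit
    { unit :=
        { app := fun K =>
            { f := fun i => adj.unit.app (K.X i)
              comm' := fun i j _ => (adj.unit.naturality (K.d i j)).symm }
          naturality := fun K K' f => by
            ext i
            exact adj.unit.naturality (f.f i) }
      counit :=
        { app := fun K =>
            { f := fun i => adj.counit.app (K.X i)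
              comm' := fun i j _ => (adj.counit.naturality (K.d i j)).symm }
          naturality := fun K K' f => by
            ext i
            exact adj.counit.naturality (f.f i) }
      left_triangle := by
        ext K i
        simp only [Functor.comp_obj, NatTrans.comp_app, Functor.whiskerRight_app,
          Functor.associator_hom_app, Functor.whiskerLeft_app, Category.id_comp]
        exact adj.left_triangle_components (K.X i)
      right_triangle := by
        ext K i
        simp only [Functor.comp_obj, NatTrans.comp_app, Functor.whiskerRight_app,
          Functor.associator_inv_app, Functor.whiskerLeft_app, Category.id_comp]
        exact adj.right_triangle_components (K.X i) }

/-- `f` is the unit followed by `R` of its transpose, and additive functors preserve homotopies. -/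
theorem homotopy_of_adj {M : CochainComplex A ℤ} {J : CochainComplex B ℤ}
    (f : M ⟶ (R.mapHomologicalComplex (ComplexShape.up ℤ)).obj J)
    (h : Nonempty (Homotopy (((complexAdjunction adj).homEquiv M J).symm f) 0)) :
    Nonempty (Homotopy f 0) := by
  obtain ⟨h⟩ := h
  have h1 : f = (complexAdjunction adj).unit.app M ≫
      (R.mapHomologicalComplex _).map (((complexAdjunction adj).homEquiv M J).symm f) := by
    refine Eq.trans ?_ ((complexAdjunction adj).homEquiv_unit ..)
    rw [Equiv.apply_symm_apply]
  rw [h1]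
  refine ⟨((R.mapHomotopy h).compLeft _).trans (Homotopy.ofEq ?_)⟩
  rw [Functor.map_zero, comp_zero]

variable [PreservesFiniteLimits L] [PreservesFiniteColimits L]

/-- The morphism `L (R J) ⟶ J` in the derived category, for a complex `J`. -/
def derivedCounit (J : CochainComplex B ℤ) :
    L.mapDerivedCategory.obj (Q.obj ((R.mapHomologicalComplex (ComplexShape.up ℤ)).obj J)) ⟶
      Q.obj J :=
  L.mapDerivedCategoryFactors.hom.app _ ≫ Q.map ((complexAdjunction adj).counit.app J)

theorem derivedCounit_naturality {J J' : CochainComplex B ℤ} (f : J ⟶ J') :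
    L.mapDerivedCategory.map (Q.map ((R.mapHomologicalComplex (ComplexShape.up ℤ)).map f)) ≫
      derivedCounit adj J' = derivedCounit adj J ≫ Q.map f := by
  rw [derivedCounit, derivedCounit, L.mapDerivedCategoryFactors_hom_naturality_assoc,
    Category.assoc, ← Functor.map_comp, ← Functor.map_comp]
  congr 2
  exact (complexAdjunction adj).counit.naturality f

/-- When `R` is exact too, both functors on complexes preserve quasi-isomorphisms, so their
adjunction localizes. Its counit at `J` is `derivedCounit`, up to the identification of `R` on
complexes with its derived functor. This case serves restriction of scalars. -/
theorem isCouniversal_derivedCounit_of_exact [PreservesFiniteLimits R] [PreservesFiniteColimits R]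
    (J : CochainComplex B ℤ) : IsCouniversal L.mapDerivedCategory (derivedCounit adj J) := by
  let : CatCommSq (L.mapHomologicalComplex (ComplexShape.up ℤ)) Q Q L.mapDerivedCategory :=
    ⟨L.mapDerivedCategoryFactors.symm⟩
  let : CatCommSq (R.mapHomologicalComplex (ComplexShape.up ℤ)) Q Q R.mapDerivedCategory :=
    ⟨R.mapDerivedCategoryFactors.symm⟩
  let adj' : L.mapDerivedCategory ⊣ R.mapDerivedCategory :=
    (complexAdjunction adj).localization Q (HomologicalComplex.quasiIso A (ComplexShape.up ℤ))
      Q (HomologicalComplex.quasiIso B (ComplexShape.up ℤ)) _ _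
  have h := (adj'.isCouniversal_counit (Q.obj J)).iso_comp (R.mapDerivedCategoryFactors.symm.app J)
  have h2 : derivedCounit adj J = L.mapDerivedCategory.map (R.mapDerivedCategoryFactors.symm.app J).hom ≫
      adj'.counit.app (Q.obj J) := by
    rw [Adjunction.localization_counit_app, ← Functor.map_comp_assoc]
    change _ = L.mapDerivedCategory.map (R.mapDerivedCategoryFactors.inv.app J ≫
      R.mapDerivedCategoryFactors.hom.app J) ≫ _
    simp
    rfl
  rw [h2]
  exact h

theorem mapHomologicalComplex_acyclic {K : CochainComplex A ℤ} (hK : K.Acyclic) :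
    ((L.mapHomologicalComplex (ComplexShape.up ℤ)).obj K).Acyclic := by
  intro i
  rw [HomologicalComplex.exactAt_iff]
  exact ((HomologicalComplex.exactAt_iff _ _).1 (hK i)).map L

/-- A map from an acyclic `K` to `R J` transposes to a map from `L K` to `J`. Since `L` is exact, `L
K` is acyclic, and the null-homotopy of the transpose yields one of the map itself. -/
theorem isKInjective_map (adj : L ⊣ R) (J : CochainComplex B ℤ) [J.IsKInjective] :
    CochainComplex.IsKInjective ((R.mapHomologicalComplex (ComplexShape.up ℤ)).obj J) where
  nonempty_homotopy_zero {K} f hK := by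
    apply homotopy_of_adj adj
    exact CochainComplex.IsKInjective.nonempty_homotopy_zero _ (mapHomologicalComplex_acyclic hK)

/-- Morphisms into a K-injective complex in the derived category are chain maps up to homotopy. This
lemma and the next one are the two halves of that fact. -/
theorem Q_map_surjective (M : CochainComplex B ℤ) (J : CochainComplex B ℤ) [J.IsKInjective] :
    Function.Surjective (Q.map : (M ⟶ J) → _) := by
  intro g
  obtain ⟨h, hh⟩ := (CochainComplex.IsKInjective.Qh_map_bijective
    ((HomotopyCategory.quotient _ _).obj M) J).surjective
    ((quotientCompQhIso B).hom.app M ≫ g ≫ (quotientCompQhIso B).inv.app J)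
  obtain ⟨h, rfl⟩ := (HomotopyCategory.quotient _ _).map_surjective h
  refine ⟨h, ?_⟩
  rw [← cancel_epi ((quotientCompQhIso B).hom.app M), ← quotientCompQhIso_hom_naturality, hh]
  simp

theorem homotopy_of_Q_map_eq_zero {M J : CochainComplex B ℤ} [J.IsKInjective] (f : M ⟶ J)
    (hf : Q.map f = 0) : Nonempty (Homotopy f 0) := by
  have h := (CochainComplex.IsKInjective.Qh_map_bijective
    ((HomotopyCategory.quotient _ _).obj M) J).injective
    (a₁ := (HomotopyCategory.quotient _ _).map f) (a₂ := 0) (by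
      rw [Functor.map_zero, ← cancel_mono ((quotientCompQhIso B).hom.app J),
        quotientCompQhIso_hom_naturality, hf, comp_zero, zero_comp])
  exact ⟨HomotopyCategory.homotopyOfEq _ _ (h.trans (Functor.map_zero _ _ _).symm)⟩

/-- Both `J` and `R J` are K-injective, so on both sides morphisms are homotopy classes of chain
maps, and the adjunction on complexes matches them. No exactness of `R` is needed, so the direct
image is allowed. -/
theorem isCouniversal_derivedCounit_of_isKInjective (J : CochainComplex B ℤ) [J.IsKInjective] :
    IsCouniversal L.mapDerivedCategory (derivedCounit adj J) := by
  have := isKInjective_map adj J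
  intro X
  refine IsCouniversal.bijective_of_iso _ (Q.objObjPreimageIso X) ?_
  generalize Q.objPreimage X = M
  have key : ∀ f : M ⟶ (R.mapHomologicalComplex (ComplexShape.up ℤ)).obj J,
      L.mapDerivedCategory.map (Q.map f) ≫ derivedCounit adj J =
        L.mapDerivedCategoryFactors.hom.app M ≫
          Q.map (((complexAdjunction adj).homEquiv M J).symm f) := by
    intro f
    rw [derivedCounit, L.mapDerivedCategoryFactors_hom_naturality_assoc, ← Functor.map_comp,
      Adjunction.homEquiv_counit]
  constructor
  · let φ : (Q.obj M ⟶ Q.obj ((R.mapHomologicalComplex (ComplexShape.up ℤ)).obj J)) →+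
        (L.mapDerivedCategory.obj (Q.obj M) ⟶ Q.obj J) :=
      { toFun := fun f => L.mapDerivedCategory.map f ≫ derivedCounit adj J
        map_zero' := by simp
        map_add' := by simp }
    refine (injective_iff_map_eq_zero φ).2 ?_
    intro f hf
    obtain ⟨f, rfl⟩ := Q_map_surjective _ _ f
    have hf : L.mapDerivedCategory.map (Q.map f) ≫ derivedCounit adj J = 0 := hf
    rw [key] at hf
    obtain ⟨h⟩ := homotopy_of_adj adj f (homotopy_of_Q_map_eq_zero _ (by
      rw [← cancel_epi (L.mapDerivedCategoryFactors.hom.app M), hf, comp_zero]))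
    rw [Q_map_eq_of_homotopy _ h, Functor.map_zero]
  · intro g
    obtain ⟨h, hh⟩ := Q_map_surjective _ J (L.mapDerivedCategoryFactors.inv.app M ≫ g)
    refine ⟨Q.map ((complexAdjunction adj).homEquiv M J h), ?_⟩
    dsimp only
    rw [key, Equiv.symm_apply_apply, hh, Iso.hom_inv_id_app_assoc]

theorem comp_cancel {C : Type*} [Category* C] {X₁ X₂ X₃ X₄ X₅ X₆ : C} (a : X₁ ⟶ X₂) (d : X₂ ⟶ X₃)
    {i : X₃ ⟶ X₄} {j : X₄ ⟶ X₃} (e : i ≫ j = 𝟙 _) {p : X₃ ⟶ X₅} {q : X₂ ⟶ X₆} {d' : X₆ ⟶ X₅}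
    (h : d ≫ p = q ≫ d') : (a ≫ d ≫ i) ≫ j ≫ p = (a ≫ q) ≫ d' := by
  rw [Category.assoc, Category.assoc, Category.assoc, reassoc_of% e, h]

/-- The morphism in the derived category adjoint to a morphism of objects. -/
def singleHom {M : A} {N : B} (φ : L.obj M ⟶ N) :
    L.mapDerivedCategory.obj ((singleFunctor A 0).obj M) ⟶ (singleFunctor B 0).obj N :=
  (L.mapDerivedCategorySingleFunctor 0).hom.app M ≫ (singleFunctor B 0).map φ

/-- The exact functor `L` carries the connecting morphism of `S` to that of `S.map L`, and
connecting morphisms are natural. The hypotheses say that `φ₁`, `φ₂`, `φ₃` form a map from `S.map L`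
to `S'`. -/
theorem map_singleδ_comp {S : ShortComplex A} (hS : S.ShortExact) {S' : ShortComplex B}
    (hS' : S'.ShortExact) (φ₁ : L.obj S.X₁ ⟶ S'.X₁) (φ₂ : L.obj S.X₂ ⟶ S'.X₂)
    (φ₃ : L.obj S.X₃ ⟶ S'.X₃) (h₁₂ : φ₁ ≫ S'.f = L.map S.f ≫ φ₂)
    (h₂₃ : φ₂ ≫ S'.g = L.map S.g ≫ φ₃) :
    ShiftedHom.map hS.singleδ L.mapDerivedCategory ≫ (singleHom φ₁)⟦(1 : ℤ)⟧' =
      singleHom φ₃ ≫ hS'.singleδ := by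
  let φ : S.map L ⟶ S' := ⟨φ₁, φ₂, φ₃, h₁₂, h₂₃⟩
  have h : (hS.map_of_exact L).singleδ ≫ ((singleFunctor B 0).map φ₁)⟦(1 : ℤ)⟧' =
      (singleFunctor B 0).map φ₃ ≫ hS'.singleδ :=
    (ShortComplex.ShortExact.singleTriangle.map (hS.map_of_exact L) hS' φ).comm₃
  have e : ((L.mapDerivedCategorySingleFunctor 0).inv.app S.X₁)⟦(1 : ℤ)⟧' ≫
      ((L.mapDerivedCategorySingleFunctor 0).hom.app S.X₁)⟦(1 : ℤ)⟧' = 𝟙 _ := by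
    rw [← Functor.map_comp, Iso.inv_hom_id_app, CategoryTheory.Functor.map_id]
  rw [ShortComplex.ShortExact.mapShiftedHom_singleδ, singleHom, singleHom, Functor.map_comp]
  exact comp_cancel _ _ e h

theorem map_comp_comp {P₀ P₁ P₂ : DerivedCategory A} {P₀' P₁' P₂' : DerivedCategory B}
    (δ : ShiftedHom P₀ P₁ (1 : ℤ)) (ε : ShiftedHom P₁ P₂ (1 : ℤ))
    (δ' : ShiftedHom P₀' P₁' (1 : ℤ)) (ε' : ShiftedHom P₁' P₂' (1 : ℤ))
    (F : DerivedCategory A ⥤ DerivedCategory B) [F.CommShift ℤ]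
    (ψ₀ : F.obj P₀ ⟶ P₀') (ψ₁ : F.obj P₁ ⟶ P₁') (ψ₂ : F.obj P₂ ⟶ P₂')
    (h : ShiftedHom.map δ F ≫ ψ₁⟦(1 : ℤ)⟧' = ψ₀ ≫ δ')
    (h' : ShiftedHom.map ε F ≫ ψ₂⟦(1 : ℤ)⟧' = ψ₁ ≫ ε') :
    ShiftedHom.map (δ.comp ε (show (1 : ℤ) + 1 = 2 from rfl)) F ≫ ψ₂⟦(2 : ℤ)⟧' =
      ψ₀ ≫ δ'.comp ε' (show (1 : ℤ) + 1 = 2 from rfl) := by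
  rw [← ShiftedHom.comp_mk₀ _ 0 rfl, ← ShiftedHom.mk₀_comp 0 rfl] at h h' ⊢
  rw [ShiftedHom.map_comp, ShiftedHom.comp_assoc _ _ _ _ (zero_add _) (by omega), h',
    ← ShiftedHom.comp_assoc _ _ _ (zero_add _) _ (by omega), h,
    ShiftedHom.comp_assoc _ _ _ _ _ (by omega)]
end Derived

/-! ### Sheaves of locally constant functions -/

section LocallyConstant
variable (R : Type) [CommRing R] (X : TopCat.{0}) (M : Type) [AddCommGroup M] [Module R M]

/-- The predicate defining the sheaf of locally constant functions. -/
def locallyConstantPredicate : LinearLocalPredicate R (fun _ : X => M) :=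
  letI : TopologicalSpace M := ⊥
  haveI : DiscreteTopology M := ⟨rfl⟩
  haveI : ContinuousConstSMul R M := ⟨fun _ => continuous_of_discreteTopology⟩
  continuousPredicate X R M

variable {X M}

theorem locallyConstantPredicate_pred {U : Opens X} {f : U → M} :
    (locallyConstantPredicate R X M).pred f ↔ IsLocallyConstant f :=
  letI : TopologicalSpace M := ⊥
  haveI : DiscreteTopology M := ⟨rfl⟩
  (IsLocallyConstant.iff_continuous f).symm

end LocallyConstant

/-! ### Extensions by zero and the Mayer-Vietoris sequence -/

section Supported
variable {X : TopCat.{0}}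

/-- The predicate defining the extension by zero of the constant sheaf `ℤ` on `U`. -/
def supportedPredicate (U : Opens X) : LinearLocalPredicate ℤ (fun _ : X => ℤ) where
  pred f := Continuous f ∧ ∀ x, x.1 ∉ U → f x = 0
  res i f hf := ⟨(TopCat.continuousLocal X ℤ).res i f hf.1, fun x hx => hf.2 _ hx⟩
  locality f hf := by
    refine ⟨(TopCat.continuousLocal X ℤ).locality f fun x => ?_, fun x hx => ?_⟩
    · obtain ⟨V, h, i, hV⟩ := hf x
      exact ⟨V, h, i, hV.1⟩
    · obtain ⟨V, h, i, hV⟩ := hf x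
      exact hV.2 ⟨x.1, h⟩ hx
  zero_mem := ⟨continuous_const, fun _ _ => rfl⟩
  add_mem f g hf hg := ⟨hf.1.add hg.1, fun x hx => by simp [hf.2 x hx, hg.2 x hx]⟩
  smul_mem r f hf := ⟨hf.1.const_smul r, fun x hx => by simp [hf.2 x hx]⟩

/-- The extension by zero of the constant sheaf `ℤ` on `U`. -/
def supportedSheaf (U : Opens X) : TopCat.Sheaf (ModuleCat.{0} ℤ) X := (supportedPredicate U).sheaf

/-- The section `1` over `U`. -/
def supportedOne (U : Opens X) : (supportedSheaf U).obj.obj (op U) :=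
  (⟨fun _ => (1 : ℤ), continuous_const, fun x hx => absurd x.2 hx⟩ : (supportedPredicate U).sections U)

/-- The section `1` over an open subset of `U`. -/
def supportedOneOf {U W : Opens X} (h : W ≤ U) : (supportedSheaf U).obj.obj (op W) :=
  (⟨fun _ => (1 : ℤ), continuous_const, fun x hx => absurd (h x.2) hx⟩ :
    (supportedPredicate U).sections W)

/-- The free presheaf on `U`, mapped to its sheafification. -/
def freeToSupported (U : Opens X) :
    yoneda.obj U ⋙ ModuleCat.free ℤ ⟶ (supportedSheaf U).obj where
  app W := ModuleCat.freeDesc (↾fun i : W.unop ⟶ U => supportedOneOf i.le)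
  naturality W W' j := by
    apply ModuleCat.free_hom_ext
    intro x
    rw [ConcreteCategory.comp_apply, ConcreteCategory.comp_apply, ModuleCat.freeDesc_apply]
    exact (congrArg _ (ModuleCat.free_map_apply _ _)).trans (ModuleCat.freeDesc_apply _ _)

theorem freeToSupported_single {U W : Opens X} (i : W ⟶ U) (n : ℤ) :
    (freeToSupported U).app (op W) (Finsupp.single i n) = n • supportedOneOf i.le := by
  have h : (Finsupp.single i n : (W ⟶ U) →₀ ℤ) = n • (Finsupp.single i 1 : (W ⟶ U) →₀ ℤ) := by
    simp
  refine (congrArg ((freeToSupported U).app (op W)) h).trans ?_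
  refine (map_smul ((freeToSupported U).app (op W)).hom n (Finsupp.single i 1)).trans ?_
  exact congrArg (n • ·) (ModuleCat.freeDesc_apply _ i)

/-- Over `W ≤ U` the free presheaf is `ℤ`, elsewhere it is zero. A section with nonzero value `n` at
`x` is constant near `x` and forces `x ∈ U`, so near `x` it is `n` times the generator; a section
with value zero at `x` vanishes near `x`. -/
theorem freeToSupported_W (U : Opens X) :
    (Opens.grothendieckTopology X).W (freeToSupported U) := by
  rw [GrothendieckTopology.W_iff_isLocallyBijective]
  constructor
  · refine ⟨fun {W} a b hab x hx => ⟨W.unop, 𝟙 _, ?_, hx⟩⟩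
    obtain ⟨W⟩ := W
    have key : ∀ c : (W ⟶ U) →₀ ℤ, (freeToSupported U).app (op W) c = 0 → c = 0 := by
      intro c hc
      by_cases h : W ≤ U
      · have hcs : c = Finsupp.single (homOfLE h) (c (homOfLE h)) := by
          ext i
          rw [Subsingleton.elim i (homOfLE h), Finsupp.single_eq_same]
        rw [hcs] at hc ⊢
        rw [freeToSupported_single] at hc
        have h1 : c (homOfLE h) * 1 = 0 := congrFun (congrArg Subtype.val hc) (⟨x, hx⟩ : W)
        rw [mul_one] at h1
        rw [h1, Finsupp.single_zero]
      · ext i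
        exact absurd i.le h
    have hab' : a - b = 0 := key (a - b) (by
      refine (map_sub ((freeToSupported U).app (op W)).hom a b).trans ?_
      exact sub_eq_zero.2 hab)
    rw [sub_eq_zero.1 hab']
    rfl
  · change TopCat.Presheaf.IsLocallySurjective _
    rw [TopCat.Presheaf.isLocallySurjective_iff]
    intro W f x hx
    obtain ⟨f, hf, hf0⟩ := f
    let n : ℤ := f ⟨x, hx⟩
    let V₀ : Opens X := ⟨Subtype.val '' (f ⁻¹' {n}),
      W.isOpen.isOpenMap_subtype_val _ ((isOpen_discrete _).preimage hf)⟩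
    have hV₀ : V₀ ≤ W := by
      rintro _ ⟨y, _, rfl⟩
      exact y.2
    have hxV : x ∈ V₀ := ⟨⟨x, hx⟩, rfl, rfl⟩
    have hfV : ∀ y : V₀, f ⟨y.1, hV₀ y.2⟩ = n := by
      rintro ⟨_, z, hz, rfl⟩
      exact hz
    by_cases hn : n = 0
    · refine ⟨V₀, hV₀, ⟨0, ?_⟩, hxV⟩
      refine (map_zero ((freeToSupported U).app (op V₀)).hom).trans (Subtype.ext (funext fun y => ?_))
      exact (hn.symm.trans (hfV y).symm)
    · have hxU : x ∈ U := by
        by_contra h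
        exact hn (hf0 ⟨x, hx⟩ h)
      refine ⟨V₀ ⊓ U, inf_le_left.trans hV₀,
        ⟨Finsupp.single (homOfLE inf_le_right) n, ?_⟩, ⟨hxV, hxU⟩⟩
      refine (freeToSupported_single _ _).trans (Subtype.ext (funext fun y => ?_))
      exact (mul_one n).trans (hfV ⟨y.1, y.2.1⟩).symm

variable {U V : Opens X} {F : TopCat.Sheaf (ModuleCat.{0} ℤ) X}

/-- By the previous lemma `supportedSheaf U` is the sheafification of the free presheaf on `U`, so
its morphisms to `F` are the sections of `F` over `U`. This is uniqueness; the next lemma is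
existence. -/
theorem supportedSheaf_hom_ext {φ ψ : supportedSheaf U ⟶ F}
    (h : φ.hom.app (op U) (supportedOne U) = ψ.hom.app (op U) (supportedOne U)) : φ = ψ := by
  apply ObjectProperty.hom_ext
  refine ((freeToSupported_W U) _ F.property).1 (NatTrans.ext (funext fun W => ?_))
  apply ModuleCat.free_hom_ext
  intro i
  have key : ∀ χ : supportedSheaf U ⟶ F, ((freeToSupported U ≫ χ.hom).app W) (ModuleCat.freeMk i) =
      F.obj.map i.op (χ.hom.app (op U) (supportedOne U)) := by
    intro χ
    have h1 := congrArg (fun q => q.hom (supportedOne U)) (χ.hom.naturality i.op)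
    refine Eq.trans ?_ h1
    exact congrArg (χ.hom.app W) (ModuleCat.freeDesc_apply _ i)
  rw [key, key, h]

theorem exists_supportedSheaf_hom (s : F.obj.obj (op U)) :
    ∃ φ : supportedSheaf U ⟶ F, φ.hom.app (op U) (supportedOne U) = s := by
  let η : yoneda.obj U ⋙ ModuleCat.free ℤ ⟶ F.obj :=
    { app := fun W => ModuleCat.freeDesc (↾fun i : W.unop ⟶ U => F.obj.map i.op s)
      naturality := fun W W' j => by
        apply ModuleCat.free_hom_ext
        intro i
        rw [ConcreteCategory.comp_apply, ConcreteCategory.comp_apply, ModuleCat.freeDesc_apply]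
        refine (congrArg _ (ModuleCat.free_map_apply _ _)).trans
          ((ModuleCat.freeDesc_apply _ _).trans ?_)
        change F.obj.map (j.unop ≫ i).op s = F.obj.map j (F.obj.map i.op s)
        rw [op_comp, Functor.map_comp]
        rfl }
  obtain ⟨φ, hφ⟩ := ((freeToSupported_W U) _ F.property).2 η
  refine ⟨⟨φ⟩, ?_⟩
  have h1 := congrArg (fun q => q.app (op U) (ModuleCat.freeMk (𝟙 U))) hφ
  have h2 : (freeToSupported U).app (op U) (ModuleCat.freeMk (𝟙 U)) = supportedOne U :=
    ModuleCat.freeDesc_apply _ (𝟙 U)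
  have h3 : η.app (op U) (ModuleCat.freeMk (𝟙 U)) = s := by
    refine (ModuleCat.freeDesc_apply _ (𝟙 U)).trans ?_
    change F.obj.map (𝟙 U).op s = s
    rw [op_id, CategoryTheory.Functor.map_id]
    rfl
  rw [← h3, ← h2]
  exact h1

/-- The inclusion of extensions by zero. -/
def supportedMap (h : V ≤ U) : supportedSheaf V ⟶ supportedSheaf U :=
  (supportedPredicate V).map (supportedPredicate U) (fun _ => LinearMap.id)
    (fun _ _ hf => ⟨hf.1, fun x hx => hf.2 x fun h' => hx (h h')⟩)

theorem supportedMap_refl (h : U ≤ U) : supportedMap h = 𝟙 (supportedSheaf U) := rfl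

theorem supportedMap_comp {W : Opens X} (h : W ≤ V) (h' : V ≤ U) :
    supportedMap h ≫ supportedMap h' = supportedMap (h.trans h') := rfl

theorem supportedMap_comp_app (h : V ≤ U) (φ : supportedSheaf U ⟶ F) :
    (supportedMap h ≫ φ).hom.app (op V) (supportedOne V) =
      F.obj.map (homOfLE h).op (φ.hom.app (op U) (supportedOne U)) :=
  congrArg (fun q => q.hom (supportedOne U)) (φ.hom.naturality (homOfLE h).op)

/-- A morphism to a quotient lifts locally. -/
theorem exists_local_lift {G : TopCat.Sheaf (ModuleCat.{0} ℤ) X} (g : F ⟶ G) [Epi g]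
    (φ : supportedSheaf U ⟶ G) {x : X} (hx : x ∈ U) :
    ∃ (V : Opens X) (h : V ≤ U) (ψ : supportedSheaf V ⟶ F), x ∈ V ∧ supportedMap h ≫ φ = ψ ≫ g := by
  have h1 := (TopCat.Presheaf.isLocallySurjective_iff g.hom).1
    ((TopCat.Sheaf.isLocallySurjective_iff_epi g).2 inferInstance) U
    (φ.hom.app (op U) (supportedOne U)) x hx
  obtain ⟨V, h, ⟨s, hs⟩, hxV⟩ := h1
  obtain ⟨ψ, hψ⟩ := exists_supportedSheaf_hom s
  refine ⟨V, h, ψ, hxV, supportedSheaf_hom_ext ?_⟩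
  rw [supportedMap_comp_app]
  refine hs.symm.trans ?_
  rw [← hψ]
  rfl

/-- The predicate defining the direct sum of two extensions by zero. -/
def supportedPairPredicate (U V : Opens X) : LinearLocalPredicate ℤ (fun _ : X => ℤ × ℤ) where
  pred f := (supportedPredicate U).pred (fun x => (f x).1) ∧
    (supportedPredicate V).pred (fun x => (f x).2)
  res i f hf := ⟨(supportedPredicate U).res i _ hf.1, (supportedPredicate V).res i _ hf.2⟩
  locality f hf := by
    refine ⟨(supportedPredicate U).locality _ fun x => ?_, (supportedPredicate V).locality _ fun x => ?_⟩
    · obtain ⟨W, h, i, hW⟩ := hf x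
      exact ⟨W, h, i, hW.1⟩
    · obtain ⟨W, h, i, hW⟩ := hf x
      exact ⟨W, h, i, hW.2⟩
  zero_mem := ⟨(supportedPredicate U).zero_mem, (supportedPredicate V).zero_mem⟩
  add_mem f g hf hg := ⟨(supportedPredicate U).add_mem _ _ hf.1 hg.1,
    (supportedPredicate V).add_mem _ _ hf.2 hg.2⟩
  smul_mem r f hf := ⟨(supportedPredicate U).smul_mem r _ hf.1,
    (supportedPredicate V).smul_mem r _ hf.2⟩

/-- The Mayer-Vietoris sequence `0 → ℤ_{U ∩ V} → ℤ_U ⊕ ℤ_V → ℤ_{U ∪ V} → 0`. -/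
def mayerVietoris (U V : Opens X) : ShortComplex (TopCat.Sheaf (ModuleCat.{0} ℤ) X) :=
  LinearLocalPredicate.shortComplex (supportedPredicate (U ⊓ V)) (supportedPairPredicate U V)
    (supportedPredicate (U ⊔ V)) (fun _ => LinearMap.prod LinearMap.id (-LinearMap.id))
    (fun _ => LinearMap.coprod LinearMap.id LinearMap.id)
    (fun _ f hf => ⟨⟨hf.1, fun x hx => hf.2 x fun h => hx h.1⟩,
      ⟨hf.1.neg, fun x hx => neg_eq_zero.2 (hf.2 x fun h => hx h.2)⟩⟩)
    (fun _ f hf => ⟨hf.1.1.add hf.2.1, fun x hx => by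
      have h1 := hf.1.2 x fun h => hx (Or.inl h)
      have h2 := hf.2.2 x fun h => hx (Or.inr h)
      simp only at h1 h2
      simp [h1, h2]⟩)
    (fun _ n => by simp)

/-- Local surjectivity is seen at each point: where `x ∈ U` the section lifts to the first summand,
where `x ∈ V` to the second, and at any other point it vanishes nearby, being locally constant. -/
theorem mayerVietoris_shortExact (U V : Opens X) : (mayerVietoris U V).ShortExact := by
  apply LinearLocalPredicate.shortExact
  · intro _ a b hab
    exact congrArg Prod.fst hab
  · intro W f hf h0
    have h0' : ∀ x : W, (f x).2 = -(f x).1 := fun x => by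
      have : (f x).1 + (f x).2 = 0 := h0 x
      exact eq_neg_of_add_eq_zero_right this
    refine ⟨fun x => (f x).1, ⟨hf.1.1, fun x hx => ?_⟩, fun x => Prod.ext rfl (h0' x).symm⟩
    by_cases hU : x.1 ∈ U
    · have h1 : (f x).2 = 0 := hf.2.2 x fun h => hx ⟨hU, h⟩
      have h2 := h0' x
      rw [h1] at h2
      exact neg_eq_zero.1 h2.symm
    · exact hf.1.2 x hU
  · intro W h hh x
    obtain ⟨hc, h0⟩ := hh
    by_cases hxU : x.1 ∈ U
    · refine ⟨W ⊓ U, ⟨x.2, hxU⟩, homOfLE inf_le_left, fun y => (h ⟨y.1, y.2.1⟩, 0),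
        ⟨⟨(TopCat.continuousLocal X ℤ).res (homOfLE inf_le_left) h hc,
          fun y hy => absurd y.2.2 hy⟩, (supportedPredicate V).zero_mem⟩, fun y => ?_⟩
      exact add_zero _
    · by_cases hxV : x.1 ∈ V
      · refine ⟨W ⊓ V, ⟨x.2, hxV⟩, homOfLE inf_le_left, fun y => (0, h ⟨y.1, y.2.1⟩),
          ⟨(supportedPredicate U).zero_mem,
            ⟨(TopCat.continuousLocal X ℤ).res (homOfLE inf_le_left) h hc,
            fun y hy => absurd y.2.2 hy⟩⟩, fun y => ?_⟩
        exact zero_add _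
      · have hx0 : h x = 0 := h0 x fun hx => hx.elim hxU hxV
        refine ⟨⟨Subtype.val '' (h ⁻¹' {0}),
          W.isOpen.isOpenMap_subtype_val _ ((isOpen_discrete _).preimage hc)⟩, ⟨x, hx0, rfl⟩,
          homOfLE (by rintro _ ⟨y, _, rfl⟩; exact y.2), fun y => 0,
          (supportedPairPredicate U V).zero_mem, ?_⟩
        rintro ⟨_, y, hy, rfl⟩
        exact hy.symm

end Supported

/-! ### Cohomology classes near compact sets -/

section LocalSurjectivity
open Abelian
variable {X : TopCat.{0}}

instance hasExtSheaf (X : TopCat.{0}) : HasExt.{1} (TopCat.Sheaf (ModuleCat.{0} ℤ) X) :=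
  HasExt.standard _

/-- The restriction to `V` of an extension class over `U`. -/
def extRes {U V : Opens X} (h : V ≤ U) {G : TopCat.Sheaf (ModuleCat.{0} ℤ) X} {i : ℕ}
    (c : Ext (supportedSheaf U) G i) : Ext (supportedSheaf V) G i :=
  (Ext.mk₀ (supportedMap h)).comp c (zero_add i)

variable {U V W : Opens X} {G : TopCat.Sheaf (ModuleCat.{0} ℤ) X} {i : ℕ}

theorem extRes_extRes (h : V ≤ U) (h' : W ≤ V) (c : Ext (supportedSheaf U) G i) :
    extRes h' (extRes h c) = extRes (h'.trans h) c := by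
  rw [extRes, extRes, extRes, Ext.mk₀_comp_mk₀_assoc, supportedMap_comp]

theorem extRes_comp (h : V ≤ U) (c : Ext (supportedSheaf U) G i)
    {G' : TopCat.Sheaf (ModuleCat.{0} ℤ) X} {j k : ℕ} (g : Ext G G' j) (hk : i + j = k) :
    extRes h (c.comp g hk) = (extRes h c).comp g hk := by
  rw [extRes, extRes, Ext.comp_assoc _ _ _ (zero_add i) hk (by omega)]

theorem extRes_sub (h : V ≤ U) (c d : Ext (supportedSheaf U) G i) :
    extRes h (c - d) = extRes h c - extRes h d := by
  rw [extRes, extRes, extRes, sub_eq_add_neg, Ext.comp_add, Ext.comp_neg, ← sub_eq_add_neg]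

/-- Classes of positive degree vanish locally. -/
theorem exists_extRes_eq_zero (i : ℕ) : ∀ {G : TopCat.Sheaf (ModuleCat.{0} ℤ) X} {U : Opens X}
    (c : Ext (supportedSheaf U) G (i + 1)) {x : X} (_ : x ∈ U),
    ∃ (V : Opens X) (h : V ≤ U), x ∈ V ∧ extRes h c = 0 := by
  induction i with
  | zero =>
    intro G U c x hx
    -- Dimension shift along an embedding of `G` in an injective: `c` is the image under the
    -- connecting map of a section `φ` of the quotient. Locally `φ` lifts to the injective, and the
    -- connecting map kills what lifts.
    let S : ShortComplex _ := ShortComplex.mk (Injective.ι G) (cokernel.π (Injective.ι G))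
      (cokernel.condition _)
    have hS : S.ShortExact := ShortComplex.ShortExact.mk' (ShortComplex.exact_cokernel _)
      inferInstance inferInstance
    obtain ⟨c', rfl⟩ := Ext.covariant_sequence_exact₁ _ hS c
      (Ext.eq_zero_of_injective (I := Injective.under G) _) (zero_add 1)
    obtain ⟨φ, rfl⟩ := (Ext.mk₀_bijective _ _).2 c'
    have : Epi S.g := hS.epi_g
    obtain ⟨V, h, ψ, hxV, hψ⟩ := exists_local_lift S.g φ hx
    refine ⟨V, h, hxV, ?_⟩
    rw [extRes_comp, extRes, Ext.mk₀_comp_mk₀, hψ, ← Ext.mk₀_comp_mk₀,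
      Ext.comp_assoc _ _ _ (zero_add 0) (zero_add 1) (zero_add 1), hS.comp_extClass, Ext.comp_zero]
  | succ i ih =>
    intro G U c x hx
    let S : ShortComplex _ := ShortComplex.mk (Injective.ι G) (cokernel.π (Injective.ι G))
      (cokernel.condition _)
    have hS : S.ShortExact := ShortComplex.ShortExact.mk' (ShortComplex.exact_cokernel _)
      inferInstance inferInstance
    obtain ⟨c', rfl⟩ := Ext.covariant_sequence_exact₁ _ hS c
      (Ext.eq_zero_of_injective (I := Injective.under G) _) (rfl : i + 1 + 1 = i + 1 + 1)
    obtain ⟨V, h, hxV, hc'⟩ := ih c' hx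
    refine ⟨V, h, hxV, ?_⟩
    rw [extRes_comp, hc', Ext.zero_comp]

/-- The projections from the direct sum of two extensions by zero. -/
def pairFst (U V : Opens X) : (supportedPairPredicate U V).sheaf ⟶ supportedSheaf U :=
  (supportedPairPredicate U V).map (supportedPredicate U) (fun _ => LinearMap.fst ℤ ℤ ℤ)
    (fun _ _ hf => hf.1)

def pairSnd (U V : Opens X) : (supportedPairPredicate U V).sheaf ⟶ supportedSheaf V :=
  (supportedPairPredicate U V).map (supportedPredicate V) (fun _ => LinearMap.snd ℤ ℤ ℤ)
    (fun _ _ hf => hf.2)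

/-- The second morphism of the Mayer-Vietoris sequence. -/
def pairSum (U V : Opens X) : (supportedPairPredicate U V).sheaf ⟶ supportedSheaf (U ⊔ V) :=
  (mayerVietoris U V).g

theorem pairSum_eq (U V : Opens X) : pairSum U V =
    pairFst U V ≫ supportedMap le_sup_left + pairSnd U V ≫ supportedMap le_sup_right := by
  apply ObjectProperty.hom_ext
  ext W f
  rfl

instance (U V : Opens X) : Epi (pairSum U V) := (mayerVietoris_shortExact U V).epi_g

/-- A class that vanishes on `U` and on `V` dies on the middle term of the Mayer-Vietoris sequence;
this is the condition of `exists_mayerVietorisClass_comp` for it to come from `U ⊓ V` in one degree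
less. -/
theorem pairSum_comp (c : Ext (supportedSheaf (U ⊔ V)) G i)
    (hU : extRes le_sup_left c = 0) (hV : extRes le_sup_right c = 0) :
    (Ext.mk₀ (pairSum U V)).comp c (zero_add i) = 0 := by
  rw [pairSum_eq, Ext.mk₀_add, Ext.add_comp, ← Ext.mk₀_comp_mk₀, ← Ext.mk₀_comp_mk₀,
    Ext.comp_assoc _ _ _ (zero_add 0) (zero_add i) (by omega),
    Ext.comp_assoc _ _ _ (zero_add 0) (zero_add i) (by omega)]
  rw [extRes] at hU hV
  rw [hU, hV, Ext.comp_zero, Ext.comp_zero, add_zero]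

/-- The class of the Mayer-Vietoris sequence. -/
def mayerVietorisClass (U V : Opens X) : Ext (supportedSheaf (U ⊔ V)) (supportedSheaf (U ⊓ V)) 1 :=
  (mayerVietoris_shortExact U V).extClass

theorem exists_mayerVietorisClass_comp {j : ℕ} (c : Ext (supportedSheaf (U ⊔ V)) G j)
    (hc : (Ext.mk₀ (pairSum U V)).comp c (zero_add j) = 0) (hj : 1 + i = j) :
    ∃ d : Ext (supportedSheaf (U ⊓ V)) G i, (mayerVietorisClass U V).comp d hj = c :=
  Ext.contravariant_sequence_exact₃ (mayerVietoris_shortExact U V) G c hc hj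

/-- The Mayer-Vietoris sequence is natural. -/
def mayerVietorisMap {U' V' : Opens X} (hU : U' ≤ U) (hV : V' ≤ V) :
    mayerVietoris U' V' ⟶ mayerVietoris U V where
  τ₁ := supportedMap (inf_le_inf hU hV)
  τ₂ := (supportedPairPredicate U' V').map (supportedPairPredicate U V) (fun _ => LinearMap.id)
    (fun _ _ hf => ⟨⟨hf.1.1, fun x hx => hf.1.2 x fun h' => hx (hU h')⟩,
      ⟨hf.2.1, fun x hx => hf.2.2 x fun h' => hx (hV h')⟩⟩)
  τ₃ := supportedMap (sup_le_sup hU hV)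
  comm₁₂ := rfl
  comm₂₃ := rfl

theorem mayerVietorisClass_naturality {U' V' : Opens X} (hU : U' ≤ U) (hV : V' ≤ V) :
    (mayerVietorisClass U' V').comp (Ext.mk₀ (supportedMap (inf_le_inf hU hV))) (add_zero 1) =
      (Ext.mk₀ (supportedMap (sup_le_sup hU hV))).comp (mayerVietorisClass U V) (zero_add 1) :=
  ShortComplex.ShortExact.extClass_naturality (mayerVietoris_shortExact U' V')
    (mayerVietoris_shortExact U V) (mayerVietorisMap hU hV)

theorem extRes_mayerVietorisClass_comp {U' V' : Opens X} (hU : U' ≤ U) (hV : V' ≤ V)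
    (d : Ext (supportedSheaf (U ⊓ V)) G i) {j : ℕ} (hj : 1 + i = j) :
    extRes (sup_le_sup hU hV) ((mayerVietorisClass U V).comp d hj) =
      (mayerVietorisClass U' V').comp (extRes (inf_le_inf hU hV) d) hj := by
  rw [extRes_comp, extRes, ← mayerVietorisClass_naturality hU hV,
    Ext.comp_assoc _ _ _ (add_zero 1) (zero_add i) (by omega), extRes]

section Fixed
variable {ι : Type} [SemilatticeSup ι] (E : ι → (G ⟶ G))

/-- The class over `U` is fixed, near `K`, by some member of the family of endomorphisms. -/
def FixedNear {i : ℕ} {U : Opens X} (c : Ext (supportedSheaf U) G i) (K : Set X) : Prop :=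
  ∃ (V : Opens X) (h : V ≤ U) (j : ι), K ⊆ V ∧
    (extRes h c).comp (Ext.mk₀ (E j)) (add_zero i) = extRes h c

variable {E}

/-- The relation `E j ≫ E k = E j` says that what `E j` produces is fixed by `E k`. -/
theorem comp_fixed_mono (hE : ∀ j k, j ≤ k → E j ≫ E k = E j) {Z : TopCat.Sheaf (ModuleCat.{0} ℤ) X}
    {j k : ι} (hjk : j ≤ k) {c : Ext Z G i} (hc : c.comp (Ext.mk₀ (E j)) (add_zero i) = c) :
    c.comp (Ext.mk₀ (E k)) (add_zero i) = c := by
  rw [← hc, Ext.comp_assoc _ _ _ (add_zero i) (add_zero 0) (by omega), Ext.mk₀_comp_mk₀, hE j k hjk]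

/-- Choose `j` such that `c` is fixed by `E j` near both sets. The difference `c E_j - c` on the
union vanishes on each piece, so it is the Mayer-Vietoris image of a class `d` on the intersection,
of one degree less. By induction `d` is fixed by some `E k` near `K₁ ∩ K₂`, and then `c` is fixed by
`E (j ⊔ k)` on smaller neighbourhoods. -/
theorem FixedNear.union [T2Space X] (hE : ∀ j k, j ≤ k → E j ≫ E k = E j)
    (ih : ∀ i' < i, ∀ {U : Opens X} (c : Ext (supportedSheaf U) G i') {K : Set X}, IsCompact K →
      K ⊆ U → FixedNear E c K) {c : Ext (supportedSheaf U) G i} {K₁ K₂ : Set X}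
    (hK₁ : IsCompact K₁) (hK₂ : IsCompact K₂) (h₁ : FixedNear E c K₁) (h₂ : FixedNear E c K₂) :
    FixedNear E c (K₁ ∪ K₂) := by
  obtain ⟨V₁, hV₁, j₁, hKV₁, hc₁⟩ := h₁
  obtain ⟨V₂, hV₂, j₂, hKV₂, hc₂⟩ := h₂
  let j := j₁ ⊔ j₂
  have hc₁' := comp_fixed_mono hE (le_sup_left : j₁ ≤ j) hc₁
  have hc₂' := comp_fixed_mono hE (le_sup_right : j₂ ≤ j) hc₂
  let e : Ext (supportedSheaf (V₁ ⊔ V₂)) G i := extRes (sup_le hV₁ hV₂) c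
  have hg := pairSum_comp (U := V₁) (V := V₂)
    (e.comp (Ext.mk₀ (E j)) (add_zero i) - e)
    (by rw [extRes_sub, extRes_comp, extRes_extRes, hc₁', sub_self])
    (by rw [extRes_sub, extRes_comp, extRes_extRes, hc₂', sub_self])
  rcases i with _ | i
  -- In degree zero there is no room for `d`: the map from the middle term is an epimorphism, so the
  -- difference itself is zero.
  · refine ⟨V₁ ⊔ V₂, sup_le hV₁ hV₂, j, Set.union_subset_union hKV₁ hKV₂, ?_⟩
    have h0 := Ext.precomp_mk₀_injective_of_epi G (pairSum V₁ V₂) (hg.trans (map_zero _).symm)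
    exact sub_eq_zero.1 h0
  · obtain ⟨d, hd⟩ := exists_mayerVietorisClass_comp (i := i) _ hg (by omega)
    obtain ⟨W, hW, k, hKW, hdk⟩ := ih i (by omega) d (hK₁.inter hK₂)
      (Set.inter_subset_inter hKV₁ hKV₂)
    -- Nothing is known of `d` outside `W`, so `V₁` and `V₂` are shrunk until they meet inside `W`.
    -- This is possible because `K₁` and `K₂ \ W` are disjoint compact sets in a Hausdorff space.
    have hK₂W : IsCompact (K₂ \ W) := hK₂.diff W.isOpen
    obtain ⟨A, B, hA, hB, hKA, hKB, hAB⟩ := SeparatedNhds.of_isCompact_isCompact hK₁ hK₂W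
      (Set.disjoint_left.2 fun x hx hx' => hx'.2 (hKW ⟨hx, hx'.1⟩))
    let V₁' : Opens X := V₁ ⊓ ⟨A, hA⟩
    let V₂' : Opens X := V₂ ⊓ (⟨B, hB⟩ ⊔ W)
    have hVW : V₁' ⊓ V₂' ≤ W := by
      rintro x ⟨⟨_, hxA⟩, ⟨_, hxB | hxW⟩⟩
      · exact absurd hxB (Set.disjoint_left.1 hAB hxA)
      · exact hxW
    have hU' : V₁' ≤ V₁ := inf_le_left
    have hU'' : V₂' ≤ V₂ := inf_le_left
    refine ⟨V₁' ⊔ V₂', (sup_le_sup hU' hU'').trans (sup_le hV₁ hV₂), j ⊔ k,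
      Set.union_subset_union (fun x hx => ⟨hKV₁ hx, hKA hx⟩) (fun x hx => ⟨hKV₂ hx, ?_⟩), ?_⟩
    · by_cases hxW : x ∈ W
      · exact Or.inr hxW
      · exact Or.inl (hKB ⟨hx, hxW⟩)
    have hd' : (extRes (inf_le_inf hU' hU'') d).comp (Ext.mk₀ (E (j ⊔ k))) (add_zero i) =
        extRes (inf_le_inf hU' hU'') d := by
      have h1 := comp_fixed_mono hE (le_sup_right : k ≤ j ⊔ k) hdk
      have h2 := congrArg (extRes hVW) h1
      rw [extRes_comp, extRes_extRes] at h2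
      exact h2
    have h3 := congrArg (extRes (sup_le_sup hU' hU'')) hd
    rw [extRes_mayerVietorisClass_comp hU' hU'', extRes_sub, extRes_comp, extRes_extRes] at h3
    -- Compose `c E_j - c` with `E (j ⊔ k)`. The difference is unchanged, as it comes from the fixed
    -- class `d`, and `c E_j` is unchanged as well; hence so is `c`.
    have h4 := congrArg (fun q => Ext.comp q (Ext.mk₀ (E (j ⊔ k))) (add_zero (i + 1))) h3
    rw [Ext.comp_assoc _ _ _ (by omega : 1 + i = i + 1) (add_zero i) (by omega), hd', h3,
      sub_eq_add_neg, Ext.add_comp, Ext.neg_comp,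
      Ext.comp_assoc _ _ _ (add_zero (i + 1)) (add_zero 0) (by omega), Ext.mk₀_comp_mk₀,
      hE j (j ⊔ k) le_sup_left] at h4
    exact (neg_injective (add_left_cancel h4)).symm

/-- Near a point, a class of positive degree vanishes and a class of degree zero is fixed by `hloc`.
Compactness and `FixedNear.union` lead from points to `K`, by strong induction on the degree. -/
theorem fixedNear_of_isCompact [Nonempty ι] [T2Space X] [LocallyCompactSpace X]
    (hE : ∀ j k, j ≤ k → E j ≫ E k = E j)
    (hloc : ∀ (U : Opens X) (φ : supportedSheaf U ⟶ G) (x : X), x ∈ U →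
      ∃ (V : Opens X) (h : V ≤ U) (j : ι), x ∈ V ∧
        (supportedMap h ≫ φ) ≫ E j = supportedMap h ≫ φ) (i : ℕ) :
    ∀ {U : Opens X} (c : Ext (supportedSheaf U) G i) {K : Set X}, IsCompact K →
      K ⊆ U → FixedNear E c K := by
  induction i using Nat.strong_induction_on with
  | _ i ih =>
  intro U c K hK hKU
  -- Compact induction runs over arbitrary subsets of `K`, while the union step needs compact ones;
  -- each subset is therefore enclosed in a compact set.
  suffices h : ∃ K' : Set X, IsCompact K' ∧ K ⊆ K' ∧ FixedNear E c K' by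
    obtain ⟨K', _, hKK', V, h, j, hV, hj⟩ := h
    exact ⟨V, h, j, hKK'.trans hV, hj⟩
  refine hK.induction_on (p := fun s => ∃ K' : Set X, IsCompact K' ∧ s ⊆ K' ∧ FixedNear E c K')
    ?_ ?_ ?_ ?_
  · refine ⟨∅, isCompact_empty, subset_rfl, ⊥, bot_le, Classical.arbitrary ι,
      Set.empty_subset _, ?_⟩
    -- The extension by zero from the empty set is the zero sheaf, so it carries no nonzero class.
    have h0 : (𝟙 (supportedSheaf (⊥ : Opens X))) = 0 := by
      apply ObjectProperty.hom_ext
      ext W f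
      apply Subtype.ext
      funext x
      exact f.2.2 x (fun h => h)
    have h1 : ∀ a : Ext (supportedSheaf (⊥ : Opens X)) G i, a = 0 := fun a => by
      rw [← Ext.mk₀_id_comp a, h0, Ext.mk₀_zero, Ext.zero_comp]
    exact (h1 _).trans (h1 _).symm
  · rintro s t hst ⟨K', hK', htK', h⟩
    exact ⟨K', hK', hst.trans htK', h⟩
  · rintro s t ⟨K₁, hK₁, hs, h₁⟩ ⟨K₂, hK₂, ht, h₂⟩
    exact ⟨K₁ ∪ K₂, hK₁.union hK₂, Set.union_subset_union hs ht, h₁.union hE ih hK₁ hK₂ h₂⟩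
  · intro x hx
    obtain ⟨V, h, j, hxV, hV⟩ : ∃ (V : Opens X) (h : V ≤ U) (j : ι), x ∈ V ∧
        (extRes h c).comp (Ext.mk₀ (E j)) (add_zero i) = extRes h c := by
      rcases i with _ | i
      · obtain ⟨φ, rfl⟩ := (Ext.mk₀_bijective _ _).2 c
        obtain ⟨V, h, j, hxV, hV⟩ := hloc U φ x (hKU hx)
        refine ⟨V, h, j, hxV, ?_⟩
        rw [extRes, Ext.mk₀_comp_mk₀, Ext.mk₀_comp_mk₀, hV]
      · obtain ⟨V, h, hxV, hV⟩ := exists_extRes_eq_zero i c (hKU hx)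
        exact ⟨V, h, Classical.arbitrary ι, hxV, by rw [hV, Ext.zero_comp]⟩
    obtain ⟨K', hK', hxK', hK'V⟩ := exists_compact_subset V.isOpen hxV
    exact ⟨K', mem_nhdsWithin_of_mem_nhds (mem_interior_iff_mem_nhds.1 hxK'),
      K', hK', subset_rfl, V, h, j, hK'V, hV⟩

end Fixed
end LocalSurjectivity

/-! ### Exactness of change of coefficients and of inverse image -/

section Functors
variable (k : Type) [Field k] (X : TopCat.{0})

/-- Restriction of scalars to `ℤ` for sheaves of modules. -/
abbrev restrictFunctor : TopCat.Sheaf (ModuleCat.{0} k) X ⥤ TopCat.Sheaf (ModuleCat.{0} ℤ) X :=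
  sheafCompose (Opens.grothendieckTopology X) (ModuleCat.restrictScalars.{0} (Int.castRingHom k))

/-- Extension of scalars is left adjoint to restriction of scalars. -/
def tensorRestrictAdj : tensorFunctor k X ⊣ restrictFunctor k X :=
  Sheaf.adjunction (Opens.grothendieckTopology X)
    (ModuleCat.extendRestrictScalarsAdj.{0} (Int.castRingHom k))

instance : PreservesFiniteLimits (restrictFunctor k X) := by
  have := (tensorRestrictAdj k X).isRightAdjoint
  infer_instance

instance : (restrictFunctor k X).Additive := Functor.additive_of_preserves_binary_products _

/-- Epimorphisms of sheaves of modules are the locally surjective maps, a condition on underlying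
sets that restriction of scalars does not alter. Left exactness supplies the rest. -/
instance : PreservesFiniteColimits (restrictFunctor k X) := by
  rw [Functor.preservesFiniteColimits_iff_forall_exact_map_and_epi]
  intro S hS
  refine ⟨hS.exact.map_of_mono_of_preservesKernel _ hS.mono_f inferInstance, ?_⟩
  have := hS.epi_g
  have h := (TopCat.Sheaf.isLocallySurjective_iff_epi S.g).2 inferInstance
  refine (TopCat.Sheaf.isLocallySurjective_iff_epi _).1 ?_
  rw [TopCat.Presheaf.isLocallySurjective_iff] at h ⊢
  exact h

/-- Preimages of open sets preserve finite intersections. This flatness makes the left Kan extension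
that defines the presheaf inverse image preserve finite limits. -/
instance representablyFlat_opensMap {X Y : TopCat.{0}} (f : X ⟶ Y) :
    RepresentablyFlat (Opens.map f) where
  cofiltered U :=
    { nonempty := ⟨StructuredArrow.mk (Y := (⊤ : Opens Y)) (homOfLE le_top : U ⟶ (Opens.map f).obj ⊤)⟩
      cone_objs := fun A B =>
        ⟨StructuredArrow.mk (Y := A.right ⊓ B.right)
          (homOfLE (le_inf A.hom.le B.hom.le) : U ⟶ (Opens.map f).obj (A.right ⊓ B.right)),
          StructuredArrow.homMk (homOfLE inf_le_left) (Subsingleton.elim _ _),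
          StructuredArrow.homMk (homOfLE inf_le_right) (Subsingleton.elim _ _), trivial⟩
      cone_maps := fun A _ _ _ =>
        ⟨A, 𝟙 A, StructuredArrow.ext _ _ (Subsingleton.elim _ _)⟩ }

instance {X Y : TopCat.{0}} (f : X ⟶ Y) :
    PreservesFiniteLimits (TopCat.Sheaf.pullback (ModuleCat.{0} ℤ) f) :=
  have := reflectsLimits_of_reflectsIsomorphisms (G := CategoryTheory.forget (ModuleCat.{0} ℤ))
  have : PreservesFiniteLimits ((Opens.map f).op.lan : (_ ⥤ _ ⥤ ModuleCat.{0} ℤ)) :=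
    lan_preservesFiniteLimits_of_flat _ _
  Functor.sheafPullbackConstruction.preservesFiniteLimits _ _ _ _

instance {X Y : TopCat.{0}} (f : X ⟶ Y) :
    PreservesFiniteColimits (TopCat.Sheaf.pullback (ModuleCat.{0} ℤ) f) := inferInstance

instance {X Y : TopCat.{0}} (f : X ⟶ Y) :
    (TopCat.Sheaf.pullback (ModuleCat.{0} ℤ) f).Additive :=
  Functor.additive_of_preserves_binary_products _

instance pushforward_additive {X Y : TopCat.{0}} (f : X ⟶ Y) :
    (TopCat.Sheaf.pushforward (ModuleCat.{0} ℤ) f).Additive :=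
  Functor.additive_of_preserves_binary_products _

end Functors

/-! ### Constant sheaves as sheaves of locally constant functions -/

section ConstantSheaf
variable (k : Type) [Field k] (X : TopCat.{0})

/-- Constants as locally constant functions. -/
def constToLocallyConstantOf : (Functor.const (Opens X)ᵒᵖ).obj (ModuleCat.of k k) ⟶
    (locallyConstantPredicate k X k).presheaf where
  app U := ModuleCat.ofHom
    { toFun := fun n => ⟨fun _ => n, (locallyConstantPredicate_pred k).2 (IsLocallyConstant.const n)⟩
      map_add' := fun _ _ => rfl
      map_smul' := fun _ _ => rfl }

theorem isLocallyBijective_constToLocallyConstantOf :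
    (Opens.grothendieckTopology X).W (constToLocallyConstantOf k X) := by
  rw [GrothendieckTopology.W_iff_isLocallyBijective]
  constructor
  · refine ⟨fun {U} a b hab x hx => ⟨U.unop, 𝟙 _, ?_, hx⟩⟩
    have := congrFun (congrArg Subtype.val hab) ⟨x, hx⟩
    exact this
  · change TopCat.Presheaf.IsLocallySurjective _
    rw [TopCat.Presheaf.isLocallySurjective_iff]
    intro U f x hx
    have hf : IsLocallyConstant f.1 := (locallyConstantPredicate_pred k).1 f.2
    let V : Opens X := ⟨Subtype.val '' (f.1 ⁻¹' {f.1 ⟨x, hx⟩}),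
      U.isOpen.isOpenMap_subtype_val _ (hf _)⟩
    have hVU : V ≤ U := by
      rintro _ ⟨y, _, rfl⟩
      exact y.2
    refine ⟨V, hVU, ⟨f.1 ⟨x, hx⟩, ?_⟩, ⟨⟨x, hx⟩, rfl, rfl⟩⟩
    apply Subtype.ext
    funext y
    obtain ⟨z, hz, hzy⟩ := y.2
    have : (⟨y.1, hVU y.2⟩ : U) = z := Subtype.ext hzy.symm
    change f.1 ⟨x, hx⟩ = f.1 ⟨y.1, hVU y.2⟩
    rw [this]
    exact hz.symm

/-- The constant sheaf is the sheaf of locally constant functions. -/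
def constSheafIsoOf : constSheaf k X ≅ (locallyConstantPredicate k X k).sheaf :=
  (@asIso _ _ _ _ ((presheafToSheaf (Opens.grothendieckTopology X) (ModuleCat.{0} k)).map
      (constToLocallyConstantOf k X))
    (((Opens.grothendieckTopology X).W_iff _).1 (isLocallyBijective_constToLocallyConstantOf k X))) ≪≫
    (sheafificationIso (locallyConstantPredicate k X k).sheaf).symm

/-- The sheaf of abelian groups of locally constant functions with values in `k`. -/
abbrev locallyConstantSheaf : TopCat.Sheaf (ModuleCat.{0} ℤ) X :=
  (locallyConstantPredicate ℤ X k).sheaf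

/-- Restriction of scalars of the sheaf of locally constant functions. -/
def restrictLocallyConstantIso :
    (restrictFunctor k X).obj (locallyConstantPredicate k X k).sheaf ≅ locallyConstantSheaf k X :=
  ObjectProperty.isoMk _ (NatIso.ofComponents (fun U => LinearEquiv.toModuleIso
    (X₁ := (ModuleCat.restrictScalars (Int.castRingHom k)).obj
      ((locallyConstantPredicate k X k).presheaf.obj U))
    (AddEquiv.toIntLinearEquiv
      { toFun := fun f => ⟨f.1, (locallyConstantPredicate_pred ℤ).2 ((locallyConstantPredicate_pred k).1 f.2)⟩
        invFun := fun f => ⟨f.1, (locallyConstantPredicate_pred k).2 ((locallyConstantPredicate_pred ℤ).1 f.2)⟩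
        map_add' := fun _ _ => rfl })) (fun _ => rfl))

variable {k}
/-- A homomorphism applied to locally constant functions. -/
def locallyConstantMap {k' : Type} [Field k'] (φ : k →+ k') :
    locallyConstantSheaf k X ⟶ locallyConstantSheaf k' X :=
  (locallyConstantPredicate ℤ X k).map (locallyConstantPredicate ℤ X k')
    (fun _ => φ.toIntLinearMap) (fun _ _ hf => (locallyConstantPredicate_pred ℤ).2
      (((locallyConstantPredicate_pred ℤ).1 hf).comp φ))

variable {X}
-- Scalar multiplication is recorded as an additive endomorphism of the coefficients, so the vector
-- space structure stays visible on sheaves of abelian groups.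
theorem restrictLocallyConstantIso_smul (z : k) :
    (restrictFunctor k X).map (z • 𝟙 (locallyConstantPredicate k X k).sheaf) ≫
      (restrictLocallyConstantIso k X).hom =
    (restrictLocallyConstantIso k X).hom ≫ locallyConstantMap X (AddMonoidHom.mulLeft z) := by
  apply ObjectProperty.hom_ext
  ext U f
  rfl

end ConstantSheaf

/-! ### Transport of the cup product between coefficients and between spaces -/

section ChangeOfSpace
open DerivedCategory

section RestrictScalars
variable {k : Type} [Field k] [CharZero k] {X : TopCat.{0}}

/-- The isomorphism in the definition of `divisorClass`. -/
def tensorSingleIso (k : Type) [Field k] [CharZero k] (X : TopCat.{0}) :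
    (tensorFunctor k X).mapDerivedCategory.obj ((singleFunctor _ 0).obj (constSheaf ℤ X)) ≅
      (singleFunctor _ 0).obj (constSheaf k X) :=
  ((tensorFunctor k X).mapDerivedCategorySingleFunctor 0).app (constSheaf ℤ X) ≪≫
    (singleFunctor _ 0).mapIso (tensorConstIso k X)

theorem divisorClass_eq (D : CartierDivisor X) : divisorClass k D = (tensorSingleIso k X).inv ≫
    ShiftedHom.map (integralClass D) (tensorFunctor k X).mapDerivedCategory ≫
    (shiftFunctor _ (2 : ℤ)).map (tensorSingleIso k X).hom := rfl

/-- Hypercohomology with coefficients in a complex of sheaves of vector spaces is the hypercohomology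
of the underlying complex of sheaves of abelian groups. -/
def cupEquivRestrict {S : Type} (D : CartierDivisor X)
    (C : CochainComplex (TopCat.Sheaf (ModuleCat.{0} k) X) ℤ) (t : S → (C ⟶ C)) :
    CupEquiv S (integralClass D)
      (fun z => Q.map (((restrictFunctor k X).mapHomologicalComplex (ComplexShape.up ℤ)).map (t z)))
      (divisorClass k D) (fun z => Q.map (t z)) :=
  -- `divisorClass` is the integral class tensored with `k`, conjugated by `tensorSingleIso`; so the
  -- first equivalence transposes along tensor and restriction, and the second undoes the
  -- conjugation.
  (CupEquiv.ofIsCouniversal (tensorFunctor k X).mapDerivedCategory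
    (isCouniversal_derivedCounit_of_exact (tensorRestrictAdj k X) C) (fun z => Q.map (t z))
    (fun z => derivedCounit_naturality (tensorRestrictAdj k X) (t z))).trans
  (CupEquiv.ofIsoLeft (divisorClass k D) (tensorSingleIso k X).symm (by
    rw [divisorClass_eq, Category.assoc, Category.assoc, Iso.symm_hom, ← Functor.map_comp,
      Iso.hom_inv_id, CategoryTheory.Functor.map_id, Category.comp_id]))

end RestrictScalars

/-- An equivalence which respects an empty family of endomorphisms. -/
def CupEquiv.castEmpty {A B : Type*} [Category.{1} A] [Category.{1} B] [Preadditive A]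
    [Preadditive B] [HasShift A ℤ] [HasShift B ℤ] {P Y : A} {ω : ShiftedHom P P (2 : ℤ)}
    {P' Y' : B} {ω' : ShiftedHom P' P' (2 : ℤ)} {s : Empty → (Y ⟶ Y)} {s' : Empty → (Y' ⟶ Y')}
    (h : CupEquiv Empty ω s ω' s') (t : Empty → (Y ⟶ Y)) (t' : Empty → (Y' ⟶ Y')) :
    CupEquiv Empty ω t ω' t' where
  e := h.e
  cup := h.cup
  smul := fun _ z => z.elim

section Injective
variable {B B' : Type 1} [Category.{0} B] [Category.{0} B'] [Abelian B] [Abelian B']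
  [EnoughInjectives B] (F : B ⥤ B') [F.Additive]

/-- The right derived functor on a complex of injectives. -/
def rightDerivedIso (K : CochainComplex.Plus (InjectiveObject B)) :
    Plus.ι.obj (F.rightDerivedFunctorPlus.obj
      (Plus.Q.obj ((InjectiveObject.ι B).mapCochainComplexPlus.obj K))) ≅
    Q.obj ((F.mapHomologicalComplex (ComplexShape.up ℤ)).obj
      (((InjectiveObject.ι B).mapHomologicalComplex (ComplexShape.up ℤ)).obj K.obj)) :=
  Plus.ι.mapIso (asIso (F.rightDerivedFunctorPlusUnit.app
      ((HomotopyCategory.Plus.quotient B).obj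
        ((InjectiveObject.ι B).mapCochainComplexPlus.obj K)))).symm

end Injective

/-- The hypercohomology of the derived direct image of the constant sheaf, with cup product by a
class, is the cohomology of the source, with cup product by the inverse image of the class. -/
theorem nonempty_cupEquiv_pushforward (k : Type) [Field k] [CharZero k] {X Y : TopCat.{0}}
    (f : X ⟶ Y) (D : CartierDivisor X) (H : CartierDivisor Y)
    (φ : (singleFunctor (TopCat.Sheaf (ModuleCat.{0} ℤ) X) 0).obj (constSheaf ℤ X) ≅
      (TopCat.Sheaf.pullback (ModuleCat.{0} ℤ) f).mapDerivedCategory.obj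
        ((singleFunctor _ 0).obj (constSheaf ℤ Y)))
    (hφ : φ.hom ≫ ShiftedHom.map (integralClass H)
        (TopCat.Sheaf.pullback (ModuleCat.{0} ℤ) f).mapDerivedCategory =
      integralClass D ≫ φ.hom⟦(2 : ℤ)⟧') :
    Nonempty (CupEquiv Empty (divisorClass k H)
      (Y := Plus.ι.obj ((derivedPushforward k f).obj (constComplex k X))) (fun z => z.elim)
      (divisorClass k D) (Y' := Plus.ι.obj (constComplex k X)) (fun z => z.elim)) := by
  -- `J` is a bounded below complex of injectives isomorphic to `k`, so `f_* J` computes the derived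
  -- direct image.
  obtain ⟨L, _, ⟨a⟩⟩ := DerivedCategory.Plus.exists_injective_nonempty_iso (constComplex k X) 0
  let J := ((InjectiveObject.ι _).mapHomologicalComplex (ComplexShape.up ℤ)).obj L.obj
  let a₁ : Plus.ι.obj ((derivedPushforward k f).obj (constComplex k X)) ≅
      Q.obj (((TopCat.Sheaf.pushforward (ModuleCat.{0} k) f).mapHomologicalComplex _).obj J) :=
    Plus.ι.mapIso ((derivedPushforward k f).mapIso a.symm) ≪≫ rightDerivedIso _ L
  let a₂ : Q.obj J ≅ Plus.ι.obj (constComplex k X) := Plus.ι.mapIso a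
  -- Restriction of scalars has an exact left adjoint, so `J` remains K-injective over `ℤ`.
  have : CochainComplex.IsKInjective (((restrictFunctor k X).mapHomologicalComplex _).obj J) :=
    isKInjective_map (tensorRestrictAdj k X) J
  -- In order: replace `Rf_* k` by `f_* J`, pass to integral coefficients on `Y`, transpose along
  -- inverse and direct image, replace the inverse image of `ℤ` by `ℤ` through `φ`, return to
  -- coefficients in `k` on `X`, and replace `J` by `k`. Restriction of scalars commutes with `f_*`
  -- definitionally, so the second and third links meet.
  exact ⟨((CupEquiv.ofIsoRight (s := fun z => z.elim) (fun z => z.elim) a₁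
      fun z => z.elim).castEmpty _ _).trans
    ((cupEquivRestrict H _ (fun z : Empty => z.elim)).symm.trans
    (((CupEquiv.ofIsCouniversal (s := fun z => z.elim)
      (TopCat.Sheaf.pullback (ModuleCat.{0} ℤ) f).mapDerivedCategory
      (isCouniversal_derivedCounit_of_isKInjective
        (TopCat.Sheaf.pullbackPushforwardAdjunction (ModuleCat.{0} ℤ) f)
        (((restrictFunctor k X).mapHomologicalComplex _).obj J)) (fun z => z.elim)
        fun z => z.elim).castEmpty _ _).trans
    (((CupEquiv.ofIsoLeft (s := fun z => z.elim) (integralClass D) φ hφ).castEmpty (fun z => z.elim) _).trans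
    ((cupEquivRestrict (S := Empty) D J (fun z => z.elim)).trans
    ((CupEquiv.ofIsoRight (s := fun z => z.elim) (fun z => z.elim) a₂
      fun z => z.elim).castEmpty _ _)))))⟩
end ChangeOfSpace

/-! ### Naturality of the first Chern class -/

section Pullback
open DerivedCategory
variable {X Y : TopCat.{0}} (f : X ⟶ Y)

/-- The morphism to a direct image given by linear maps applied pointwise. -/
def LinearLocalPredicate.mapPushforward {R : Type} [Ring R] {T : Y → Type} {T' : X → Type}
    [∀ x, AddCommGroup (T x)] [∀ x, Module R (T x)]
    [∀ x, AddCommGroup (T' x)] [∀ x, Module R (T' x)]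
    (P : LinearLocalPredicate R T) (P' : LinearLocalPredicate R T')
    (φ : ∀ x : X, T (f x) →ₗ[R] T' x)
    (hφ : ∀ (U : Opens Y) (s : ∀ y : U, T y), P.pred s →
      P'.pred (U := (Opens.map f).obj U) (fun x => φ x (s ⟨f x.1, x.2⟩))) :
    P.sheaf ⟶ (TopCat.Sheaf.pushforward (ModuleCat.{0} R) f).obj P'.sheaf :=
  ⟨{ app := fun U => ModuleCat.ofHom
      { toFun := fun s => ⟨fun x => φ x.1 (s.1 ⟨f x.1, x.2⟩), hφ _ s.1 s.2⟩
        map_add' := fun _ _ => by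
          apply Subtype.ext
          funext x
          exact map_add _ _ _
        map_smul' := fun _ _ => by
          apply Subtype.ext
          funext x
          exact map_smul _ _ _ } }⟩

/-- Composition with `f`, on sheaves of continuous functions. -/
def continuousPushforward (G : Type) [AddCommGroup G] [TopologicalSpace G] [IsTopologicalAddGroup G]
    [ContinuousConstSMul ℤ G] :
    (continuousPredicate Y ℤ G).sheaf ⟶
      (TopCat.Sheaf.pushforward (ModuleCat.{0} ℤ) f).obj (continuousPredicate X ℤ G).sheaf :=
  LinearLocalPredicate.mapPushforward f _ _ (fun _ => LinearMap.id) (fun U s hs => by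
    have hc : Continuous fun x : (Opens.map f).obj U => (⟨f x.1, x.2⟩ : U) := by fun_prop
    exact Continuous.comp (g := s) hs hc)

/-- The morphism adjoint to composition with `f`. -/
def continuousPullback (G : Type) [AddCommGroup G] [TopologicalSpace G] [IsTopologicalAddGroup G]
    [ContinuousConstSMul ℤ G] :
    (TopCat.Sheaf.pullback (ModuleCat.{0} ℤ) f).obj (continuousPredicate Y ℤ G).sheaf ⟶
      (continuousPredicate X ℤ G).sheaf :=
  ((TopCat.Sheaf.pullbackPushforwardAdjunction (ModuleCat.{0} ℤ) f).homEquiv _ _).symm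
    (continuousPushforward f G)

/-- The extension by zero from the whole space. -/
def supportedTopIso (X : TopCat.{0}) :
    supportedSheaf (⊤ : Opens X) ≅ (continuousPredicate X ℤ ℤ).sheaf where
  hom := (supportedPredicate ⊤).map (continuousPredicate X ℤ ℤ) (fun _ => LinearMap.id)
    (fun _ _ hf => hf.1)
  inv := (continuousPredicate X ℤ ℤ).map (supportedPredicate ⊤) (fun _ => LinearMap.id)
    (fun _ _ hf => ⟨hf, fun _ hx => absurd trivial hx⟩)

/-- The global section `1`. -/
def globalOne (X : TopCat.{0}) : (continuousPredicate X ℤ ℤ).sheaf.obj.obj (op ⊤) :=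
  (⟨fun _ => (1 : ℤ), continuous_const⟩ : (continuousPredicate X ℤ ℤ).sections ⊤)

/-- The case of the whole space in the description of morphisms out of `supportedSheaf U`. -/
theorem bijective_globalOne (F : TopCat.Sheaf (ModuleCat.{0} ℤ) X) : Function.Bijective
    (fun φ : (continuousPredicate X ℤ ℤ).sheaf ⟶ F => φ.hom.app (op ⊤) (globalOne X)) := by
  have h : ∀ φ : (continuousPredicate X ℤ ℤ).sheaf ⟶ F, φ.hom.app (op ⊤) (globalOne X) =
      ((supportedTopIso X).hom ≫ φ).hom.app (op ⊤) (supportedOne ⊤) := fun φ => rfl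
  constructor
  · intro φ ψ hφψ
    rw [← cancel_epi (supportedTopIso X).hom]
    apply supportedSheaf_hom_ext
    rw [← h, ← h]
    exact hφψ
  · intro s
    obtain ⟨φ, hφ⟩ := exists_supportedSheaf_hom (U := ⊤) s
    refine ⟨(supportedTopIso X).inv ≫ φ, ?_⟩
    dsimp only
    rw [h, Iso.hom_inv_id_assoc, hφ]

/-- Both sides corepresent global sections: morphisms from the inverse image of `ℤ` to `F` are
morphisms from `ℤ` to `f_* F`, that is, sections of `f_* F` over `Y`, and these are the sections of
`F` over `X`. -/
instance isIso_continuousPullback_int : IsIso (continuousPullback f ℤ) := by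
  apply isIso_of_coyoneda_map_bijective
  intro F
  let adj := TopCat.Sheaf.pullbackPushforwardAdjunction (ModuleCat.{0} ℤ) f
  rw [← (adj.homEquiv _ _).bijective.of_comp_iff']
  have h := bijective_globalOne ((TopCat.Sheaf.pushforward (ModuleCat.{0} ℤ) f).obj F)
  rw [← h.of_comp_iff']
  refine Eq.subst (motive := fun q => Function.Bijective q) ?_ (bijective_globalOne F)
  funext x
  have h1 : (adj.homEquiv _ _) (continuousPullback f ℤ ≫ x) =
      continuousPushforward f ℤ ≫ (TopCat.Sheaf.pushforward (ModuleCat.{0} ℤ) f).map x := by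
    rw [Adjunction.homEquiv_naturality_right, continuousPullback, Equiv.apply_symm_apply]
  refine Eq.trans ?_ (congrArg (fun q : (continuousPredicate Y ℤ ℤ).sheaf ⟶
    (TopCat.Sheaf.pushforward (ModuleCat.{0} ℤ) f).obj F => q.hom.app (op ⊤) (globalOne Y)) h1).symm
  rfl

/-- The line bundle of `D` is the inverse image of the line bundle of `H`. -/
structure FrameMap (D : CartierDivisor X) (H : CartierDivisor Y) where
  index : D.ι → H.ι
  mem : ∀ i x, x ∈ D.chart i → f x ∈ H.chart (index i)
  transition : ∀ i j x, x ∈ D.chart i → x ∈ D.chart j →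
    H.transition (index i) (index j) (f x) = D.transition i j x

variable {f} {D : CartierDivisor X} {H : CartierDivisor Y} (m : FrameMap f D H)

/-- The map of frames. -/
def FrameMap.frameHom (x : X) : H.Frame (f x) →+ D.Frame x where
  toFun a := (a.1, fun i => a.2 ⟨m.index i.1, m.mem i.1 x i.2⟩)
  map_zero' := rfl
  map_add' _ _ := rfl

/-- The map from the frames of `H` to the direct image of the frames of `D`. -/
def FrameMap.pushforward : H.framePredicate.sheaf ⟶
    (TopCat.Sheaf.pushforward (ModuleCat.{0} ℤ) f).obj D.framePredicate.sheaf :=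
  LinearLocalPredicate.mapPushforward f _ _ (fun x => (m.frameHom x).toIntLinearMap)
    (fun U s hs => by
    have hc : Continuous fun x : (Opens.map f).obj U => (⟨f x.1, x.2⟩ : U) := by fun_prop
    refine ⟨fun x i j => ?_, hs.2.1.comp hc, fun i => ?_⟩
    · have h1 := hs.1 ⟨f x.1, x.2⟩ ⟨m.index i.1, m.mem i.1 x i.2⟩ ⟨m.index j.1, m.mem j.1 x j.2⟩
      rw [m.transition i.1 j.1 x.1 i.2 j.2] at h1
      exact h1
    · have hc' : Continuous fun x : {x : (Opens.map f).obj U // x.1 ∈ D.chart i} =>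
          (⟨⟨f x.1.1, x.1.2⟩, m.mem i _ x.2⟩ : {y : U // y.1 ∈ H.chart (m.index i)}) := by
        fun_prop
      exact (hs.2.2 (m.index i)).comp hc')

/-- The adjoint of the map of frames. -/
def FrameMap.pullback : (TopCat.Sheaf.pullback (ModuleCat.{0} ℤ) f).obj H.framePredicate.sheaf ⟶
    D.framePredicate.sheaf :=
  ((TopCat.Sheaf.pullbackPushforwardAdjunction (ModuleCat.{0} ℤ) f).homEquiv _ _).symm m.pushforward

theorem homEquiv_symm_square {A B : Type*} [Category* A] [Category* B] {L : A ⥤ B} {R : B ⥤ A}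
    (adj : L ⊣ R) {M M' : A} {N N' : B} (a : M ⟶ R.obj N) (a' : M' ⟶ R.obj N') (g : M ⟶ M')
    (h : N ⟶ N') (w : a ≫ R.map h = g ≫ a') :
    (adj.homEquiv _ _).symm a ≫ h = L.map g ≫ (adj.homEquiv _ _).symm a' := by
  rw [← Adjunction.homEquiv_naturality_left_symm, ← Adjunction.homEquiv_naturality_right_symm, w]

/-- Composition with `f` maps the frame sequence and the exponential sequence of `Y` to the direct
images of those of `X`. The squares commute on sections by definition; transposed, they become maps
of short exact sequences out of the inverse images, and each connecting morphism is natural. -/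
theorem FrameMap.map_composite (m : FrameMap f D H) :
    ShiftedHom.map (ShiftedHom.comp (show ShiftedHom _ _ (1 : ℤ) from H.frameSequence_shortExact.singleδ)
      (show ShiftedHom _ _ (1 : ℤ) from (exponentialSequence_shortExact Y).singleδ)
      (show (1 : ℤ) + 1 = 2 from rfl)) (TopCat.Sheaf.pullback (ModuleCat.{0} ℤ) f).mapDerivedCategory ≫
      (singleHom (continuousPullback f ℤ))⟦(2 : ℤ)⟧' =
    singleHom (continuousPullback f ℤ) ≫
      ShiftedHom.comp (show ShiftedHom _ _ (1 : ℤ) from D.frameSequence_shortExact.singleδ)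
      (show ShiftedHom _ _ (1 : ℤ) from (exponentialSequence_shortExact X).singleδ)
      (show (1 : ℤ) + 1 = 2 from rfl) := by
  refine map_comp_comp _ _ _ _ _ _ (singleHom (continuousPullback f (Additive ℂˣ))) _ ?_ ?_
  · exact map_singleδ_comp H.frameSequence_shortExact D.frameSequence_shortExact
      (continuousPullback f (Additive ℂˣ)) m.pullback (continuousPullback f ℤ)
      (homEquiv_symm_square _ _ _ _ _ rfl) (homEquiv_symm_square _ _ _ _ _ rfl)
  · exact map_singleδ_comp (exponentialSequence_shortExact Y) (exponentialSequence_shortExact X)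
      (continuousPullback f ℤ) (continuousPullback f ℂ) (continuousPullback f (Additive ℂˣ))
      (homEquiv_symm_square _ _ _ _ _ rfl) (homEquiv_symm_square _ _ _ _ _ rfl)

theorem map_conj {A B : Type*} [Category* A] [Category* B] [HasShift A ℤ] [HasShift B ℤ]
    (F : A ⥤ B) [F.CommShift ℤ] {P Q : A} (a : P ≅ Q) (β : ShiftedHom Q Q (2 : ℤ))
    (γ : ShiftedHom P P (2 : ℤ)) (hγ : γ = a.hom ≫ β ≫ a.inv⟦(2 : ℤ)⟧') :
    ShiftedHom.map γ F ≫
      (F.map a.hom)⟦(2 : ℤ)⟧' = F.map a.hom ≫ ShiftedHom.map β F := by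
  have h := (F.commShiftIso (2 : ℤ)).hom.naturality a.inv
  dsimp at h
  subst hγ
  simp only [ShiftedHom.map, Functor.map_comp, Category.assoc]
  rw [reassoc_of% h, ← Functor.map_comp, ← Functor.map_comp, Iso.inv_hom_id]
  simp

theorem conj_square {A : Type*} [Category* A] [HasShift A ℤ] {P₁ P₂ P₃ P₄ : A}
    {ω₁ : ShiftedHom P₁ P₁ (2 : ℤ)} {ω₂ : ShiftedHom P₂ P₂ (2 : ℤ)} {ω₃ : ShiftedHom P₃ P₃ (2 : ℤ)}
    {ω₄ : ShiftedHom P₄ P₄ (2 : ℤ)} {a : P₁ ⟶ P₂} {b : P₂ ⟶ P₃} {c : P₃ ⟶ P₄}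
    (ha : ω₁ ≫ a⟦(2 : ℤ)⟧' = a ≫ ω₂) (hb : ω₂ ≫ b⟦(2 : ℤ)⟧' = b ≫ ω₃)
    (hc : ω₃ ≫ c⟦(2 : ℤ)⟧' = c ≫ ω₄) :
    ω₁ ≫ (a ≫ b ≫ c)⟦(2 : ℤ)⟧' = (a ≫ b ≫ c) ≫ ω₄ := by
  simp only [Functor.map_comp, Category.assoc]
  rw [reassoc_of% ha, reassoc_of% hb, hc]

/-- This is `c₁(f^*L) = f^*c₁(L)`. The isomorphism is the canonical one between the inverse image of
`ℤ` and `ℤ`, conjugated by `constSheafIso` because `integralClass` is stated for constant sheaves.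
-/
theorem FrameMap.exists_iso (m : FrameMap f D H) :
    ∃ φ : (singleFunctor (TopCat.Sheaf (ModuleCat.{0} ℤ) X) 0).obj (constSheaf ℤ X) ≅
      (TopCat.Sheaf.pullback (ModuleCat.{0} ℤ) f).mapDerivedCategory.obj
        ((singleFunctor _ 0).obj (constSheaf ℤ Y)),
      φ.hom ≫ ShiftedHom.map (integralClass H)
        (TopCat.Sheaf.pullback (ModuleCat.{0} ℤ) f).mapDerivedCategory =
      integralClass D ≫ φ.hom⟦(2 : ℤ)⟧' := by
  have : IsIso (singleHom (continuousPullback f ℤ)) := by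
    rw [singleHom]
    infer_instance
  let ρ := (TopCat.Sheaf.pullback (ModuleCat.{0} ℤ) f).mapDerivedCategory.map
    ((singleFunctor _ 0).mapIso (constSheafIso Y)).hom ≫ singleHom (continuousPullback f ℤ) ≫
      ((singleFunctor _ 0).mapIso (constSheafIso X)).inv
  have hρ : ShiftedHom.map (integralClass H)
      (TopCat.Sheaf.pullback (ModuleCat.{0} ℤ) f).mapDerivedCategory ≫ ρ⟦(2 : ℤ)⟧' =
        ρ ≫ integralClass D := by
    refine conj_square (map_conj _ ((singleFunctor _ 0).mapIso (constSheafIso Y)) _ _ rfl) m.map_composite ?_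
    refine Eq.trans ?_ (Iso.inv_hom_id_assoc ((singleFunctor _ 0).mapIso (constSheafIso X)) _).symm
    rfl
  refine ⟨(asIso ρ).symm, ?_⟩
  rw [Iso.symm_hom, Iso.inv_comp_eq, asIso_hom, ← reassoc_of% hρ, ← Functor.map_comp,
    asIso_inv, IsIso.hom_inv_id, CategoryTheory.Functor.map_id, Category.comp_id]

end Pullback

/-! ### Ranks under descent and conjugation -/

section Rank

/-- An endomorphism defined over a subfield has the same rank as its descent. -/
theorem rank_eq_of_descends {k K : Type} [Field k] [Field K] [Algebra k K] {B : Type}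
    (b : Module.Basis B k K) {V W : Type 1} [AddCommGroup V] [Module k V] [AddCommGroup W] [Module K W]
    (m : V →+ W) (hm : ∀ (q : k) (v : V), m (q • v) = algebraMap k K q • m v)
    (p : B → W →+ V) (hp : ∀ i c v, p i (c • m v) = b.repr c i • v)
    (hspan : Submodule.span K (Set.range m) = ⊤) (f : V →ₗ[k] V) (g : W →ₗ[K] W)
    (hfg : ∀ v, g (m v) = m (f v)) : g.rank = f.rank := by
  -- The image under `m` of a `k`-basis of the range of `f` turns out to be a `K`-basis of the range
  -- of `g`.
  let e := Module.Basis.ofVectorSpace k (LinearMap.range f)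
  let w : Module.Basis.ofVectorSpaceIndex k (LinearMap.range f) → W := fun j => m (e j).1
  have hw : LinearIndependent K w := by
    rw [linearIndependent_iff']
    intro s c hc j hj
    apply b.repr.injective
    ext i
    rw [map_zero, Finsupp.zero_apply]
    -- The coordinate map `p i` turns a relation over `K` into one over `k` whose coefficients are
    -- the `i`-th coordinates.
    have h1 := congrArg (p i) hc
    rw [map_sum, map_zero] at h1
    simp only [w, hp] at h1
    have he : LinearIndependent k fun j => (e j).1 :=
      e.linearIndependent.map' (LinearMap.range f).subtype (Submodule.ker_subtype _)
    exact linearIndependent_iff'.1 he s (fun j => b.repr (c j) i) h1 j hj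
  have hr : LinearMap.range g = Submodule.span K (Set.range w) := by
    apply le_antisymm
    · rw [LinearMap.range_eq_map, ← hspan, Submodule.map_span, Submodule.span_le]
      rintro _ ⟨_, ⟨v, rfl⟩, rfl⟩
      have h1 : ∀ u : LinearMap.range f, m u.1 ∈ Submodule.span K (Set.range w) := by
        intro u
        have h2 : u ∈ Submodule.span k (Set.range e) := by
          rw [e.span_eq]
          trivial
        induction h2 using Submodule.span_induction with
        | mem x hx =>
          obtain ⟨j, rfl⟩ := hx
          exact Submodule.subset_span ⟨j, rfl⟩
        | zero => simp
        | add x y _ _ hx hy =>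
          rw [Submodule.coe_add, map_add]
          exact add_mem hx hy
        | smul a x _ hx =>
          rw [Submodule.coe_smul, hm]
          exact Submodule.smul_mem _ _ hx
      rw [SetLike.mem_coe, hfg]
      exact h1 ⟨f v, v, rfl⟩
    · rw [Submodule.span_le]
      rintro _ ⟨j, rfl⟩
      obtain ⟨v, hv⟩ := (e j).2
      exact ⟨m v, by rw [hfg, hv]⟩
  rw [LinearMap.rank, LinearMap.rank, hr, rank_span hw, ← e.mk_eq_rank'',
    Cardinal.mk_range_eq _ hw.injective]

theorem rank_eq_of_conj {k : Type} [Field k] {V W : Type 1} [AddCommGroup V] [Module k V]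
    [AddCommGroup W] [Module k W] (e : V ≃ₗ[k] W) (f : V →ₗ[k] V) (g : W →ₗ[k] W)
    (h : ∀ v, e (f v) = g (e v)) : f.rank = g.rank := by
  have hr : LinearMap.range g = (LinearMap.range f).map (e : V →ₗ[k] W) := by
    ext w
    constructor
    · rintro ⟨u, rfl⟩
      refine ⟨f (e.symm u), ⟨_, rfl⟩, ?_⟩
      exact (h _).trans (by rw [e.apply_symm_apply])
    · rintro ⟨_, ⟨v, rfl⟩, rfl⟩
      exact ⟨e v, (h v).symm⟩
  rw [LinearMap.rank, LinearMap.rank, hr]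
  exact (e.submoduleMap (LinearMap.range f)).rank_eq

variable {k : Type} [Field k] {X : TopCat.{0}}

open Classical in
theorem totalCup_of (ω : H2 k X) (F : DerivedCategory.Plus (TopCat.Sheaf (ModuleCat.{0} k) X))
    (i : ℤ) (α : Hypercohomology k F i) :
    totalCup k ω F (DirectSum.of (Hypercohomology k F) i α) =
      DirectSum.of (Hypercohomology k F) (i + 2) (cup k ω F i α) := by
  rw [← DirectSum.lof_eq_of k, ← DirectSum.lof_eq_of k, totalCup]
  refine (DirectSum.toModule_lof k i α).trans ?_
  rfl

/-- A `CupEquiv` is only additive. Over `ℚ` this suffices, since additive maps between rational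
vector spaces are linear. -/
theorem rank_totalCup_eq {Y : TopCat.{0}} {ω : H2 ℚ X} {ω' : H2 ℚ Y}
    {F : DerivedCategory.Plus (TopCat.Sheaf (ModuleCat.{0} ℚ) X)}
    {F' : DerivedCategory.Plus (TopCat.Sheaf (ModuleCat.{0} ℚ) Y)}
    {s : Empty → (DerivedCategory.Plus.ι.obj F ⟶ DerivedCategory.Plus.ι.obj F)}
    {s' : Empty → (DerivedCategory.Plus.ι.obj F' ⟶ DerivedCategory.Plus.ι.obj F')}
    (E : CupEquiv Empty ω s ω' s') : (totalCup ℚ ω F).rank = (totalCup ℚ ω' F').rank := by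
  let e : TotalHypercohomology ℚ F ≃+ TotalHypercohomology ℚ F' :=
    DFinsupp.mapRange.addEquiv E.e
  have he : ∀ i (α : Hypercohomology ℚ F i), e (DirectSum.of _ i α) = DirectSum.of _ i (E.e i α) :=
    fun i α => DFinsupp.mapRange_single (hf := fun i => map_zero (E.e i))
  refine rank_eq_of_conj (e.toLinearEquiv fun q v => map_rat_smul e.toAddMonoidHom q v) _ _ ?_
  intro v
  change e _ = totalCup ℚ ω' F' (e v)
  induction v using DirectSum.induction_on with
  | zero => simp
  | of i α =>
    rw [totalCup_of, he, he, totalCup_of]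
    exact congrArg _ (E.cup i α)
  | add x y hx hy => rw [map_add, map_add, map_add, map_add, hx, hy]

end Rank

theorem map_square {C C' : Type*} [Category* C] [Category* C'] (F : C' ⥤ C) {a b : C'} {p : a ⟶ a} {q : a ⟶ b}
    {r : b ⟶ b} (h : p ≫ q = q ≫ r) : F.map p ≫ F.map q = F.map q ≫ F.map r := by
  rw [← F.map_comp, h, F.map_comp]

theorem paste_squares {C : Type*} [Category* C] {a b c : C} {p : a ⟶ a} {q : a ⟶ b} {r : b ⟶ b} {s : b ⟶ c} {t : c ⟶ c}
    (h₁ : p ≫ q = q ≫ r) (h₂ : r ≫ s = s ≫ t) : p ≫ (q ≫ s) = (q ≫ s) ≫ t := by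
  rw [reassoc_of% h₁, h₂, Category.assoc]

/-! ### The action of coefficient homomorphisms on cohomology -/

section PostComposition
variable {C : Type*} [Category.{1} C] [Preadditive C] [HasShift C ℤ]
  [∀ i : ℤ, (shiftFunctor C i).Additive]

/-- Composition with a morphism of degree zero. -/
def shiftedPostcomp (P Y Y' : C) (i : ℤ) : (Y ⟶ Y') →+ ShiftedHom P Y i →+ ShiftedHom P Y' i :=
  AddMonoidHom.mk' (fun φ => AddMonoidHom.mk' (fun α => α ≫ φ⟦i⟧')
      (fun α β => Preadditive.add_comp _ _ _ _ _ _))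
    (fun φ ψ => by
      ext α
      change α ≫ (φ + ψ)⟦i⟧' = α ≫ φ⟦i⟧' + α ≫ ψ⟦i⟧'
      rw [Functor.map_add, Preadditive.comp_add])

theorem shiftedPostcomp_apply {P Y Y' : C} {i : ℤ} (φ : Y ⟶ Y') (α : ShiftedHom P Y i) :
    shiftedPostcomp P Y Y' i φ α = α ≫ φ⟦i⟧' := rfl

theorem shiftedPostcomp_comp {P Y Y' Y'' : C} {i : ℤ} (φ : Y ⟶ Y') (ψ : Y' ⟶ Y'')
    (α : ShiftedHom P Y i) : shiftedPostcomp P Y' Y'' i ψ (shiftedPostcomp P Y Y' i φ α) =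
      shiftedPostcomp P Y Y'' i (φ ≫ ψ) α := by
  rw [shiftedPostcomp_apply, shiftedPostcomp_apply, shiftedPostcomp_apply, Category.assoc,
    ← Functor.map_comp]

theorem shiftedPostcomp_cup {P Y Y' : C} {i : ℤ} (ω : ShiftedHom P P (2 : ℤ)) (φ : Y ⟶ Y')
    (α : ShiftedHom P Y i) : shiftedPostcomp P Y Y' (i + 2) φ (ω.comp α rfl) =
      ω.comp (shiftedPostcomp P Y Y' i φ α) rfl := by
  rw [shiftedPostcomp_apply, shiftedPostcomp_apply, ← ShiftedHom.comp_mk₀ _ 0 rfl,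
    ← ShiftedHom.comp_mk₀ _ 0 rfl, ShiftedHom.comp_assoc _ _ _ _ (zero_add _) (by omega)]

end PostComposition

section BaseChange
open DerivedCategory Abelian
variable (X : TopCat.{0})

section
variable {k k' k'' : Type} [Field k] [Field k'] [Field k'']

theorem locallyConstantMap_comp (φ : k →+ k') (ψ : k' →+ k'') :
    locallyConstantMap X φ ≫ locallyConstantMap X ψ = locallyConstantMap X (ψ.comp φ) := rfl

theorem locallyConstantMap_add (φ ψ : k →+ k') :
    locallyConstantMap X (φ + ψ) = locallyConstantMap X φ + locallyConstantMap X ψ := rfl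

variable {X}

/-- The action of a homomorphism of coefficients on cohomology. -/
def coefficientMap (Z : TopCat.Sheaf (ModuleCat.{0} ℤ) X) (i : ℤ) (φ : k →+ k') :
    ShiftedHom ((singleFunctor _ 0).obj Z) ((singleFunctor _ 0).obj (locallyConstantSheaf k X)) i →+
    ShiftedHom ((singleFunctor _ 0).obj Z) ((singleFunctor _ 0).obj (locallyConstantSheaf k' X)) i :=
  shiftedPostcomp _ _ _ i ((singleFunctor _ 0).map (locallyConstantMap X φ))

variable {Z : TopCat.Sheaf (ModuleCat.{0} ℤ) X} {i : ℤ}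

theorem coefficientMap_add (φ ψ : k →+ k') :
    coefficientMap Z i (φ + ψ) = coefficientMap Z i φ + coefficientMap Z i ψ := by
  rw [coefficientMap, locallyConstantMap_add, Functor.map_add, map_add]
  rfl

theorem coefficientMap_coefficientMap (φ : k →+ k') (ψ : k' →+ k'') (α) :
    coefficientMap Z i ψ (coefficientMap Z i φ α) = coefficientMap Z i (ψ.comp φ) α := by
  rw [coefficientMap, coefficientMap, shiftedPostcomp_comp, ← Functor.map_comp,
    locallyConstantMap_comp]
  rfl

theorem coefficientMap_cup (ω : ShiftedHom ((singleFunctor _ 0).obj Z) ((singleFunctor _ 0).obj Z) (2 : ℤ))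
    (φ : k →+ k') (α) :
    coefficientMap Z (i + 2) φ (ω.comp α rfl) = ω.comp (coefficientMap Z i φ α) rfl :=
  shiftedPostcomp_cup _ _ _

end

section
variable (k : Type) [Field k] {X}

/-- The complex underlying a sheaf of vector spaces. -/
def singleRestrictIso : Q.obj (((restrictFunctor k X).mapHomologicalComplex (ComplexShape.up ℤ)).obj
      ((CochainComplex.singleFunctor _ 0).obj (constSheaf k X))) ≅
    (singleFunctor _ 0).obj (locallyConstantSheaf k X) :=
  Q.mapIso ((HomologicalComplex.singleMapHomologicalComplex (restrictFunctor k X)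
    (ComplexShape.up ℤ) 0).app (constSheaf k X)) ≪≫
  (singleFunctor _ 0).mapIso ((restrictFunctor k X).mapIso (constSheafIsoOf k X) ≪≫
    restrictLocallyConstantIso k X)

/-- The sheaf-level statement about scalars, transported to complexes concentrated in degree zero:
naturality of the comparison of such complexes is pasted to the square of sheaves. -/
theorem singleRestrictIso_smul (z : k) :
    Q.map (((restrictFunctor k X).mapHomologicalComplex (ComplexShape.up ℤ)).map
      ((CochainComplex.singleFunctor _ 0).map (z • 𝟙 (constSheaf k X)))) ≫
        (singleRestrictIso k (X := X)).hom =
      (singleRestrictIso k (X := X)).hom ≫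
        (singleFunctor _ 0).map (locallyConstantMap X (AddMonoidHom.mulLeft z)) := by
  have h1 := (HomologicalComplex.singleMapHomologicalComplex (restrictFunctor k X)
    (ComplexShape.up ℤ) 0).hom.naturality (z • 𝟙 (constSheaf k X))
  have h2 : (restrictFunctor k X).map (z • 𝟙 (constSheaf k X)) ≫
      (restrictFunctor k X).map (constSheafIsoOf k X).hom =
      (restrictFunctor k X).map (constSheafIsoOf k X).hom ≫
        (restrictFunctor k X).map (z • 𝟙 (locallyConstantPredicate k X k).sheaf) := by
    rw [← Functor.map_comp, ← Functor.map_comp, Linear.smul_comp, Linear.comp_smul,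
      Category.id_comp, Category.comp_id]
  have h3 := restrictLocallyConstantIso_smul (X := X) z
  have h4 : (restrictFunctor k X).map (z • 𝟙 (constSheaf k X)) ≫
      ((restrictFunctor k X).map (constSheafIsoOf k X).hom ≫ (restrictLocallyConstantIso k X).hom) =
      ((restrictFunctor k X).map (constSheafIsoOf k X).hom ≫ (restrictLocallyConstantIso k X).hom) ≫
        locallyConstantMap X (AddMonoidHom.mulLeft z) := by
    rw [reassoc_of% h2, h3, Category.assoc]
  have h5 := map_square Q (map_square (CochainComplex.singleFunctor _ 0) h4)
  have h6 := map_square Q h1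
  exact paste_squares h6 h5

/-- Cohomology with coefficients in a field is the cohomology of the sheaf of abelian groups of
locally constant functions. -/
theorem nonempty_cupEquiv_locallyConstant [CharZero k] (D : CartierDivisor X) :
    Nonempty (CupEquiv k (integralClass D)
      (fun z => (singleFunctor _ 0).map (locallyConstantMap X (AddMonoidHom.mulLeft z)))
      (divisorClass k D) (Y' := Plus.ι.obj (constComplex k X)) (fun z => z • 𝟙 _)) := by
  have h : ∀ z : k, Q.map ((CochainComplex.singleFunctor _ 0).map (z • 𝟙 (constSheaf k X))) =
      z • 𝟙 (Plus.ι.obj (constComplex k X)) := by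
    intro z
    refine ((DerivedCategory.singleFunctor _ 0).map_smul z (𝟙 (constSheaf k X))).trans ?_
    rw [CategoryTheory.Functor.map_id]
    rfl
  have e := cupEquivRestrict D ((CochainComplex.singleFunctor _ 0).obj (constSheaf k X))
    (fun z : k => (CochainComplex.singleFunctor _ 0).map (z • 𝟙 (constSheaf k X)))
  refine ⟨(CupEquiv.ofIsoRight _ (singleRestrictIso k (X := X)) ?_).symm.trans
    (e.trans (CupEquiv.ofIsoRight _ (Iso.refl _) ?_))⟩
  · exact singleRestrictIso_smul k
  · intro z
    rw [Iso.refl_hom]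
    exact (Category.comp_id _).trans ((h z).trans (Category.id_comp _).symm)

end
end BaseChange

/-! ### Extension of the field of coefficients -/

section FieldExtension
open DerivedCategory Abelian
variable {k K : Type} [Field k] [Field K] [Algebra k K] {B : Type} (b : Module.Basis B k K)

/-- A coordinate in a field extension. -/
def coordinateHom (i : B) : K →+ k := (b.coord i).toAddMonoidHom

/-- The projection to the span of finitely many basis vectors. -/
def basisProjection (s : Finset B) : K →+ K :=
  ∑ i ∈ s, (AddMonoidHom.mulLeft (b i)).comp
    ((algebraMap k K : k →+* K).toAddMonoidHom.comp (coordinateHom b i))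

theorem basisProjection_apply (s : Finset B) (x : K) :
    basisProjection b s x = ∑ i ∈ s, b.repr x i • b i := by
  rw [basisProjection, AddMonoidHom.finsetSum_apply]
  refine Finset.sum_congr rfl fun i _ => ?_
  rw [Algebra.smul_def, mul_comm]
  rfl

theorem basisProjection_eq_self {s : Finset B} {x : K} (h : (b.repr x).support ⊆ s) :
    basisProjection b s x = x := by
  rw [basisProjection_apply]
  conv_rhs => rw [← b.linearCombination_repr x, Finsupp.linearCombination_apply]
  exact (Finsupp.sum_of_support_subset (b.repr x) h (fun i a => a • b i)
    fun i _ => zero_smul k (b i)).symm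

theorem support_repr_basisProjection (s : Finset B) (x : K) :
    (b.repr (basisProjection b s x)).support ⊆ s := by
  intro i hi
  by_contra hs
  rw [Finsupp.mem_support_iff, basisProjection_apply] at hi
  apply hi
  rw [map_sum, Finsupp.finsetSum_apply]
  refine Finset.sum_eq_zero fun j hj => ?_
  rw [map_smul, b.repr_self, Finsupp.smul_single, Finsupp.single_eq_of_ne]
  rintro rfl
  exact hs hj

/-- This is the relation `E s ≫ E t = E s` for `s ≤ t` that `fixedNear_of_isCompact` requires of a
directed family. -/
theorem basisProjection_comp {s t : Finset B} (h : s ≤ t) :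
    (basisProjection b t).comp (basisProjection b s) = basisProjection b s := by
  ext x
  exact basisProjection_eq_self b ((support_repr_basisProjection b s x).trans h)

variable {X : TopCat.{0}}

/-- A section is locally constant, so near `x` it takes a single value, and one element of `K`
involves finitely many basis vectors. -/
theorem exists_basisProjection_fixed {U : Opens X}
    (φ : supportedSheaf U ⟶ locallyConstantSheaf K X) {x : X} (hx : x ∈ U) :
    ∃ (V : Opens X) (h : V ≤ U) (s : Finset B), x ∈ V ∧
      (supportedMap h ≫ φ) ≫ locallyConstantMap X (basisProjection b s) = supportedMap h ≫ φ := by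
  let f : (locallyConstantPredicate ℤ X K).sections U := φ.hom.app (op U) (supportedOne U)
  have hf : IsLocallyConstant f.1 := (locallyConstantPredicate_pred ℤ).1 f.2
  have ho : IsOpen (f.1 ⁻¹' {f.1 ⟨x, hx⟩}) := hf _
  refine ⟨⟨Subtype.val '' (f.1 ⁻¹' {f.1 ⟨x, hx⟩}), U.isOpen.isOpenMap_subtype_val _ ho⟩, ?_,
    (b.repr (f.1 ⟨x, hx⟩)).support, ⟨⟨x, hx⟩, rfl, rfl⟩, ?_⟩
  · rintro _ ⟨y, _, rfl⟩
    exact y.2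
  · apply supportedSheaf_hom_ext
    rw [Category.assoc, supportedMap_comp_app, supportedMap_comp_app]
    apply Subtype.ext
    funext y
    obtain ⟨z, hz, hzy⟩ := y.2
    change basisProjection b _ (f.1 ⟨y.1, _⟩) = f.1 ⟨y.1, _⟩
    have hy : f.1 ⟨y.1, by rw [← hzy]; exact z.2⟩ = f.1 ⟨x, hx⟩ := by
      refine Eq.trans (congrArg f.1 ?_) hz
      exact Subtype.ext hzy.symm
    rw [hy]
    exact basisProjection_eq_self b subset_rfl

/-- On a compact Hausdorff space every cohomology class involves only finitely many basis vectors of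
the extension of coefficients. -/
theorem exists_coefficientMap_basisProjection [T2Space X] [CompactSpace X] (i : ℤ)
    (α : ShiftedHom ((singleFunctor _ 0).obj (constSheaf ℤ X))
      ((singleFunctor _ 0).obj (locallyConstantSheaf K X)) i) :
    ∃ s : Finset B, coefficientMap _ i (basisProjection b s) α = α := by
  classical
  by_cases hi : 0 ≤ i
  · obtain ⟨m, rfl⟩ := Int.eq_ofNat_of_zero_le hi
    let e : supportedSheaf (⊤ : Opens X) ≅ constSheaf ℤ X := supportedTopIso X ≪≫ (constSheafIso X).symm
    let c : Ext (constSheaf ℤ X) (locallyConstantSheaf K X) m := Ext.homAddEquiv.symm α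
    obtain ⟨V, h, s, hV, hs⟩ := fixedNear_of_isCompact
      (E := fun s : Finset B => locallyConstantMap X (basisProjection b s))
      (fun s t hst => by rw [locallyConstantMap_comp, basisProjection_comp b hst])
      (fun U φ x hx => exists_basisProjection_fixed b φ hx) m
      ((Ext.mk₀ e.hom).comp c (zero_add m)) (K := Set.univ) isCompact_univ (fun _ _ => trivial)
    -- Compactness of `X` allows `Set.univ` as the compact set, so the neighbourhood is the whole
    -- space and the result is global.
    obtain rfl : V = ⊤ := le_antisymm le_top fun x _ => hV trivial
    refine ⟨s, ?_⟩
    rw [extRes, supportedMap_refl, Ext.mk₀_id_comp,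
      Ext.comp_assoc _ _ _ (zero_add m) (add_zero m) (by omega)] at hs
    have h1 := congrArg (fun q => (Ext.mk₀ e.inv).comp q (zero_add m)) hs
    simp only [Ext.mk₀_comp_mk₀_assoc, e.inv_hom_id, Ext.mk₀_id_comp] at h1
    have h2 := congrArg Ext.hom h1
    rw [Ext.comp_hom, Ext.mk₀_hom] at h2
    have h3 : c.hom = α := Ext.homAddEquiv.apply_symm_apply α
    rw [h3] at h2
    refine Eq.trans ?_ h2
    rw [ShiftedHom.comp_mk₀]
    rfl
  -- There are no morphisms of negative degree between objects concentrated in degree zero.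
  · have h : ∀ β : ShiftedHom ((singleFunctor _ 0).obj (constSheaf ℤ X))
        ((singleFunctor _ 0).obj (locallyConstantSheaf K X)) i, β = 0 := by
      intro β
      have := TStructure.t.isGE_shift
        ((singleFunctor (TopCat.Sheaf (ModuleCat.{0} ℤ) X) 0).obj (locallyConstantSheaf K X)) 0 i (-i)
      exact TStructure.t.zero β 0 (-i) (by omega)
    exact ⟨∅, (h _).trans (h _).symm⟩

section
variable (D : CartierDivisor X)

/-- A choice of comparison between the cohomology with coefficients in a field and the cohomology of
the sheaf of abelian groups of locally constant functions. -/
def locallyConstantCupEquiv (k : Type) [Field k] [CharZero k] (D : CartierDivisor X) :=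
  Classical.choice (nonempty_cupEquiv_locallyConstant k D)

variable {k k' k'' : Type} [Field k] [Field k'] [Field k''] [CharZero k] [CharZero k'] [CharZero k'']

/-- The action of a homomorphism of coefficient fields on cohomology. -/
def fieldMap (φ : k →+ k') (i : ℤ) :
    Hypercohomology k (constComplex k X) i →+ Hypercohomology k' (constComplex k' X) i :=
  ((locallyConstantCupEquiv k' D).e i).toAddMonoidHom.comp
    ((coefficientMap (constSheaf ℤ X) i φ).comp ((locallyConstantCupEquiv k D).symm.e i).toAddMonoidHom)

theorem fieldMap_apply (φ : k →+ k') (i : ℤ) (α : Hypercohomology k (constComplex k X) i) :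
    fieldMap D φ i α = (locallyConstantCupEquiv k' D).e i (coefficientMap (constSheaf ℤ X) i φ
      ((locallyConstantCupEquiv k D).symm.e i α)) := rfl

theorem fieldMap_fieldMap (φ : k →+ k') (ψ : k' →+ k'') (i : ℤ)
    (α : Hypercohomology k (constComplex k X) i) :
    fieldMap D ψ i (fieldMap D φ i α) = fieldMap D (ψ.comp φ) i α := by
  change (locallyConstantCupEquiv k'' D).e i (coefficientMap (constSheaf ℤ X) i ψ
      (((locallyConstantCupEquiv k' D).e i).symm ((locallyConstantCupEquiv k' D).e i
        (coefficientMap (constSheaf ℤ X) i φ ((locallyConstantCupEquiv k D).symm.e i α))))) = _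
  rw [AddEquiv.symm_apply_apply, coefficientMap_coefficientMap φ ψ]
  rfl

/-- Scalar multiplication is thus one of the coefficient actions. Semilinearity and coordinates are
then identities between additive maps of fields, checked on elements. -/
theorem fieldMap_mulLeft (z : k) (i : ℤ) (α : Hypercohomology k (constComplex k X) i) :
    fieldMap D (AddMonoidHom.mulLeft z) i α = z • α := by
  rw [fieldMap_apply]
  refine ((locallyConstantCupEquiv k D).smul i z _).trans ?_
  refine (congrArg (fun q => q ≫ _)
    (((locallyConstantCupEquiv k D).e i).apply_symm_apply α)).trans ?_
  rw [Functor.map_smul, CategoryTheory.Functor.map_id, Linear.comp_smul]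
  exact congrArg (z • ·) (Category.comp_id α)

theorem fieldMap_add (φ ψ : k →+ k') (i : ℤ) (α : Hypercohomology k (constComplex k X) i) :
    fieldMap D (φ + ψ) i α = fieldMap D φ i α + fieldMap D ψ i α := by
  refine (congrArg (fun q : _ →+ _ => (locallyConstantCupEquiv k' D).e i
    (q ((locallyConstantCupEquiv k D).symm.e i α))) (coefficientMap_add φ ψ)).trans ?_
  exact map_add ((locallyConstantCupEquiv k' D).e i) _ _

theorem fieldMap_cup (φ : k →+ k') (i : ℤ) (α : Hypercohomology k (constComplex k X) i) :
    fieldMap D φ (i + 2) (cup k (divisorClass k D) (constComplex k X) i α) =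
      cup k' (divisorClass k' D) (constComplex k' X) i (fieldMap D φ i α) := by
  rw [fieldMap_apply]
  refine (congrArg _ (congrArg _ ((locallyConstantCupEquiv k D).symm.cup i α))).trans ?_
  rw [coefficientMap_cup]
  exact (locallyConstantCupEquiv k' D).cup i _

/-- The action of a homomorphism of coefficient fields on the total cohomology. -/
def totalFieldMap : (k →+ k') →+ (TotalHypercohomology k (constComplex k X) →+
    TotalHypercohomology k' (constComplex k' X)) :=
  AddMonoidHom.mk' (fun φ => DirectSum.map (fieldMap D φ)) (fun φ ψ => by
    apply DirectSum.addHom_ext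
    intro i α
    rw [AddMonoidHom.add_apply, DirectSum.map_of, DirectSum.map_of, DirectSum.map_of, fieldMap_add,
      map_add])

theorem totalFieldMap_of (φ : k →+ k') (i : ℤ) (α : Hypercohomology k (constComplex k X) i) :
    totalFieldMap D φ (DirectSum.of _ i α) = DirectSum.of _ i (fieldMap D φ i α) :=
  DirectSum.map_of _ _ _

theorem totalFieldMap_totalFieldMap (φ : k →+ k') (ψ : k' →+ k'')
    (v : TotalHypercohomology k (constComplex k X)) :
    totalFieldMap D ψ (totalFieldMap D φ v) = totalFieldMap D (ψ.comp φ) v := by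
  induction v using DirectSum.induction_on with
  | zero => simp
  | of i α => rw [totalFieldMap_of, totalFieldMap_of, totalFieldMap_of, fieldMap_fieldMap]
  | add x y hx hy => rw [map_add, map_add, map_add, hx, hy]

theorem totalFieldMap_mulLeft (z : k) (v : TotalHypercohomology k (constComplex k X)) :
    totalFieldMap D (AddMonoidHom.mulLeft z) v = z • v := by
  induction v using DirectSum.induction_on with
  | zero => simp
  | of i α => rw [totalFieldMap_of, fieldMap_mulLeft, DirectSum.of_smul]
  | add x y hx hy => rw [map_add, hx, hy, smul_add]

theorem totalFieldMap_cup (φ : k →+ k') (v : TotalHypercohomology k (constComplex k X)) :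
    totalCup k' (divisorClass k' D) (constComplex k' X) (totalFieldMap D φ v) =
      totalFieldMap D φ (totalCup k (divisorClass k D) (constComplex k X) v) := by
  induction v using DirectSum.induction_on with
  | zero => simp
  | of i α =>
    rw [totalFieldMap_of, totalCup_of, totalCup_of, totalFieldMap_of, fieldMap_cup]
  | add x y hx hy => simp only [map_add, hx, hy]

theorem exists_totalFieldMap_basisProjection {k K B : Type} [Field k] [Field K] [CharZero K]
    [Algebra k K] (b : Module.Basis B k K) [T2Space X] [CompactSpace X]
    (i : ℤ) (α : Hypercohomology K (constComplex K X) i) : ∃ s : Finset B,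
      totalFieldMap D (basisProjection b s) (DirectSum.of _ i α) = DirectSum.of _ i α := by
  obtain ⟨s, hs⟩ := exists_coefficientMap_basisProjection b i
    ((locallyConstantCupEquiv K D).symm.e i α)
  refine ⟨s, ?_⟩
  rw [totalFieldMap_of, fieldMap_apply, hs]
  exact congrArg _ (((locallyConstantCupEquiv K D).e i).apply_symm_apply α)

/-- The rank of the cup product with a divisor class does not change under extension of the field
of coefficients. -/
theorem rank_totalCup_divisorClass_eq (k K : Type) [Field k] [Field K] [CharZero k] [CharZero K]
    [Algebra k K] [T2Space X] [CompactSpace X] :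
    (totalCup K (divisorClass K D) (constComplex K X)).rank =
      (totalCup k (divisorClass k D) (constComplex k X)).rank := by
  let b := Module.Basis.ofVectorSpace k K
  let a : k →+ K := (algebraMap k K : k →+* K).toAddMonoidHom
  -- The descent data are the maps induced by the inclusion `k → K` and by the coordinates `K → k`;
  -- no isomorphism with a tensor product is needed.
  refine rank_eq_of_descends b (totalFieldMap D a) (fun q v => ?_)
    (fun i => totalFieldMap D (coordinateHom b i)) (fun i c v => ?_) ?_ _ _
    (fun v => totalFieldMap_cup D a v)
  · rw [← totalFieldMap_mulLeft D, totalFieldMap_totalFieldMap, ← totalFieldMap_mulLeft D,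
      totalFieldMap_totalFieldMap]
    congr 2
    ext x
    exact map_mul (algebraMap k K) q x
  · rw [← totalFieldMap_mulLeft D, totalFieldMap_totalFieldMap, totalFieldMap_totalFieldMap,
      ← totalFieldMap_mulLeft D]
    congr 2
    ext x
    change b.repr (c * algebraMap k K x) i = b.repr c i * x
    rw [mul_comm, ← Algebra.smul_def, map_smul, Finsupp.smul_apply, smul_eq_mul, mul_comm]
  · rw [eq_top_iff]
    rintro v -
    induction v using DirectSum.induction_on with
    | zero => exact zero_mem _
    | of i α =>
      obtain ⟨s, hs⟩ := exists_totalFieldMap_basisProjection D b i α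
      -- A class fixed by a basis projection is a finite sum of terms `b j` times the image of its
      -- `j`-th coordinate, hence lies in the span of the classes coming from `k`.
      rw [← hs, basisProjection, map_sum, AddMonoidHom.finsetSum_apply]
      refine sum_mem fun j _ => ?_
      rw [← totalFieldMap_totalFieldMap, totalFieldMap_mulLeft, ← totalFieldMap_totalFieldMap]
      exact Submodule.smul_mem _ _ (Submodule.subset_span ⟨_, rfl⟩)
    | add x y hx hy => exact add_mem hx hy

end
end FieldExtension

/-! ### Crepancy of the resolution -/

section ToricFrames
variable {n : ℕ} {P : Set (Fin n → ℝ)} {K : Geometry.SimplicialComplex ℝ (Fin n → ℝ)}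
open AffineChart

/-- The integral pairing of a lattice point with a lattice vector given by real coordinates. -/
def latticeDot (v : Fin n → ℝ) : (Fin n → ℤ) →+ ℤ :=
  AddMonoidHom.mk' (fun m => m ⬝ᵥ fun i => ⌊v i⌋) fun _ _ => add_dotProduct _ _ _

/-- The floors are exact at lattice vectors. This turns real pairings into integers, where strict
inequalities gain a full unit. -/
theorem latticeDot_cast {v : Fin n → ℝ} (hv : v ∈ Set.range (toReal (n := n))) (m : Fin n → ℤ) :
    (latticeDot v m : ℝ) = toReal m ⬝ᵥ v := by
  obtain ⟨l, rfl⟩ := hv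
  simp [latticeDot, dotProduct, toReal]

namespace IsRegularProjectiveTriangulation

theorem mem_closure (hK : IsRegularProjectiveTriangulation P K) (t : K.facets) {v : Fin n → ℝ}
    (hv : v ∈ Set.range (toReal (n := n))) : v ∈ AddSubgroup.closure (t.1 : Set (Fin n → ℝ)) := by
  rw [← SetLike.mem_coe, hK.unimodular t.1 t.2]
  exact hv

/-- A lattice point of the dual is determined by its values at the vertices of a maximal simplex. -/
theorem eq_of_dot_eq (hK : IsRegularProjectiveTriangulation P K) (t : K.facets) {m m' : Fin n → ℤ}
    (h : ∀ v ∈ t.1, v ≠ 0 → toReal m ⬝ᵥ v = toReal m' ⬝ᵥ v) : m = m' := by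
  have h1 : ∀ v ∈ AddSubgroup.closure (t.1 : Set (Fin n → ℝ)), toReal m ⬝ᵥ v = toReal m' ⬝ᵥ v := by
    intro v hv
    induction hv using AddSubgroup.closure_induction with
    | mem x hx =>
      by_cases hx0 : x = 0
      · simp [hx0]
      · exact h x hx hx0
    | zero => simp
    | add x y _ _ hx hy => rw [dotProduct_add, dotProduct_add, hx, hy]
    | neg x _ hx => rw [dotProduct_neg, dotProduct_neg, hx]
  ext i
  have h2 := h1 _ (hK.mem_closure t ⟨Pi.single i 1, rfl⟩)
  have h3 : toReal (Pi.single i 1) = (Pi.single i 1 : Fin n → ℝ) := by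
    ext j
    by_cases hij : j = i
    · subst hij; simp [toReal]
    · simp [toReal, hij]
  rw [h3, dotProduct_single_one, dotProduct_single_one] at h2
  simp only [toReal] at h2
  exact_mod_cast h2

theorem mem_of_mem_face (hK : IsRegularProjectiveTriangulation P K) {t : Finset (Fin n → ℝ)}
    (ht : t ∈ K.faces) {v : Fin n → ℝ} (hv : v ∈ t) : v ∈ P := by
  rw [← hK.space_eq]
  exact K.subset_space ht hv

/-- The anticanonical frame of a maximal simplex is a lattice point of the polar dual. -/
theorem neg_exponent_one_mem (hK : IsRegularProjectiveTriangulation P K) (hP : IsReflexive P)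
    (t : K.facets) : toReal (-hK.exponent (fun _ => ((1 : ℕ) : ℤ)) t) ∈ polarDual P := by
  -- The cone of `t` lies in the cone of a proper face `F`, and reflexivity gives a lattice point
  -- `m` of the polar dual with value `-1` on `F`.
  obtain ⟨σ, ⟨F, hF, hne, rfl⟩, hσ⟩ := hK.refines hP _ ⟨t.1, t.2.1, rfl⟩
  obtain ⟨m, hm, hmF⟩ := hP.exists_lattice_face hF hne
  have h1 : ∀ v ∈ PointedCone.hull ℝ F, 0 ≤ toReal (-m) ⬝ᵥ v := fun v hv =>
    hull_nonneg (fun w hw => by rw [toReal_neg, neg_dotProduct, hmF w hw]; norm_num) hv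
  -- On the cone of `F` the form `-m` vanishes only at the origin, so it is strictly positive at the
  -- nonzero vertices of `t`.
  have h2 : ∀ v ∈ PointedCone.hull ℝ F, toReal (-m) ⬝ᵥ v = 0 → v = 0 := by
    intro v hv
    induction hv using Submodule.span_induction with
    | mem x hx =>
      intro h
      rw [toReal_neg, neg_dotProduct, hmF x hx] at h
      norm_num at h
    | zero => exact fun _ => rfl
    | add x y hx hy ihx ihy =>
      intro h
      rw [dotProduct_add] at h
      have hx0 := h1 x hx
      have hy0 := h1 y hy
      rw [ihx (by linarith), ihy (by linarith), add_zero]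
    | smul a x hx ihx =>
      intro h
      rw [show a • x = (a : ℝ) • x from rfl, dotProduct_smul, smul_eq_mul] at h
      rcases mul_eq_zero.1 h with h | h
      · rw [show a • x = (a : ℝ) • x from rfl, h, zero_smul]
      · rw [ihx h, smul_zero]
  -- At a nonzero vertex `v` the value of `m` is a negative integer, and it is at least `-1` because
  -- `v` lies in the polytope; so it equals `-1`.
  have h3 : m = -hK.exponent (fun _ => ((1 : ℕ) : ℤ)) t := by
    refine hK.eq_of_dot_eq t fun v hv hv0 => ?_
    rw [toReal_neg, neg_dotProduct, hK.exponent_dot _ t v hv hv0]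
    have hvF := hσ (Submodule.subset_span hv)
    have h4 := h1 v hvF
    have h5 : toReal (-m) ⬝ᵥ v ≠ 0 := fun h => hv0 (h2 v hvF h)
    have h6 := hm v (hK.mem_of_mem_face t.2.1 hv)
    rw [toReal_neg, neg_dotProduct, ← latticeDot_cast (hK.lattice _ t.2.1 v hv)] at h4 h5
    rw [← latticeDot_cast (hK.lattice _ t.2.1 v hv)] at h6 ⊢
    norm_cast at h4 h5 h6 ⊢
    omega
  rw [← h3]
  exact hm

end IsRegularProjectiveTriangulation

/-- The cone of the second fan that is chosen for a cone of the first fan. -/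
def Refines.cone {S S' : Set (PointedCone ℝ (Fin n → ℝ))} (h : Refines S S') (σ : S) : S' :=
  ⟨(h σ.1 σ.2).choose, (h σ.1 σ.2).choose_spec.1⟩

theorem Refines.le_cone {S S' : Set (PointedCone ℝ (Fin n → ℝ))} (h : Refines S S') (σ : S) :
    σ.1 ≤ (h.cone σ).1 := (h σ.1 σ.2).choose_spec.2

/-- The toric morphism of a refinement of fans pulls back frames of toric line bundles. -/
def ToricData.frameMap {S S' : Set (PointedCone ℝ (Fin n → ℝ))} (A : ToricData S)
    (B : ToricData S') (h : Refines S S') (index : A.ι → B.ι)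
    (hframe : ∀ i, B.frame (index i) = A.frame i)
    (hloc : ∀ i σ, ∃ N : ℕ, N • A.loc i σ - B.loc (index i) (h.cone σ) ∈ dualMonoid σ.1) :
    FrameMap (TopCat.ofHom ⟨ToricVariety.map h, ToricVariety.continuous_map h⟩ :
      TopCat.of (ToricVariety S) ⟶ TopCat.of (ToricVariety S')) A.divisor B.divisor :=
  have hmem : ∀ i (σ : S) (x : AffineChart σ.1), char (A.loc i σ) x ≠ 0 →
      char (B.loc (index i) (h.cone σ)) (x.restrict (h.le_cone σ)) ≠ 0 := by
    intro i σ x hx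
    obtain ⟨N, hN⟩ := hloc i σ
    have hB := B.loc_mem (index i) (h.cone σ)
    rw [char_restrict _ hB]
    -- `hloc` makes a power of the character `A.loc` divisible by the pulled back character `B.loc`,
    -- so the latter cannot vanish where the former does not.
    have h1 := char_add (dualMonoid_anti (h.le_cone σ) hB) hN x
    rw [add_sub_cancel, char_nsmul (A.loc_mem i σ)] at h1
    exact left_ne_zero_of_mul (h1 ▸ pow_ne_zero N hx)
  have htrans : ∀ (i j : A.ι) (σ : S) (x : AffineChart σ.1), char (A.loc i σ) x ≠ 0 →
      char (A.loc j σ) x ≠ 0 →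
      (B.transition (index i) (index j)
        (ToricVariety.mk ⟨h.cone σ, x.restrict (h.le_cone σ)⟩) : ℂ) =
        A.transition i j (ToricVariety.mk ⟨σ, x⟩) := by
    intro i j σ x hi hj
    rw [B.transition_mk (hmem i σ x hi) (hmem j σ x hj), A.transition_mk hi hj,
      (B.regular_trans (hmem i σ x hi) (hmem j σ x hj)).of_restrict, hframe, hframe]
  { index := index
    mem := by
      rintro i ⟨⟨σ, x⟩⟩ hx
      exact hmem i σ x hx
    transition := by
      rintro i j ⟨⟨σ, x⟩⟩ hi hj
      exact Units.ext (htrans i j σ x hi hj) }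

/-- The anticanonical frames of the resolution come from those of the toric variety of the face
fan. -/
theorem exists_resolutionFrameMap (hP : IsReflexive P) (hK : IsRegularProjectiveTriangulation P K)
    (f : (Fin n → ℤ) →₀ ℂ) (hf : ∀ m ∈ f.support, toReal m ∈ polarDual P) :
    Nonempty (FrameMap (resolution hP hK) (anticanonical hK) (hypersurface hP f hf)) := by
  refine ⟨ToricData.frameMap _ _ (hK.refines hP)
    (fun t => ⟨-hK.exponent (fun _ => ((1 : ℕ) : ℤ)) t, hK.neg_exponent_one_mem hP t⟩)
    (fun _ => rfl) ?_⟩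
  intro t σ
  set τ := (hK.refines hP).cone σ
  obtain ⟨σ, s, hs, rfl⟩ := σ
  dsimp only
  set e := hK.exponent (outside t) (facetOf hK ⟨_, s, hs, rfl⟩) with he
  set m := -hK.exponent (fun _ => ((1 : ℕ) : ℤ)) t with hm
  -- `facetOf` is an arbitrary choice of a maximal simplex around the cone; by `exponent_compat` the
  -- values at the vertices of `s` do not depend on it.
  have he : ∀ v ∈ s, v ≠ 0 → toReal e ⬝ᵥ v = outside t v := by
    intro v hv hv0
    obtain ⟨s', hs', hss'⟩ := hK.exists_facet hs
    have hvs : v ∈ PointedCone.hull ℝ (s : Set (Fin n → ℝ)) := Submodule.subset_span hv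
    rw [he, hK.exponent_compat (outside t) _ ⟨s', hs'⟩ (le_facetOf hK ⟨_, s, hs, rfl⟩ hvs)
      (Submodule.subset_span (hss' hv)), hK.exponent_dot _ _ v (hss' hv) hv0]
  -- At the vertices of `s` outside `t`, the multiple `N • e` has value `N`, which only has to
  -- exceed finitely many numbers. At those in `t` it is zero, but there `m` has the least value
  -- `-1` allowed in the polar dual, so subtracting `m - localGenerator` does no harm.
  obtain ⟨M, hM⟩ := (s.image fun v => toReal (m - localGenerator hP τ) ⬝ᵥ v).exists_le
  obtain ⟨N, hN⟩ := exists_nat_ge M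
  refine ⟨N, fun v hv => hull_nonneg (fun w hw => ?_) hv⟩
  by_cases hw0 : w = 0
  · simp [hw0]
  rw [toReal_sub, sub_dotProduct, toReal_nsmul, smul_dotProduct, he w hw hw0, smul_eq_mul, outside]
  split_ifs with hwt
  · have h1 := localGenerator_mem hP τ w (hK.mem_of_mem_face hs hw)
    have h2 : toReal m ⬝ᵥ w = -1 := by
      rw [hm, toReal_neg, neg_dotProduct, hK.exponent_dot _ t w hwt hw0]
      simp
    rw [toReal_sub, sub_dotProduct, h2]
    push_cast
    linarith
  · have h1 := hM _ (Finset.mem_image_of_mem _ hw)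
    push_cast
    linarith

end ToricFrames

/-! ### Gluing of affine toric charts along separating characters -/

section Gluing
variable {n : ℕ} {σ τ ρ : PointedCone ℝ (Fin n → ℝ)}

namespace AffineChart

@[ext]
theorem ext {x y : AffineChart σ} (h : ∀ m ∈ dualMonoid σ, char m x = char m y) : x = y := by
  refine MonoidHom.ext fun m => ?_
  have h1 := h m.toAdd.1 m.toAdd.2
  rw [char, char, dif_pos m.toAdd.2, dif_pos m.toAdd.2] at h1
  exact h1

/-- The point of an affine chart with given values of the characters. -/
def ofChar (g : (Fin n → ℤ) → ℂ) (h0 : g 0 = 1)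
    (hadd : ∀ m ∈ dualMonoid σ, ∀ m' ∈ dualMonoid σ, g (m + m') = g m * g m') : AffineChart σ :=
  ({ toFun := fun m => g m.toAdd.1
     map_one' := h0
     map_mul' := fun a b => hadd _ a.toAdd.2 _ b.toAdd.2 } : Multiplicative (dualMonoid σ) →* ℂ)

theorem char_ofChar {g : (Fin n → ℤ) → ℂ} {h0 : g 0 = 1}
    {hadd : ∀ m ∈ dualMonoid σ, ∀ m' ∈ dualMonoid σ, g (m + m') = g m * g m'} {m : Fin n → ℤ}
    (hm : m ∈ dualMonoid σ) : char m (ofChar g h0 hadd) = g m := by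
  rw [char, dif_pos hm]
  rfl

theorem laurent_of_mem {m : Fin n → ℤ} (hm : m ∈ dualMonoid σ) (x : AffineChart σ) :
    laurent m x = char m x := by
  rw [laurent_eq (zero_mem _) (by rwa [add_zero]) (by rw [char_zero]; exact one_ne_zero), char_zero,
    div_one, add_zero]

end AffineChart

/-- Two points of affine charts that are identified in a toric variety. -/
def Glued (x : AffineChart σ) (y : AffineChart τ) : Prop :=
  ∃ z : AffineChart (σ ⊓ τ), z.restrict inf_le_left = x ∧ z.restrict inf_le_right = y

theorem Glued.symm {x : AffineChart σ} {y : AffineChart τ} (h : Glued x y) : Glued y x := by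
  obtain ⟨z, rfl, rfl⟩ := h
  exact ⟨z.restrict (le_of_eq (inf_comm _ _)), rfl, rfl⟩

theorem Glued.restrict {σ' τ' : PointedCone ℝ (Fin n → ℝ)} {x : AffineChart σ} {y : AffineChart τ}
    (h : Glued x y) (hσ : σ ≤ σ') (hτ : τ ≤ τ') : Glued (x.restrict hσ) (y.restrict hτ) := by
  obtain ⟨z, rfl, rfl⟩ := h
  exact ⟨z.restrict (inf_le_inf hσ hτ), rfl, rfl⟩

theorem glued_restrict {x : AffineChart ρ} (hσ : ρ ≤ σ) (hτ : ρ ≤ τ) :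
    Glued (x.restrict hσ) (x.restrict hτ) := ⟨x.restrict (le_inf hσ hτ), rfl, rfl⟩

/-- The lattice point `u` cuts out the intersection of the cones `σ` and `τ` and separates them. -/
structure Separates (u : Fin n → ℤ) (σ τ : PointedCone ℝ (Fin n → ℝ)) : Prop where
  left : u ∈ dualMonoid σ
  right : -u ∈ dualMonoid τ
  exists_left : ∀ m ∈ dualMonoid (σ ⊓ τ), ∃ N : ℕ, m + N • u ∈ dualMonoid σ
  exists_right : ∀ m ∈ dualMonoid (σ ⊓ τ), ∃ N : ℕ, m + N • (-u) ∈ dualMonoid τ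

open AffineChart

namespace Separates
variable {u : Fin n → ℤ}

theorem symm (h : Separates u σ τ) : Separates (-u) τ σ where
  left := h.right
  right := by rw [neg_neg]; exact h.left
  exists_left m hm := h.exists_right m (by rwa [inf_comm])
  exists_right m hm := by
    rw [neg_neg]
    exact h.exists_left m (by rwa [inf_comm])

theorem regular (h : Separates u σ τ) {x : AffineChart σ} (hx : char u x ≠ 0) {m : Fin n → ℤ}
    (hm : m ∈ dualMonoid (σ ⊓ τ)) : Regular m x := by
  obtain ⟨N, hN⟩ := h.exists_left m hm
  refine ⟨N • u, nsmul_mem h.left N, hN, ?_⟩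
  rw [char_nsmul h.left]
  exact pow_ne_zero _ hx

/-- The extension of a point to the characters that are regular on the intersection. -/
def extend (h : Separates u σ τ) (x : AffineChart σ) (hx : char u x ≠ 0) : AffineChart (σ ⊓ τ) :=
  ofChar (fun m => laurent m x) (laurent_zero x)
    fun _ hm _ hm' => laurent_add (h.regular hx hm) (h.regular hx hm')

theorem char_extend (h : Separates u σ τ) {x : AffineChart σ} (hx : char u x ≠ 0) {m : Fin n → ℤ}
    (hm : m ∈ dualMonoid (σ ⊓ τ)) : char m (h.extend x hx) = laurent m x :=
  char_ofChar hm

/-- On the chart of the intersection both `u` and `-u` are regular, so `χ^u` is invertible there. -/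
theorem char_ne_zero (h : Separates u σ τ) {x : AffineChart σ} {y : AffineChart τ}
    (hxy : Glued x y) : char u x ≠ 0 := by
  obtain ⟨z, rfl, rfl⟩ := hxy
  rw [char_restrict _ h.left]
  have h1 := char_add (dualMonoid_anti inf_le_left h.left) (dualMonoid_anti inf_le_right h.right) z
  rw [add_neg_cancel, char_zero] at h1
  exact left_ne_zero_of_mul (h1 ▸ one_ne_zero)

theorem laurent_glued (h : Separates u σ τ) {x : AffineChart σ} {y : AffineChart τ}
    (hxy : Glued x y) {m : Fin n → ℤ} (hm : m ∈ dualMonoid τ) : laurent m x = char m y := by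
  have hx := h.char_ne_zero hxy
  obtain ⟨z, rfl, rfl⟩ := hxy
  have hm' := dualMonoid_anti (inf_le_right (a := σ)) hm
  rw [(h.regular hx hm').of_restrict, laurent_of_mem hm', char_restrict _ hm]

theorem glued_of_laurent (h : Separates u σ τ) {x : AffineChart σ} {y : AffineChart τ}
    (hx : char u x ≠ 0) (hxy : ∀ m ∈ dualMonoid τ, laurent m x = char m y) : Glued x y := by
  refine ⟨h.extend x hx, AffineChart.ext fun m hm => ?_, AffineChart.ext fun m hm => ?_⟩
  · rw [char_restrict _ hm, h.char_extend hx (dualMonoid_anti inf_le_left hm), laurent_of_mem hm]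
  · rw [char_restrict _ hm, h.char_extend hx (dualMonoid_anti inf_le_right hm), hxy m hm]

/-- The equations say that `x` and `y` induce a single multiplicative function on the sum of the two
monoids. The relation `u + (-u) = 0 + 0` forces `χ^u(x) ≠ 0`, and the others then determine the
characters of `τ` as quotients at `x`. Gluing is thereby expressed by equations alone, without an
open condition. -/
theorem glued_iff (h : Separates u σ τ) {x : AffineChart σ} {y : AffineChart τ} :
    Glued x y ↔ ∀ a ∈ dualMonoid σ, ∀ c ∈ dualMonoid σ, ∀ b ∈ dualMonoid τ, ∀ d ∈ dualMonoid τ,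
      a + b = c + d → char a x * char b y = char c x * char d y := by
  constructor
  · rintro ⟨z, rfl, rfl⟩ a ha c hc b hb d hd hab
    rw [char_restrict _ ha, char_restrict _ hc, char_restrict _ hb, char_restrict _ hd,
      ← char_add (dualMonoid_anti inf_le_left ha) (dualMonoid_anti inf_le_right hb),
      ← char_add (dualMonoid_anti inf_le_left hc) (dualMonoid_anti inf_le_right hd), hab]
  · intro H
    have h1 := H u h.left 0 (zero_mem _) (-u) h.right 0 (zero_mem _) (by abel)
    rw [char_zero, char_zero, one_mul] at h1
    have hx : char u x ≠ 0 := left_ne_zero_of_mul (h1 ▸ one_ne_zero)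
    refine h.glued_of_laurent hx fun m hm => ?_
    obtain ⟨N, hN⟩ := h.exists_left m (dualMonoid_anti inf_le_right hm)
    have hNu := nsmul_mem h.left N
    have hx' : char (N • u) x ≠ 0 := by
      rw [char_nsmul h.left]
      exact pow_ne_zero _ hx
    rw [laurent_eq hNu hN hx', div_eq_iff hx']
    have h2 := H _ hN _ hNu 0 (zero_mem _) m hm (by abel)
    rw [char_zero, mul_one] at h2
    rw [h2, mul_comm]

theorem isClosed_glued (h : Separates u σ τ) :
    IsClosed {p : AffineChart σ × AffineChart τ | Glued p.1 p.2} := by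
  simp only [h.glued_iff, Set.ofPred_forall]
  refine isClosed_iInter fun a => isClosed_iInter fun _ => isClosed_iInter fun c =>
    isClosed_iInter fun _ => isClosed_iInter fun b => isClosed_iInter fun _ => isClosed_iInter fun d =>
    isClosed_iInter fun _ => isClosed_iInter fun _ => ?_
  exact isClosed_eq (((continuous_char a).comp continuous_fst).mul
    ((continuous_char b).comp continuous_snd)) (((continuous_char c).comp continuous_fst).mul
    ((continuous_char d).comp continuous_snd))

/-- Points of the `τ` chart that are glued to something form the open set `χ^(-u) ≠ 0`. There the
partner in the `σ` chart is given by a continuous map `g`, whose characters are quotients of regular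
ones, and the set is the preimage of `W` under `g`. -/
theorem isOpen_glued (h : Separates u σ τ) {W : Set (AffineChart σ)} (hW : IsOpen W) :
    IsOpen {y : AffineChart τ | ∃ x ∈ W, Glued x y} := by
  let V : Set (AffineChart τ) := {y | char (-u) y ≠ 0}
  have hV : IsOpen V := isOpen_ne.preimage (continuous_char (-u))
  let g : V → AffineChart σ := fun y => (h.symm.extend y.1 y.2).restrict inf_le_right
  have hg : ∀ (m : Fin n → ℤ), m ∈ dualMonoid σ → ∀ y : V, char m (g y) = laurent m y.1 := by
    intro m hm y
    rw [char_restrict _ hm, h.symm.char_extend y.2 (dualMonoid_anti inf_le_right hm)]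
  have hgc : Continuous g := by
    refine continuous_induced_rng.2 (continuous_pi fun m => ?_)
    by_cases hm : m ∈ dualMonoid σ
    · obtain ⟨N, hN⟩ := h.symm.exists_left m (dualMonoid_anti inf_le_right hm)
      have hd := nsmul_mem h.right N
      have hd0 : ∀ y : V, char (N • -u) y.1 ≠ 0 := fun y => by
        rw [char_nsmul h.right]
        exact pow_ne_zero _ y.2
      refine Continuous.congr (f := fun y : V => char (m + N • -u) y.1 / char (N • -u) y.1)
        (((continuous_char _).comp continuous_subtype_val).div
          ((continuous_char _).comp continuous_subtype_val) hd0) fun y => ?_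
      exact ((hg m hm y).trans (laurent_eq hd hN (hd0 y))).symm
    · exact continuous_const.congr fun y => (dif_neg hm).symm
  have key : {y : AffineChart τ | ∃ x ∈ W, Glued x y} = Subtype.val '' (g ⁻¹' W) := by
    ext y
    constructor
    · rintro ⟨x, hx, hxy⟩
      have hy := h.symm.char_ne_zero hxy.symm
      refine ⟨⟨y, hy⟩, ?_, rfl⟩
      have : g ⟨y, hy⟩ = x := AffineChart.ext fun m hm =>
        (hg m hm ⟨y, hy⟩).trans (h.symm.laurent_glued hxy.symm hm)
      rwa [Set.mem_preimage, this]
    · rintro ⟨y, hy, rfl⟩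
      refine ⟨g y, hy, Glued.symm (h.symm.glued_of_laurent y.2 fun m hm => (hg m hm y).symm)⟩
  rw [key]
  exact hV.isOpenMap_subtype_val _ (hgc.isOpen_preimage _ hW)

end Separates

/-- Characters regular on `σ` or on `ρ` are all regular Laurent monomials at the middle point `y`,
so the equations of `glued_iff` can be verified at `y`. -/
theorem Glued.trans {u u' u'' : Fin n → ℤ} (h : Separates u σ τ) (h' : Separates u' τ ρ)
    (h'' : Separates u'' σ ρ) {x : AffineChart σ} {y : AffineChart τ} {w : AffineChart ρ}
    (hxy : Glued x y) (hyw : Glued y w) : Glued x w := by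
  have hl : ∀ a ∈ dualMonoid σ, Regular a y ∧ laurent a y = char a x := fun a ha =>
    ⟨h.symm.regular (h.symm.char_ne_zero hxy.symm) (dualMonoid_anti inf_le_right ha),
      h.symm.laurent_glued hxy.symm ha⟩
  have hr : ∀ b ∈ dualMonoid ρ, Regular b y ∧ laurent b y = char b w := fun b hb =>
    ⟨h'.regular (h'.char_ne_zero hyw) (dualMonoid_anti inf_le_right hb),
      h'.laurent_glued hyw hb⟩
  rw [h''.glued_iff]
  intro a ha c hc b hb d hd hab
  rw [← (hl a ha).2, ← (hl c hc).2, ← (hr b hb).2, ← (hr d hd).2,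
    ← laurent_add (hl a ha).1 (hr b hb).1, ← laurent_add (hl c hc).1 (hr d hd).1, hab]

end Gluing

/-! ### The resolution is Hausdorff -/

section Separation
variable {n : ℕ} {P : Set (Fin n → ℝ)} {K : Geometry.SimplicialComplex ℝ (Fin n → ℝ)}
open AffineChart

namespace IsRegularProjectiveTriangulation

/-- The multiples of a linear form are approximated by lattice points up to a bounded error. -/
theorem exists_rounding_bound (hK : IsRegularProjectiveTriangulation P K) (t : K.facets)
    (w : (Fin n → ℝ) →ₗ[ℝ] ℝ) {v : Fin n → ℝ} (hv : v ∈ Set.range (toReal (n := n))) :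
    ∃ C : ℝ, ∀ N : ℕ, |toReal (hK.exponent (fun v => ⌈N * w v⌉) t) ⬝ᵥ v - N * w v| ≤ C := by
  -- By unimodularity the vertices of `t` generate the lattice. At a vertex the rounding error is at
  -- most one, and the errors add up along sums and negatives.
  have h := hK.mem_closure t hv
  clear hv
  induction h using AddSubgroup.closure_induction with
  | mem x hx =>
    refine ⟨1, fun N => ?_⟩
    by_cases hx0 : x = 0
    · simp [hx0]
    · rw [hK.exponent_dot _ t x hx hx0, abs_le]
      constructor
      · linarith [Int.le_ceil (N * w x)]
      · linarith [Int.ceil_lt_add_one (N * w x)]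
  | zero => exact ⟨0, fun N => by simp⟩
  | add x y _ _ hx hy =>
    obtain ⟨C, hC⟩ := hx
    obtain ⟨C', hC'⟩ := hy
    refine ⟨C + C', fun N => ?_⟩
    refine le_trans (le_of_eq ?_) ((abs_add_le _ _).trans (add_le_add (hC N) (hC' N)))
    rw [dotProduct_add, map_add]
    congr 1
    ring
  | neg x _ hx =>
    obtain ⟨C, hC⟩ := hx
    refine ⟨C, fun N => ?_⟩
    rw [dotProduct_neg, map_neg, mul_neg, ← neg_sub', abs_neg]
    exact hC N

/-- The form is the difference of the affine pieces of the strictly convex function on `t` and `t'`.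
Both pieces agree with it at the common vertex `0`, so the difference is linear; its signs are the
strict inequalities off each simplex. -/
theorem exists_linear_separating (hK : IsRegularProjectiveTriangulation P K) (t t' : K.facets) :
    ∃ w : (Fin n → ℝ) →ₗ[ℝ] ℝ, (∀ v ∈ t.1, v ∈ t'.1 → w v = 0) ∧
      (∀ v ∈ t.1, v ∉ t'.1 → 0 < w v) ∧ ∀ v ∈ t'.1, v ∉ t.1 → w v < 0 := by
  obtain ⟨ψ, hψ⟩ := hK.projective
  obtain ⟨a, ha⟩ := hψ t.1 t.2
  obtain ⟨a', ha'⟩ := hψ t'.1 t'.2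
  have hvert : ∀ s : K.facets, ∀ v ∈ s.1, v ∈ K.vertices := fun s v hv =>
    K.down_closed s.2.1 (Finset.singleton_subset_iff.2 hv) (Finset.singleton_nonempty v)
  have h0 := hK.zero_mem t.1 t.2
  have h0' := hK.zero_mem t'.1 t'.2
  have hw : ∀ v, (a - a').linear v = a v - a' v := by
    intro v
    have h1 := (a - a').linearMap_vsub v 0
    have h2 := (ha 0 (hvert t 0 h0)).1 h0
    have h3 := (ha' 0 (hvert t 0 h0)).1 h0'
    rw [vsub_eq_sub, sub_zero] at h1
    rw [h1]
    simp [h2, h3]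
  refine ⟨(a - a').linear, fun v hv hv' => ?_, fun v hv hv' => ?_, fun v hv' hv => ?_⟩
  · rw [hw, (ha v (hvert t v hv)).1 hv, (ha' v (hvert t v hv)).1 hv', sub_self]
  · rw [hw, (ha v (hvert t v hv)).1 hv]
    linarith [(ha' v (hvert t v hv)).2 hv']
  · rw [hw, (ha' v (hvert t' v hv')).1 hv']
    linarith [(ha v (hvert t' v hv')).2 hv]

/-- A large multiple of the real form is rounded up at the vertices of `t`. There zero stays zero
and positive stays positive; at the other vertices of `t'` the value tends to minus infinity while
the rounding error is bounded. -/
theorem exists_exponent_separating (hK : IsRegularProjectiveTriangulation P K) (t t' : K.facets) :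
    ∃ u : Fin n → ℤ, (∀ v ∈ t.1, v ∈ t'.1 → toReal u ⬝ᵥ v = 0) ∧
      (∀ v ∈ t.1, v ∉ t'.1 → 0 < toReal u ⬝ᵥ v) ∧ ∀ v ∈ t'.1, v ∉ t.1 → toReal u ⬝ᵥ v < 0 := by
  obtain ⟨w, hw0, hw1, hw2⟩ := hK.exists_linear_separating t t'
  have hev : ∀ᶠ N : ℕ in Filter.atTop, ∀ v ∈ t'.1, v ∉ t.1 →
      toReal (hK.exponent (fun v => ⌈N * w v⌉) t) ⬝ᵥ v < 0 := by
    rw [Filter.eventually_all_finset]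
    intro v hv
    by_cases hvt : v ∈ t.1
    · exact Filter.Eventually.of_forall fun N h => absurd hvt h
    obtain ⟨C, hC⟩ := hK.exists_rounding_bound t w (hK.lattice _ t'.2.1 v hv)
    obtain ⟨M, hM⟩ := exists_nat_gt (C / -w v)
    have hwv := hw2 v hv hvt
    filter_upwards [Filter.eventually_ge_atTop M] with N hN _
    have h1 := (abs_le.1 (hC N)).2
    rw [div_lt_iff₀ (by linarith)] at hM
    have h2 : (M : ℝ) ≤ N := by exact_mod_cast hN
    nlinarith
  obtain ⟨N, hN, hN1⟩ := (hev.and (Filter.eventually_ge_atTop 1)).exists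
  have hN1 : (1 : ℝ) ≤ N := by exact_mod_cast hN1
  refine ⟨_, fun v hv hv' => ?_, fun v hv hv' => ?_, hN⟩
  · by_cases hv0 : v = 0
    · simp [hv0]
    · rw [hK.exponent_dot _ t v hv hv0, hw0 v hv hv']
      simp
  · have hv0 : v ≠ 0 := by
      rintro rfl
      exact hv' (hK.zero_mem _ t'.2)
    rw [hK.exponent_dot _ t v hv hv0]
    have := hw1 v hv hv'
    exact_mod_cast Int.ceil_pos.2 (by positivity)

/-- A character regular on the intersection is nonnegative at the common vertices, where `u`
vanishes; at the remaining vertices of `t` it is corrected by a large multiple of `u`, which is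
positive there. The other side is the same with `-u`. -/
theorem exists_separates (hK : IsRegularProjectiveTriangulation P K) (t t' : K.facets) :
    ∃ u, Separates u (PointedCone.hull ℝ (t.1 : Set (Fin n → ℝ)))
      (PointedCone.hull ℝ (t'.1 : Set (Fin n → ℝ))) := by
  have aux : ∀ (t t' : K.facets) (u : Fin n → ℤ), (∀ v ∈ t.1, v ∈ t'.1 → toReal u ⬝ᵥ v = 0) →
      (∀ v ∈ t.1, v ∉ t'.1 → 0 < toReal u ⬝ᵥ v) →
      u ∈ dualMonoid (PointedCone.hull ℝ (t.1 : Set (Fin n → ℝ))) ∧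
      ∀ m ∈ dualMonoid (PointedCone.hull ℝ (t.1 : Set (Fin n → ℝ)) ⊓
        PointedCone.hull ℝ (t'.1 : Set (Fin n → ℝ))),
        ∃ N : ℕ, m + N • u ∈ dualMonoid (PointedCone.hull ℝ (t.1 : Set (Fin n → ℝ))) := by
    intro t t' u h0 h1
    refine ⟨fun v hv => hull_nonneg (fun w hw => ?_) hv, fun m hm => ?_⟩
    · by_cases hw' : w ∈ t'.1
      · exact (h0 w hw hw').ge
      · exact (h1 w hw hw').le
    · have hev : ∀ᶠ N : ℕ in Filter.atTop, ∀ v ∈ t.1, 0 ≤ toReal (m + N • u) ⬝ᵥ v := by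
        rw [Filter.eventually_all_finset]
        intro v hv
        by_cases hv' : v ∈ t'.1
        · refine Filter.Eventually.of_forall fun N => ?_
          rw [toReal_add, toReal_nsmul, add_dotProduct, smul_dotProduct, h0 v hv hv', smul_zero,
            add_zero]
          exact hm v ⟨Submodule.subset_span hv, Submodule.subset_span hv'⟩
        · have huv := h1 v hv hv'
          obtain ⟨M, hM⟩ := exists_nat_gt (-(toReal m ⬝ᵥ v) / (toReal u ⬝ᵥ v))
          rw [div_lt_iff₀ huv] at hM
          filter_upwards [Filter.eventually_ge_atTop M] with N hN
          have h2 : (M : ℝ) ≤ N := by exact_mod_cast hN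
          rw [toReal_add, toReal_nsmul, add_dotProduct, smul_dotProduct, smul_eq_mul]
          nlinarith
      obtain ⟨N, hN⟩ := hev.exists
      exact ⟨N, fun v hv => hull_nonneg hN hv⟩
  obtain ⟨u, h0, h1, h2⟩ := hK.exists_exponent_separating t t'
  obtain ⟨hl, hl'⟩ := aux t t' u h0 h1
  obtain ⟨hr, hr'⟩ := aux t' t (-u)
    (fun v hv hv' => by rw [toReal_neg, neg_dotProduct, h0 v hv' hv, neg_zero])
    (fun v hv hv' => by rw [toReal_neg, neg_dotProduct]; linarith [h2 v hv hv'])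
  exact ⟨u, hl, hr, hl', fun m hm => hr' m (by rwa [inf_comm])⟩

end IsRegularProjectiveTriangulation

/-- The cone of a maximal simplex. -/
def facetCone (t : K.facets) : triangulationFan K :=
  ⟨PointedCone.hull ℝ (t.1 : Set (Fin n → ℝ)), t.1, t.2.1, rfl⟩

/-- A point of an affine chart, in the chart of a maximal simplex. -/
def toFacet (hK : IsRegularProjectiveTriangulation P K) (p : Σ σ : triangulationFan K, AffineChart σ.1) :
    Σ t : K.facets, AffineChart (facetCone t).1 :=
  ⟨facetOf hK p.1, p.2.restrict (le_facetOf hK p.1)⟩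

/-- The parametrization of a toric variety by the charts of the maximal simplices. -/
def ofFacet (q : Σ t : K.facets, AffineChart (facetCone t).1) : ToricVariety (triangulationFan K) :=
  ToricVariety.mk ⟨facetCone q.1, q.2⟩

theorem glued_trans_facets (hK : IsRegularProjectiveTriangulation P K) {t t' t'' : K.facets}
    {x : AffineChart (facetCone t).1} {y : AffineChart (facetCone t').1}
    {w : AffineChart (facetCone t'').1} (hxy : Glued x y) (hyw : Glued y w) : Glued x w := by
  obtain ⟨u, hu⟩ := hK.exists_separates t t'
  obtain ⟨u', hu'⟩ := hK.exists_separates t' t''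
  obtain ⟨u'', hu''⟩ := hK.exists_separates t t''
  exact Glued.trans hu hu' hu'' hxy hyw

theorem ToricVariety.mk_eq_of_le {S : Set (PointedCone ℝ (Fin n → ℝ))} {σ τ : S} (h : σ.1 ≤ τ.1)
    (x : AffineChart σ.1) : ToricVariety.mk ⟨σ, x⟩ = ToricVariety.mk ⟨τ, x.restrict h⟩ :=
  Quot.sound ⟨x.restrict (le_inf le_rfl h), rfl, rfl⟩

theorem ofFacet_toFacet (hK : IsRegularProjectiveTriangulation P K)
    (p : Σ σ : triangulationFan K, AffineChart σ.1) : ofFacet (toFacet hK p) = ToricVariety.mk p :=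
  (ToricVariety.mk_eq_of_le (τ := facetCone (facetOf hK p.1)) (le_facetOf hK p.1) p.2).symm

/-- Equality in the quotient is the equivalence relation generated by gluing. Separating characters
are available between maximal simplices, so all points are moved to their charts, where gluing is
transitive and generates nothing new. -/
theorem glued_toFacet (hK : IsRegularProjectiveTriangulation P K)
    {p q : Σ σ : triangulationFan K, AffineChart σ.1} (h : ToricVariety.mk p = ToricVariety.mk q) :
    Glued (toFacet hK p).2 (toFacet hK q).2 := by
  have h1 := Quot.eqvGen_exact h
  clear h
  induction h1 with
  | rel p q h => exact Glued.restrict h (le_facetOf hK p.1) (le_facetOf hK q.1)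
  | refl p => exact glued_restrict (le_facetOf hK p.1) (le_facetOf hK p.1)
  | symm p q _ ih => exact ih.symm
  | trans p q r _ _ ih ih' => exact glued_trans_facets hK ih ih'

theorem ofFacet_eq_iff (hK : IsRegularProjectiveTriangulation P K) {t t' : K.facets}
    {x : AffineChart (facetCone t).1} {y : AffineChart (facetCone t').1} :
    ofFacet ⟨t, x⟩ = ofFacet ⟨t', y⟩ ↔ Glued x y := by
  constructor
  · intro h
    have h1 : ∀ (t : K.facets) (x : AffineChart (facetCone t).1),
        Glued x (toFacet hK ⟨facetCone t, x⟩).2 := fun t x =>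
      glued_restrict (x := x) le_rfl (le_facetOf hK (facetCone t))
    exact glued_trans_facets hK (h1 t x) (glued_trans_facets hK (glued_toFacet hK h) (h1 t' y).symm)
  · exact fun h => Quot.sound h

theorem isOpenQuotientMap_ofFacet (hK : IsRegularProjectiveTriangulation P K) :
    IsOpenQuotientMap (ofFacet (K := K)) where
  surjective := by
    rintro ⟨p⟩
    exact ⟨_, ofFacet_toFacet hK p⟩
  continuous := continuous_sigma fun t => continuous_quot_mk.comp
    (continuous_sigmaMk (σ := fun τ : triangulationFan K => AffineChart τ.1) (i := facetCone t))
  isOpenMap := by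
    rw [isOpenMap_sigma]
    intro t W hW
    rw [ToricVariety.isOpen_iff]
    intro σ
    obtain ⟨u, hu⟩ := hK.exists_separates t (facetOf hK σ)
    have h1 := (hu.isOpen_glued hW).preimage (continuous_restrict (le_facetOf hK σ))
    convert h1 using 1
    ext x
    constructor
    · rintro ⟨y, hy, hyx⟩
      refine ⟨y, hy, (ofFacet_eq_iff hK).1 (hyx.trans ?_)⟩
      exact (ofFacet_toFacet hK ⟨σ, x⟩).symm
    · rintro ⟨y, hy, hyx⟩
      exact ⟨y, hy, ((ofFacet_eq_iff hK).2 hyx).trans (ofFacet_toFacet hK ⟨σ, x⟩)⟩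

/-- The quotient map from the maximal charts is open, so it suffices that its relation is closed. On
each pair of charts this is `isClosed_glued`. -/
theorem t2Space_triangulationVariety (hK : IsRegularProjectiveTriangulation P K) :
    T2Space (triangulationVariety K) := by
  refine (t2Space_iff_of_isOpenQuotientMap (isOpenQuotientMap_ofFacet hK)).2 ?_
  rw [← isOpen_compl_iff, isOpen_iff_mem_nhds]
  rintro ⟨⟨t, x⟩, ⟨t', y⟩⟩ h
  obtain ⟨u, hu⟩ := hK.exists_separates t t'
  have e := (Topology.IsOpenEmbedding.sigmaMk (σ := fun t : K.facets => AffineChart (facetCone t).1)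
    (i := t)).prodMap (Topology.IsOpenEmbedding.sigmaMk
    (σ := fun t : K.facets => AffineChart (facetCone t).1) (i := t'))
  refine (e.map_nhds_eq (x, y)).ge (Filter.mem_map.2 ?_)
  refine Filter.mem_of_superset (hu.isClosed_glued.isOpen_compl.mem_nhds (x := (x, y))
    fun hxy => h ((ofFacet_eq_iff hK).2 hxy)) ?_
  exact fun p hp hp' => hp ((ofFacet_eq_iff hK).1 hp')

end Separation

/-! ### The resolution is compact -/

section Compactness
variable {n : ℕ} {P : Set (Fin n → ℝ)} {K : Geometry.SimplicialComplex ℝ (Fin n → ℝ)}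
open AffineChart

/-- The image consists of the functions with value one at `0`, zero off the monoid and
multiplicative on it, and these are closed conditions. -/
theorem isClosedEmbedding_char (σ : PointedCone ℝ (Fin n → ℝ)) :
    Topology.IsClosedEmbedding fun (x : AffineChart σ) m => char m x := by
  refine ⟨⟨⟨rfl⟩, fun x y h => AffineChart.ext fun m _ => congrFun h m⟩, ?_⟩
  have key : (Set.range fun (x : AffineChart σ) m => char m x) = {g : (Fin n → ℤ) → ℂ | g 0 = 1} ∩
      ({g | ∀ m, m ∉ dualMonoid σ → g m = 0} ∩ {g | ∀ m ∈ dualMonoid σ, ∀ m' ∈ dualMonoid σ,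
        g (m + m') = g m * g m'}) := by
    ext g
    constructor
    · rintro ⟨x, rfl⟩
      exact ⟨char_zero x, fun m hm => dif_neg hm, fun m hm m' hm' => char_add hm hm' x⟩
    · rintro ⟨h0, hz, hadd⟩
      refine ⟨ofChar g h0 hadd, funext fun m => ?_⟩
      by_cases hm : m ∈ dualMonoid σ
      · exact char_ofChar hm
      · exact (dif_neg hm).trans (hz m hm).symm
  rw [key]
  refine (isClosed_eq (continuous_apply 0) continuous_const).inter (IsClosed.inter ?_ ?_)
  · simp only [Set.ofPred_forall]
    exact isClosed_iInter fun m => isClosed_iInter fun _ =>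
      isClosed_eq (continuous_apply m) continuous_const
  · simp only [Set.ofPred_forall]
    exact isClosed_iInter fun m => isClosed_iInter fun _ => isClosed_iInter fun m' =>
      isClosed_iInter fun _ => isClosed_eq (continuous_apply _)
        ((continuous_apply m).mul (continuous_apply m'))

/-- The points of an affine chart at which all regular characters are bounded by one. -/
def polydisc (σ : PointedCone ℝ (Fin n → ℝ)) : Set (AffineChart σ) := {x | ∀ m, ‖char m x‖ ≤ 1}

/-- Tychonoff's theorem for a product of closed discs, pulled back along the closed embedding by
characters. -/
theorem isCompact_polydisc (σ : PointedCone ℝ (Fin n → ℝ)) : IsCompact (polydisc σ) := by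
  have h1 : IsCompact (Set.pi Set.univ fun _ : Fin n → ℤ => Metric.closedBall (0 : ℂ) 1) :=
    isCompact_univ_pi fun _ => isCompact_closedBall 0 1
  convert (isClosedEmbedding_char σ).isCompact_preimage h1 using 1
  ext x
  simp [polydisc, Set.mem_pi]

theorem mem_dualMonoid_bot (m : Fin n → ℤ) : m ∈ dualMonoid (⊥ : PointedCone ℝ (Fin n → ℝ)) := by
  intro v hv
  rw [(Submodule.mem_bot _).1 hv, dotProduct_zero]

theorem char_bot_ne_zero (z : AffineChart (⊥ : PointedCone ℝ (Fin n → ℝ))) (m : Fin n → ℤ) :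
    char m z ≠ 0 := by
  have h := char_add (mem_dualMonoid_bot m) (mem_dualMonoid_bot (-m)) z
  rw [add_neg_cancel, char_zero] at h
  exact left_ne_zero_of_mul (h ▸ one_ne_zero)

/-- The logarithm of the absolute value of the characters at a point of the torus is linear. -/
theorem exists_log_norm_char (z : AffineChart (⊥ : PointedCone ℝ (Fin n → ℝ))) :
    ∃ w : Fin n → ℝ, ∀ m, Real.log ‖char m z‖ = -(toReal m ⬝ᵥ w) := by
  let l : (Fin n → ℤ) →+ ℝ := AddMonoidHom.mk' (fun m => Real.log ‖char m z‖) fun m m' => by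
    rw [char_add (mem_dualMonoid_bot m) (mem_dualMonoid_bot m'), norm_mul, Real.log_mul
      (norm_ne_zero_iff.2 (char_bot_ne_zero z m)) (norm_ne_zero_iff.2 (char_bot_ne_zero z m'))]
  refine ⟨fun i => -l (Pi.single i 1), fun m => ?_⟩
  change l m = _
  conv_lhs => rw [← Finset.univ_sum_single m]
  rw [map_sum, dotProduct, ← Finset.sum_neg_distrib]
  refine Finset.sum_congr rfl fun i _ => ?_
  rw [show (Pi.single i (m i) : Fin n → ℤ) = m i • Pi.single i 1 by
    rw [← Pi.single_smul', smul_eq_mul, mul_one], map_zsmul, zsmul_eq_mul, mul_neg, neg_neg]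
  rfl

namespace IsRegularProjectiveTriangulation

/-- The cones of the maximal simplices cover the space. -/
theorem exists_mem_hull (hK : IsRegularProjectiveTriangulation P K) (hP : IsReflexive P)
    (w : Fin n → ℝ) : ∃ t : K.facets, w ∈ PointedCone.hull ℝ (t.1 : Set (Fin n → ℝ)) := by
  have hev : ∀ᶠ c in nhdsWithin (0 : ℝ) (Set.Ioi 0), c • w ∈ P := by
    have hcont : Filter.Tendsto (fun c : ℝ => c • w) (nhdsWithin (0 : ℝ) (Set.Ioi 0))
        (nhds ((0 : ℝ) • w)) :=
      ((continuous_id.smul continuous_const).tendsto 0).mono_left nhdsWithin_le_nhds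
    rw [zero_smul] at hcont
    exact hcont.eventually (mem_interior_iff_mem_nhds.1 hP.zero_mem_interior)
  obtain ⟨c, hc, hc0⟩ := (hev.and self_mem_nhdsWithin).exists
  have hc0 : 0 < c := hc0
  rw [← hK.space_eq, Geometry.SimplicialComplex.mem_space_iff] at hc
  obtain ⟨s, hs, hcs⟩ := hc
  obtain ⟨t, ht, hst⟩ := hK.exists_facet hs
  refine ⟨⟨t, ht⟩, ?_⟩
  have hconv : Convex ℝ (PointedCone.hull ℝ (t : Set (Fin n → ℝ)) : Set (Fin n → ℝ)) :=
    (PointedCone.hull ℝ (t : Set (Fin n → ℝ))).toConvexCone.convex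
  have h1 : c • w ∈ PointedCone.hull ℝ (t : Set (Fin n → ℝ)) :=
    convexHull_min Submodule.subset_span hconv (convexHull_mono hst hcs)
  have h2 := Submodule.smul_mem _ (⟨c⁻¹, (inv_pos.2 hc0).le⟩ : NNReal) h1
  rwa [show (⟨c⁻¹, (inv_pos.2 hc0).le⟩ : NNReal) • c • w = c⁻¹ • c • w from rfl,
    inv_smul_smul₀ hc0.ne'] at h2

/-- A point of the torus lies in the polydisc of some maximal simplex. -/
theorem exists_restrict_mem_polydisc (hK : IsRegularProjectiveTriangulation P K)
    (hP : IsReflexive P) (z : AffineChart (⊥ : PointedCone ℝ (Fin n → ℝ))) :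
    ∃ t : K.facets, z.restrict bot_le ∈ polydisc (facetCone t).1 := by
  -- For `w` in the cone of `t` and `m` in the dual monoid, `log |χ^m(z)| = -⟨m, w⟩ ≤ 0`, so it is
  -- enough that the cones cover the space.
  obtain ⟨w, hw⟩ := exists_log_norm_char z
  obtain ⟨t, ht⟩ := hK.exists_mem_hull hP w
  refine ⟨t, fun m => ?_⟩
  by_cases hm : m ∈ dualMonoid (facetCone t).1
  · rw [char_restrict _ hm]
    have h1 := hm w ht
    rw [← Real.log_nonpos_iff (norm_nonneg _), hw]
    linarith
  · rw [char, dif_neg hm, norm_zero]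
    exact zero_le_one

/-- The torus is dense in the chart of a maximal simplex. -/
theorem mem_closure_torus (hK : IsRegularProjectiveTriangulation P K) (t : K.facets)
    (x : AffineChart (facetCone t).1) : x ∈ closure (Set.range fun z : AffineChart
      (⊥ : PointedCone ℝ (Fin n → ℝ)) => (z.restrict bot_le : AffineChart (facetCone t).1)) := by
  classical
  let s := t.1.erase 0
  -- The lattice points `e v` are dual to the nonzero vertices of `t`. By unimodularity every `m` in
  -- the monoid is a combination of them with natural coefficients, so the characters `e v` are
  -- coordinates on the chart.
  let e : (Fin n → ℝ) → Fin n → ℤ := fun v => hK.exponent (fun v' => if v' = v then 1 else 0) t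
  have he : ∀ v, ∀ v' ∈ s, latticeDot v' (e v) = if v' = v then 1 else 0 := by
    intro v v' hv'
    have h1 := hK.exponent_dot (fun v' => if v' = v then 1 else 0) t v' (Finset.mem_of_mem_erase hv')
      (Finset.ne_of_mem_erase hv')
    rw [← latticeDot_cast (hK.lattice _ t.2.1 v' (Finset.mem_of_mem_erase hv'))] at h1
    exact Int.cast_injective h1
  have hem : ∀ v, e v ∈ dualMonoid (facetCone t).1 := by
    intro v u hu
    refine hull_nonneg (fun w hw => ?_) hu
    by_cases hw0 : w = 0
    · simp [hw0]
    · rw [hK.exponent_dot _ t w hw hw0]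
      split_ifs <;> simp
  have hdot : ∀ m ∈ dualMonoid (facetCone t).1, ∀ v ∈ s, 0 ≤ latticeDot v m := by
    intro m hm v hv
    have h1 := hm v (Submodule.subset_span (Finset.mem_of_mem_erase hv))
    rw [← latticeDot_cast (hK.lattice _ t.2.1 v (Finset.mem_of_mem_erase hv))] at h1
    exact_mod_cast h1
  have hchar : ∀ m ∈ dualMonoid (facetCone t).1,
      char m x = ∏ v ∈ s, char (e v) x ^ latticeDot v m := by
    intro m hm
    have h1 : m = ∑ v ∈ s, (latticeDot v m).toNat • e v := by
      refine hK.eq_of_dot_eq t fun v hv hv0 => ?_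
      have hvs : v ∈ s := Finset.mem_erase.2 ⟨hv0, hv⟩
      rw [← latticeDot_cast (hK.lattice _ t.2.1 v hv), ← latticeDot_cast (hK.lattice _ t.2.1 v hv),
        map_sum]
      simp only [map_nsmul]
      rw [Finset.sum_eq_single v (fun w hw hwv => by rw [he w v hvs, if_neg hwv.symm, smul_zero])
        (fun h => absurd hvs h), he v v hvs, if_pos rfl, nsmul_eq_mul, mul_one,
        Int.toNat_of_nonneg (hdot m hm v hvs)]
    have h2 : ∀ (s' : Finset (Fin n → ℝ)) (k : (Fin n → ℝ) → ℕ),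
        char (∑ v ∈ s', k v • e v) x = ∏ v ∈ s', char (e v) x ^ k v := by
      intro s' k
      induction s' using Finset.induction_on with
      | empty => rw [Finset.sum_empty, Finset.prod_empty, char_zero]
      | insert v s' hv ih =>
        rw [Finset.sum_insert hv, Finset.prod_insert hv, char_add (nsmul_mem (hem v) _)
          (sum_mem fun w _ => nsmul_mem (hem w) _), ih, char_nsmul (hem v)]
    conv_lhs => rw [h1]
    rw [h2]
    refine Finset.prod_congr rfl fun v hv => ?_
    rw [← zpow_natCast, Int.toNat_of_nonneg (hdot m hm v hv)]
  -- The vanishing coordinates of `x` are replaced by `c ≠ 0`; this gives points of the torus that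
  -- tend to `x` as `c` tends to zero.
  let y : ℂ → (Fin n → ℝ) → ℂ := fun c v => if char (e v) x = 0 then c else char (e v) x
  have hy : ∀ c, c ≠ 0 → ∀ v, y c v ≠ 0 := by
    intro c hc v
    dsimp only [y]
    split_ifs with h
    · exact hc
    · exact h
  let z : {c : ℂ // c ≠ 0} → AffineChart (⊥ : PointedCone ℝ (Fin n → ℝ)) := fun c =>
    ofChar (fun m => ∏ v ∈ s, y c.1 v ^ latticeDot v m) (by simp) fun m _ m' _ => by
      rw [← Finset.prod_mul_distrib]
      refine Finset.prod_congr rfl fun v _ => ?_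
      rw [map_add, zpow_add₀ (hy c.1 c.2 v)]
  have hne : (Filter.comap (Subtype.val : {c : ℂ // c ≠ 0} → ℂ) (nhds 0)).NeBot :=
    mem_closure_iff_comap_neBot.1 (dense_compl_singleton (0 : ℂ) 0)
  refine mem_closure_of_tendsto (f := fun c => (z c).restrict bot_le)
    (b := Filter.comap (Subtype.val : {c : ℂ // c ≠ 0} → ℂ) (nhds 0)) ?_
    (Filter.Eventually.of_forall fun c => ⟨z c, rfl⟩)
  rw [(isClosedEmbedding_char (facetCone t).1).isInducing.tendsto_nhds_iff, tendsto_pi_nhds]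
  intro m
  by_cases hm : m ∈ dualMonoid (facetCone t).1
  · have h1 : ∀ c, char m ((z c).restrict bot_le : AffineChart (facetCone t).1) =
        ∏ v ∈ s, y c.1 v ^ latticeDot v m := fun c =>
      (char_restrict _ hm _).trans (char_ofChar (mem_dualMonoid_bot m))
    simp only [Function.comp_def, h1, hchar m hm]
    refine tendsto_finsetProd _ fun v hv => ?_
    -- The limit may be zero, so the exponents have to be nonnegative; they are, for `m` in the dual
    -- monoid.
    refine Filter.Tendsto.zpow₀ ?_ _ (Or.inr (hdot m hm v hv))
    dsimp only [y]
    split_ifs with h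
    · rw [h]
      exact Filter.tendsto_comap
    · exact tendsto_const_nhds
  · have h1 : ∀ x : AffineChart (facetCone t).1, char m x = 0 := fun x => dif_neg hm
    simp only [Function.comp_def, h1]
    exact tendsto_const_nhds

end IsRegularProjectiveTriangulation

/-- The finite union of the polydiscs of the maximal simplices is compact, hence closed in this
Hausdorff space. It contains the torus, which is dense in every chart, so it is everything. -/
theorem compactSpace_triangulationVariety (hP : IsReflexive P)
    (hK : IsRegularProjectiveTriangulation P K) : CompactSpace (triangulationVariety K) := by
  have := t2Space_triangulationVariety hK
  have : Finite K.facets := hK.finite.subset fun t ht => ht.1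
  have hcont : ∀ t : K.facets, Continuous fun x => ofFacet (K := K) ⟨t, x⟩ := fun t =>
    (isOpenQuotientMap_ofFacet hK).continuous.comp
      (continuous_sigmaMk (σ := fun t : K.facets => AffineChart (facetCone t).1))
  let C : Set (triangulationVariety K) :=
    ⋃ t : K.facets, (fun x => ofFacet ⟨t, x⟩) '' polydisc (facetCone t).1
  have hC : IsCompact C := isCompact_iUnion fun t => (isCompact_polydisc _).image (hcont t)
  have htop : C = Set.univ := by
    rw [Set.eq_univ_iff_forall]
    intro q
    obtain ⟨⟨t, x⟩, rfl⟩ := (isOpenQuotientMap_ofFacet hK).surjective q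
    rw [← hC.isClosed.closure_eq]
    refine map_mem_closure (f := fun x => ofFacet ⟨t, x⟩) (hcont t) (hK.mem_closure_torus t x) ?_
    rintro _ ⟨z, rfl⟩
    obtain ⟨t', ht'⟩ := hK.exists_restrict_mem_polydisc hP z
    exact Set.mem_iUnion.2 ⟨t', _, ht', (ofFacet_eq_iff hK).2 (glued_restrict _ _)⟩
  exact ⟨htop ▸ hC⟩

end Compactness
end ToricCup

end

theorem mainTheorem7 (n : ℕ) (Δ : Set (Fin n → ℝ)) (hΔ : IsReflexive Δ)
    (K : Geometry.SimplicialComplex ℝ (Fin n → ℝ)) (hK : IsRegularProjectiveTriangulation Δ K)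
    (f : (Fin n → ℤ) →₀ ℂ) (hf : IsRegularSection (polarDual Δ) f) :
    (totalCup ℂ (divisorClass ℂ (anticanonical hK))
        (constComplex ℂ (triangulationVariety K))).rank =
      (totalCup ℚ (divisorClass ℚ (hypersurface hΔ f hf.mem))
        ((derivedPushforward ℚ (resolution hΔ hK)).obj
          (constComplex ℚ (triangulationVariety K)))).rank ∧
    (totalCup ℚ (divisorClass ℚ (anticanonical hK))
        (constComplex ℚ (triangulationVariety K))).rank =
      (totalCup ℚ (divisorClass ℚ (hypersurface hΔ f hf.mem))
        ((derivedPushforward ℚ (resolution hΔ hK)).obj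
          (constComplex ℚ (triangulationVariety K)))).rank := by
  have := t2Space_triangulationVariety hK
  have := compactSpace_triangulationVariety hΔ hK
  -- Crepancy gives `π^*[Y] = [-D₀]`, and adjunction converts the cup product on the derived direct
  -- image into the cup product with `-D₀` on the resolution.
  obtain ⟨m⟩ := exists_resolutionFrameMap hΔ hK f hf.mem
  obtain ⟨φ, hφ⟩ := m.exists_iso
  obtain ⟨E⟩ := nonempty_cupEquiv_pushforward ℚ (resolution hΔ hK) (anticanonical hK)
    (hypersurface hΔ f hf.mem) φ hφ
  have h := rank_totalCup_eq E.symm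
  -- Compactness and Hausdorffness enter in the passage from `ℚ` to `ℂ`, which concerns the
  -- resolution alone.
  exact ⟨(rank_totalCup_divisorClass_eq (anticanonical hK) ℚ ℂ).trans h, h⟩
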